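/- **Setting.** Let $\Omega=(0,L_0)\times(0,L_1)$ with $L_0,L_1>0$, let $\epsilon\in(0,1)$, and impose periodic boundary conditions on $\Omega$; $\|\cdot\|$ and $(\cdot,\cdot)$ are the norm and inner product of $L^2(\Omega)$, $\Delta$ is the (weak) periodic Laplacian, and $\|v\|_{-1}^2=((-\Delta)^{-1}v,v)$ for mean-zero $v$. The phase field crystal (PFC) equation is $$\partial_t\Phi=\Delta\mu,\qquad \mu=(1+\Delta)^2\Phi+\Phi^3-\epsilon\Phi .$$ Let $k\in\{3,4,5\}$, $T>0$, $N\ge 1$, $\tau=T/N$, $t_n=n\tau$, $\Phi^n=\Phi(t_n)$ and $\nabla_\tau v^n=v^n-v^{n-1}$. The kernels $b_j$ are given by $\sum_{\ell=1}^{k}\frac1\ell(1-\zeta)^{\ell-1}=\sum_{j=0}^{k-1}b_j\zeta^j$ ($b_j=0$ for $j\ge k$), and $D_kv^n=\frac1\tau\sum_{j=1}^n b_{n-j}\nabla_\tau v^j$. The BDF-$k$ scheme is $$D_k\phi^n=\Delta\mu^n,\qquad \mu^n=(1+\Delta)^2\phi^n+(\phi^n)^3-\epsilon\phi^n,\qquad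 k\le n\le N,$$ with given starting values $\phi^0,\dots,\phi^{k-1}\in L^2(\Omega)$. The energy is $E[u]=\frac12\|(1+\Delta)u\|^2+\frac14\|u^2-\epsilon\|^2-\frac14\epsilon^2|\Omega|$ and the modified energy is $$\mathcal E_k[\vec\phi^{\,n}]=E[\phi^n]+\tfrac1\tau\,\mathcal G_k[\nabla_\tau\vec\phi^{\,n}],$$ where, with $v_j=\nabla_\tau\phi^j$ and $\delta v_n=v_n-v_{n-1}$, $$\mathcal G_3=\tfrac16\|v_n\|_{-1}^2+\tfrac16\|\tfrac74v_n-v_{n-1}\|_{-1}^2,$$ $$\mathcal G_4=\tfrac{13627}{43008}\|v_n\|_{-1}^2+\tfrac7{24}\|\tfrac{65}{56}v_n-v_{n-1}\|_{-1}^2+\tfrac18\|\tfrac32\delta v_n+v_{n-2}\|_{-1}^2,$$ $$\mathcal G_5=\tfrac{1198850903}{1678080000}\|v_n\|_{-1}^2+\tfrac{437}{900}\|\tfrac{4931}{6992}v_n-v_{n-1}\|_{-1}^2+\tfrac9{40}\|\tfrac{23}{18}\delta v_n+v_{n-2}\|_{-1}^2+\tfrac1{10}\|2\delta v_n+2v_{n-2}-v_{n-3}\|_{-1}^2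 .$$ **Assumption A2 (with constant $c_0$).** The starting values preserve the volume, $(\phi^\ell,1)=(\phi^0,1)$ for $1\le\ell\le k-1$; $\tau\le\frac{2}{3\epsilon}\min\{b_0,\sigma_{Lk}\}$ with $\sigma_{L3}=\frac{95}{48}$, $\sigma_{L4}=\frac{4919}{3072}$, $\sigma_{L5}=\frac{646631}{1920000}$; and $\phi^{k-1}\in H^2(\Omega)$ (periodic) with $\mathcal E_k[\vec\phi^{\,k-1}]\le c_0$. **Constants.** Put $\rho_3=\frac{10}3$, $\rho_4=6$, $\rho_5=\frac{96}5$; $\mathfrak m_{13}=\frac{95}{48}$, $\mathfrak m_{14}=1.628$, $\mathfrak m_{15}=0.3711$; $\mathfrak m_{3k}=\frac{7\rho_k}{2(7-k)}$. Let $\theta_0=1/b_0$ and $\theta_m=-\frac1{b_0}\sum_{i=0}^{m-1}\theta_i b_{m-i}$ for $m\ge1$. **Theorem.** There are constants as follows. * For each $k\in\{3,4,5\}$, constants $\mathfrak m_{2k}>0$ and $c_{I,k}>1$ depending only on $k$, such that $\lambda_{\max}(B^{T}B)\le\mathfrak m_{2k}$ for the lower triangular Toeplitz matrix $B=(b_{i-j})_{j\le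 i}$ of every order, and such that for every real sequence $(v^n)$ and all $n\ge k$ $$\Big|\sum_{\ell=1}^{k-1}\nabla_\tau v^\ell\sum_{j=k}^n\theta_{n-j}b_{j-\ell}\Big|\le\frac{c_{I,k}\rho_k}8\Big(\frac k7\Big)^{n-k}\sum_{\ell=1}^{k-1}|\nabla_\tau v^\ell| .$$ * For each $\Omega$, a constant $c_\Omega>0$ depending only on $\Omega$, such that $\|v\|_{L^\infty}\le c_\Omega(\|v\|+\|\Delta v\|)$ for all periodic $v\in H^2(\Omega)$. * For all $\Omega$, $\epsilon$ and initial data $\Phi_0$, a constant $c_2>0$ depending only on these, such that $\|\Phi(t)\|_{L^\infty}\le c_2$ for all $t\in[0,T]$, for every $T>0$, every $k\in\{3,4,5\}$ and every solution $\Phi\in C^{k+1}([0,T];L^2(\Omega))$ of the PFC equation on $[0,T]$ with $\Phi(0)=\Phi_0$. * For each such $k$, $T$ and $\Phi$, a constant $C_\phi>0$ independent of $N$, $\tau$, $c_0$ and of the numerical solution. For given $c_0$, put $$c_1=c_\Omega\sqrt{8c_0+2(2+\epsilon)^2|\Omega|},\quad c_3=c_2^2+c_1c_2+c_1^2+\epsilon,\quad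 c_4=\frac{250\,\mathfrak m_{2k}^2}{\mathfrak m_{1k}^5}+\frac{2c_3^2\,\mathfrak m_{2k}\mathfrak m_{3k}}{\mathfrak m_{1k}^2}.$$ If $\phi^0,\dots,\phi^N$ satisfies the BDF-$k$ scheme, A2 holds with $c_0$, and $\tau\le 1/(2c_4)$, then for all $k\le n\le N$ $$\|\Phi^n-\phi^n\|\le\frac{7\rho_k}{7-k}\exp(2c_4t_{n-k+1})\Big(c_{I,k}\sum_{\ell=0}^{k-1}\|\Phi^\ell-\phi^\ell\|+C_\phi\,t_{n-k+1}\,\tau^k\Big).$$ -/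

import Mathlib

open MeasureTheory
open scoped ContDiff InnerProductSpace

noncomputable section

namespace PFC

/-! ### BDF kernels, DOC kernels and the constants attached to them -/

/-- The BDF-`k` kernels `b_j`, generated by
`∑_{ℓ=1}^{k} (1/ℓ) (1 - ζ)^{ℓ-1} = ∑_j b_j ζ^j` (so `b_j = 0` for `j ≥ k`). -/
def bdfKernel (k j : ℕ) : ℝ :=
  (∑ l ∈ Finset.Icc 1 k,
    Polynomial.C (1 / (l : ℝ)) * (1 - Polynomial.X) ^ (l - 1) : Polynomial ℝ).coeff j

/-- The backward difference `v^n - v^{n-1}` (used for `n ≥ 1` only). -/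
def backDiff {V : Type*} [AddCommGroup V] (v : ℕ → V) (n : ℕ) : V := v n - v (n - 1)

/-- The BDF-`k` formula `D_k v^n = (1/τ) ∑_{j=1}^{n} b_{n-j} (v^j - v^{j-1})`. -/
def bdf {V : Type*} [AddCommGroup V] [Module ℝ V] (k : ℕ) (τ : ℝ) (v : ℕ → V) (n : ℕ) : V :=
  (1 / τ) • ∑ j ∈ Finset.Icc 1 n, bdfKernel k (n - j) • backDiff v j

/-- The discrete orthogonal convolution kernels `θ_j` of the BDF-`k` kernels:
`θ_0 = 1 / b_0` and `θ_m = -(1 / b_0) ∑_{i=0}^{m-1} θ_i b_{m-i}`. -/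
def docKernel (k : ℕ) : ℕ → ℝ
  | 0 => 1 / bdfKernel k 0
  | m + 1 => -(1 / bdfKernel k 0) *
      ∑ i : Fin (m + 1), docKernel k i * bdfKernel k (m + 1 - (i : ℕ))
  decreasing_by exact i.2

/-- The starting effect
`v_I^{(k,n)} = ∑_{ℓ=1}^{k-1} (v^ℓ - v^{ℓ-1}) ∑_{j=k}^{n} θ_{n-j} b_{j-ℓ}`. -/
def startingEffect (k : ℕ) (v : ℕ → ℝ) (n : ℕ) : ℝ :=
  ∑ l ∈ Finset.Icc 1 (k - 1), backDiff v l *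
    ∑ j ∈ Finset.Icc k n, docKernel k (n - j) * bdfKernel k (j - l)

/-- The lower triangular Toeplitz matrix of order `m` built from the BDF-`k` kernels. -/
def bdfMatrix (k m : ℕ) : Matrix (Fin m) (Fin m) ℝ :=
  Matrix.of fun i j => if j ≤ i then bdfKernel k ((i : ℕ) - (j : ℕ)) else 0

/-- The constants `ρ_k`, for `k = 3, 4, 5`. -/
def rho : ℕ → ℝ
  | 3 => 10 / 3
  | 4 => 6
  | 5 => 96 / 5
  | _ => 0

/-- The constants `σ_{Lk}`, for `k = 3, 4, 5`. -/
def sigmaL : ℕ → ℝ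
  | 3 => 95 / 48
  | 4 => 4919 / 3072
  | 5 => 646631 / 1920000
  | _ => 0

/-- The constants `𝔪_{1k}`, for `k = 3, 4, 5`. -/
def m1 : ℕ → ℝ
  | 3 => 95 / 48
  | 4 => 1.628
  | 5 => 0.3711
  | _ => 0

/-- The constants `𝔪_{3k} = 7 ρ_k / (2 (7 - k))`. -/
def m3 (k : ℕ) : ℝ := 7 * rho k / (2 * (7 - (k : ℝ)))

/-- The nonnegative quadratic functionals `𝒢_k` of the discrete gradient structure, evaluated at
`(v_n, v_{n-1}, …)`, where `q` is the quadratic form that replaces squaring. -/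
def gradFunctional {V : Type*} [AddCommGroup V] [Module ℝ V]
    (k : ℕ) (q : V → ℝ) (v : ℕ → V) (n : ℕ) : ℝ :=
  match k with
  | 3 => 1 / 6 * q (v n) + 1 / 6 * q ((7 / 4 : ℝ) • v n - v (n - 1))
  | 4 => 13627 / 43008 * q (v n) + 7 / 24 * q ((65 / 56 : ℝ) • v n - v (n - 1))
      + 1 / 8 * q ((3 / 2 : ℝ) • (v n - v (n - 1)) + v (n - 2))
  | 5 => 1198850903 / 1678080000 * q (v n)
      + 437 / 900 * q ((4931 / 6992 : ℝ) • v n - v (n - 1))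
      + 9 / 40 * q ((23 / 18 : ℝ) • (v n - v (n - 1)) + v (n - 2))
      + 1 / 10 * q ((2 : ℝ) • (v n - v (n - 1)) + (2 : ℝ) • v (n - 2) - v (n - 3))
  | _ => 0

/-! ### Periodic functions on a rectangle -/

/-- The period cell `Ω = (0, L₀) × (0, L₁)`. -/
def cell (L : Fin 2 → ℝ) : Set (EuclideanSpace ℝ (Fin 2)) :=
  {x | ∀ i, x i ∈ Set.Ioo 0 (L i)}

/-- Lebesgue measure on the period cell. -/
abbrev cellMeasure (L : Fin 2 → ℝ) : Measure (EuclideanSpace ℝ (Fin 2)) :=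
  volume.restrict (cell L)

/-- The real Hilbert space `L²(Ω)`. -/
abbrev L2 (L : Fin 2 → ℝ) : Type := Lp ℝ 2 (cellMeasure L)

/-- Smooth functions on the plane that are `Ω`-periodic. -/
def IsPeriodicTest (L : Fin 2 → ℝ) (ψ : EuclideanSpace ℝ (Fin 2) → ℝ) : Prop :=
  ContDiff ℝ ∞ ψ ∧ ∀ x i, ψ (x + EuclideanSpace.single i (L i)) = ψ x

/-- `w ∈ L²(Ω)` is the weak Laplacian of `u ∈ L²(Ω)` under periodic boundary conditions. -/
def HasLaplacian (L : Fin 2 → ℝ) (u w : L2 L) : Prop :=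
  ∀ ψ : EuclideanSpace ℝ (Fin 2) → ℝ, IsPeriodicTest L ψ →
    ∫ x, u x * Laplacian.laplacian ψ x ∂(cellMeasure L) = ∫ x, w x * ψ x ∂(cellMeasure L)

/-- Membership in the periodic Sobolev space `H²(Ω)`; on a periodic cell this is the domain of
the weak Laplacian. -/
def InH2 (L : Fin 2 → ℝ) (u : L2 L) : Prop := ∃ w : L2 L, HasLaplacian L u w

open Classical in
/-- The weak Laplacian of `u` (unique where it exists, and `0` by convention elsewhere). -/
def lap (L : Fin 2 → ℝ) (u : L2 L) : L2 L :=
  if h : InH2 L u then h.choose else 0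

/-- The integral `(u, 1)` over the cell. -/
def mean (L : Fin 2 → ℝ) (u : L2 L) : ℝ := ∫ x, u x ∂(cellMeasure L)

open Classical in
/-- `(-Δ)⁻¹ v` for mean-zero `v`: the mean-zero `g` with `-Δ g = v`. -/
def invNegLap (L : Fin 2 → ℝ) (v : L2 L) : L2 L :=
  if h : ∃ g : L2 L, mean L g = 0 ∧ HasLaplacian L g (-v) then h.choose else 0

/-- The squared `H⁻¹` norm `‖v‖²_{-1} = ((-Δ)⁻¹ v, v)` of a mean-zero `v`. -/
def negNormSq (L : Fin 2 → ℝ) (v : L2 L) : ℝ := ⟪invNegLap L v, v⟫_ℝ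

/-! ### The phase field crystal equation and its BDF discretization -/

/-- `u` is regular enough and `μ = (1 + Δ)² u + u³ - ε u` in `L²(Ω)`. -/
def IsChemicalPotential (L : Fin 2 → ℝ) (ε : ℝ) (u μ : L2 L) : Prop :=
  InH2 L u ∧ InH2 L (u + lap L u) ∧
    ∀ᵐ x ∂(cellMeasure L),
      μ x = ((u + lap L u) + lap L (u + lap L u)) x + (u x) ^ 3 - ε * u x

/-- `Φ` solves `∂_t Φ = Δ μ`, `μ = (1 + Δ)² Φ + Φ³ - ε Φ` on `[0, T]`, periodically in space. -/
def IsPFCSolution (L : Fin 2 → ℝ) (ε T : ℝ) (Φ : ℝ → L2 L) : Prop :=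
  ∀ t ∈ Set.Icc 0 T, ∃ μ : L2 L, IsChemicalPotential L ε (Φ t) μ ∧
    HasLaplacian L μ (derivWithin Φ (Set.Icc 0 T) t)

/-- `φ^0, …, φ^N` satisfies the BDF-`k` implicit scheme `D_k φ^n = Δ μ^n`,
`μ^n = (1 + Δ)² φ^n + (φ^n)³ - ε φ^n` for `k ≤ n ≤ N`. -/
def IsBDFSolution (k : ℕ) (L : Fin 2 → ℝ) (ε τ : ℝ) (N : ℕ) (φ : ℕ → L2 L) : Prop :=
  ∀ n, k ≤ n → n ≤ N → ∃ μ : L2 L, IsChemicalPotential L ε (φ n) μ ∧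
    HasLaplacian L μ (bdf k τ φ n)

/-- The free energy `E[u] = ½‖(1 + Δ)u‖² + ¼‖u² - ε‖² - ¼‖ε‖²`. -/
def energy (L : Fin 2 → ℝ) (ε : ℝ) (u : L2 L) : ℝ :=
  1 / 2 * ‖u + lap L u‖ ^ 2
    + 1 / 4 * ∫ x, ((u x) ^ 2 - ε) ^ 2 ∂(cellMeasure L)
    - 1 / 4 * (ε ^ 2 * volume.real (cell L))

/-- The modified energy `E[φ^n] + (1/τ) (𝒢_k[∇_τ φ^n], 1)_{-1}`. -/
def modifiedEnergy (k : ℕ) (L : Fin 2 → ℝ) (ε τ : ℝ) (φ : ℕ → L2 L) (n : ℕ) : ℝ :=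
  energy L ε (φ n) + 1 / τ * gradFunctional k (negNormSq L) (backDiff φ) n

/-- Assumption A1: the starting values preserve the volume. -/
def AssumptionA1 (k : ℕ) (L : Fin 2 → ℝ) (φ : ℕ → L2 L) : Prop :=
  ∀ l, 1 ≤ l → l ≤ k - 1 → mean L (φ l) = mean L (φ 0)

/-- Assumption A2: A1, the time-step restriction `τ ≤ (2/(3ε)) min {b_0, σ_{Lk}}`, and a modified
energy of the starting values that is finite and at most `c₀`. -/
def AssumptionA2 (k : ℕ) (L : Fin 2 → ℝ) (ε τ : ℝ) (φ : ℕ → L2 L) (c₀ : ℝ) : Prop :=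
  AssumptionA1 k L φ ∧ τ ≤ 2 / (3 * ε) * min (bdfKernel k 0) (sigmaL k) ∧
    InH2 L (φ (k - 1)) ∧ modifiedEnergy k L ε τ φ (k - 1) ≤ c₀

/-- `c₁ = c_Ω √(8 c₀ + 2 (2 + ε)² |Ω|)`. -/
def c1 (L : Fin 2 → ℝ) (ε cΩ c₀ : ℝ) : ℝ :=
  cΩ * Real.sqrt (8 * c₀ + 2 * (2 + ε) ^ 2 * volume.real (cell L))

/-- `c₃ = c₂² + c₁ c₂ + c₁² + ε`. -/
def c3 (ε a₁ a₂ : ℝ) : ℝ := a₂ ^ 2 + a₁ * a₂ + a₁ ^ 2 + ε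

/-- `c₄ = 250 𝔪_{2k}² / 𝔪_{1k}⁵ + 2 c₃² 𝔪_{2k} 𝔪_{3k} / 𝔪_{1k}²`. -/
def c4 (k : ℕ) (m2 a₃ : ℝ) : ℝ :=
  250 * m2 ^ 2 / m1 k ^ 5 + 2 * a₃ ^ 2 * m2 * m3 k / m1 k ^ 2

end PFC

end

noncomputable section

namespace PFC

/-! The constants `𝔪_{2k}` and `c_{I,k}` only have to be upper bounds depending on `k`, so the
stability analysis may be crude. With `10 ^ 4` for `𝔪_{2k}`, `le_c4` shows that `c₄` dominates the
Gronwall constant the argument produces.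

Estimates are made mode by mode. Real plane waves form a Hilbert basis of `L²(Ω)` (`waveBasis`) on
which the weak Laplacian is multiplication by `-freq` (`hasLaplacian_iff`), so inequalities in `L²`
and `H⁻¹` become sums over modes of scalar inequalities.

Uniform bounds: the gradient structure `gradFunctional_le` bounds `v_n ∑ b_i v_{n-i}` below by an
increment of `𝒢_k` plus `σ_{Lk}/2 · v_n²`. Together with the convexity inequality `energy_sub_le` it
makes the modified energy nonincreasing (`modifiedEnergy_le_pred`); the energy controls `‖u‖ +
‖Δu‖`, hence the sup norm (`exists_sobolev`). The same convexity inequality between two times of the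
exact solution bounds energy increments by `O((s - r)²)`, and refining a partition gives
`energy_solution_le`. Hence the cubic term is Lipschitz with constant `c₃` along both solutions.

Stability: the kernels `θ` are the power series inverse of the `b_j`. Coercivity and boundedness of
the `b`-convolution on `ℓ²` pass to `θ` (`sum_mul_conv_doc_ge`, `sum_conv_doc_sq_le`). Inverting the
error equation by `θ` and testing with the error leaves the dissipation `f (1 - f)²` against a
nonlinear term multiplied by `f`; Young's inequality and `f² ≤ f (1 - f)² + 4` absorb the latter. A
Lyapunov function gives `|θ_p| ≤ C (k/7)^p`, so starting errors and truncation errors are summed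
against a geometric series. `gronwall_running_max` closes the estimate (`norm_error_le`), and Taylor
expansion gives the order `τ^k` (`norm_bdf_sub_le`). -/

/-! ### BDF kernels and their discrete gradient structure -/

lemma bdfKernel_three (j : ℕ) : bdfKernel 3 j =
    if j = 0 then 11 / 6 else if j = 1 then -7 / 6 else if j = 2 then 1 / 3 else 0 := by
  have h : (∑ l ∈ Finset.Icc (1 : ℕ) 3, Polynomial.C (1 / (l : ℝ)) * (1 - Polynomial.X) ^ (l - 1) :
      Polynomial ℝ) = Polynomial.C (11 / 6) + Polynomial.C (-7 / 6) * Polynomial.X +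
        Polynomial.C (1 / 3) * Polynomial.X ^ 2 :=
    Polynomial.funext fun x => by simp [Finset.sum_Icc_succ_top]; ring
  rw [bdfKernel, h]
  simp only [Polynomial.coeff_add, Polynomial.coeff_C_mul, Polynomial.coeff_C,
    Polynomial.coeff_X, Polynomial.coeff_X_pow]
  split_ifs <;> first | omega | norm_num

lemma bdfKernel_four (j : ℕ) : bdfKernel 4 j =
    if j = 0 then 25 / 12 else if j = 1 then -23 / 12 else if j = 2 then 13 / 12
      else if j = 3 then -1 / 4 else 0 := by
  have h : (∑ l ∈ Finset.Icc (1 : ℕ) 4, Polynomial.C (1 / (l : ℝ)) * (1 - Polynomial.X) ^ (l - 1) :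
      Polynomial ℝ) = Polynomial.C (25 / 12) + Polynomial.C (-23 / 12) * Polynomial.X +
        Polynomial.C (13 / 12) * Polynomial.X ^ 2 + Polynomial.C (-1 / 4) * Polynomial.X ^ 3 :=
    Polynomial.funext fun x => by simp [Finset.sum_Icc_succ_top]; ring
  rw [bdfKernel, h]
  simp only [Polynomial.coeff_add, Polynomial.coeff_C_mul, Polynomial.coeff_C,
    Polynomial.coeff_X, Polynomial.coeff_X_pow]
  split_ifs <;> first | omega | norm_num

lemma bdfKernel_five (j : ℕ) : bdfKernel 5 j =
    if j = 0 then 137 / 60 else if j = 1 then -163 / 60 else if j = 2 then 137 / 60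
      else if j = 3 then -21 / 20 else if j = 4 then 1 / 5 else 0 := by
  have h : (∑ l ∈ Finset.Icc (1 : ℕ) 5, Polynomial.C (1 / (l : ℝ)) * (1 - Polynomial.X) ^ (l - 1) :
      Polynomial ℝ) = Polynomial.C (137 / 60) + Polynomial.C (-163 / 60) * Polynomial.X +
        Polynomial.C (137 / 60) * Polynomial.X ^ 2 + Polynomial.C (-21 / 20) * Polynomial.X ^ 3 +
        Polynomial.C (1 / 5) * Polynomial.X ^ 4 :=
    Polynomial.funext fun x => by simp [Finset.sum_Icc_succ_top]; ring
  rw [bdfKernel, h]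
  simp only [Polynomial.coeff_add, Polynomial.coeff_C_mul, Polynomial.coeff_C,
    Polynomial.coeff_X, Polynomial.coeff_X_pow]
  split_ifs <;> first | omega | norm_num

lemma bdfKernel_eq_zero {k j : ℕ} (hk3 : 3 ≤ k) (hk5 : k ≤ 5) (hj : k ≤ j) :
    bdfKernel k j = 0 := by
  interval_cases k
  · rw [bdfKernel_three]; split_ifs <;> first | omega | rfl
  · rw [bdfKernel_four]; split_ifs <;> first | omega | rfl
  · rw [bdfKernel_five]; split_ifs <;> first | omega | rfl

lemma bdfKernel_zero_pos {k : ℕ} (hk3 : 3 ≤ k) (hk5 : k ≤ 5) : 0 < bdfKernel k 0 := by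
  interval_cases k
  · rw [bdfKernel_three]; norm_num
  · rw [bdfKernel_four]; norm_num
  · rw [bdfKernel_five]; norm_num

lemma sigmaL_pos {k : ℕ} (hk3 : 3 ≤ k) (hk5 : k ≤ 5) : 0 < sigmaL k := by
  interval_cases k <;> norm_num [sigmaL]

/-- A discrete convolution with a kernel of length `k` as a sum over the kernel. -/
lemma sum_Icc_kernel {V : Type*} [AddCommGroup V] [Module ℝ V] {k n : ℕ} {b : ℕ → ℝ}
    (hb : ∀ j, k ≤ j → b j = 0) (hn : k ≤ n) (v : ℕ → V) :
    ∑ j ∈ Finset.Icc 1 n, b (n - j) • v j = ∑ i ∈ Finset.range k, b i • v (n - i) := by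
  have h1 : ∑ i ∈ Finset.range k, b i • v (n - i) = ∑ i ∈ Finset.range n, b i • v (n - i) := by
    refine Finset.sum_subset (Finset.range_subset_range.2 hn) fun i _ hi => ?_
    rw [hb i (by simpa using hi), zero_smul]
  rw [h1]
  refine Finset.sum_bij' (fun j _ => n - j) (fun i _ => n - i) ?_ ?_ ?_ ?_ ?_
  · intro j hj; simp only [Finset.mem_Icc, Finset.mem_range] at *; omega
  · intro j hj; simp only [Finset.mem_Icc, Finset.mem_range] at *; omega
  · intro j hj; simp only [Finset.mem_Icc] at *; omega
  · intro j hj; simp only [Finset.mem_range] at *; omega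
  · intro j hj
    simp only [Finset.mem_Icc] at hj
    rw [Nat.sub_sub_self hj.2]

/-- The discrete gradient structure of the BDF kernels. -/
lemma gradFunctional_le {k n : ℕ} (hk3 : 3 ≤ k) (hk5 : k ≤ 5) (v : ℕ → ℝ) :
    gradFunctional k (fun x : ℝ => x ^ 2) v n - gradFunctional k (fun x : ℝ => x ^ 2) v (n - 1)
      + sigmaL k / 2 * v n ^ 2 ≤ v n * ∑ i ∈ Finset.range k, bdfKernel k i * v (n - i) := by
  -- In each case the right side minus the left is a nonnegative combination of the squares given to
  -- `linarith`; for `k = 3` it is one sixth of the single square. Since `n - 1 - 1 = n - 2` also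
  -- holds for truncated subtraction, `n` needs no lower bound.
  interval_cases k
  · simp only [gradFunctional, sigmaL, Finset.sum_range_succ, Finset.sum_range_zero,
      bdfKernel_three, smul_eq_mul, Nat.sub_sub, Nat.sub_zero]
    norm_num
    linarith [sq_nonneg (v n - 7 / 4 * v (n - 1) + v (n - 2))]
  · simp only [gradFunctional, sigmaL, Finset.sum_range_succ, Finset.sum_range_zero,
      bdfKernel_four, smul_eq_mul, Nat.sub_sub, Nat.sub_zero]
    norm_num
    linarith [sq_nonneg (-v n + 3 / 2 * v (n - 1) - 3 / 2 * v (n - 2) + v (n - 3)),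
      sq_nonneg (v n - 29 / 32 * v (n - 1) + v (n - 2))]
  · simp only [gradFunctional, sigmaL, Finset.sum_range_succ, Finset.sum_range_zero,
      bdfKernel_five, smul_eq_mul, Nat.sub_sub, Nat.sub_zero]
    norm_num
    linarith [sq_nonneg (v n - 2 * v (n - 1) + 2 * v (n - 2) - 2 * v (n - 3) + v (n - 4)),
      sq_nonneg (-v n + 7 / 10 * v (n - 1) - 7 / 10 * v (n - 2) + v (n - 3)),
      sq_nonneg (v n + 187 / 800 * v (n - 1) + v (n - 2))]

lemma gradFunctional_nonneg {V : Type*} [AddCommGroup V] [Module ℝ V] (k n : ℕ) {q : V → ℝ}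
    {v : ℕ → V} (hq : ∀ a b c d : ℝ, 0 ≤ q (a • v n + b • v (n - 1) + c • v (n - 2) + d • v (n - 3))) :
    0 ≤ gradFunctional k q v n := by
  have h1 : 0 ≤ q (v n) := by simpa using hq 1 0 0 0
  have h2 : ∀ a : ℝ, 0 ≤ q (a • v n - v (n - 1)) := fun a => by
    simpa [sub_eq_add_neg] using hq a (-1) 0 0
  have h3 : ∀ a : ℝ, 0 ≤ q (a • (v n - v (n - 1)) + v (n - 2)) := fun a => by
    simpa [sub_eq_add_neg] using hq a (-a) 1 0
  have h4 : 0 ≤ q ((2 : ℝ) • (v n - v (n - 1)) + (2 : ℝ) • v (n - 2) - v (n - 3)) := by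
    simpa [sub_eq_add_neg] using hq 2 (-2) 2 (-1)
  unfold gradFunctional
  split
  · have := h2 (7 / 4); positivity
  · have := h2 (65 / 56); have := h3 (3 / 2); positivity
  · have := h2 (4931 / 6992); have := h3 (23 / 18); positivity
  · exact le_rfl

/-! ### Orthogonal kernels as the inverse of the BDF convolution -/

/-- Causal convolution of sequences. -/
def conv (f g : ℕ → ℝ) (p : ℕ) : ℝ := ∑ i ∈ Finset.range (p + 1), f (p - i) * g i

lemma conv_eq_coeff (f g : ℕ → ℝ) (p : ℕ) :
    conv f g p = PowerSeries.coeff p (PowerSeries.mk g * PowerSeries.mk f) := by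
  rw [PowerSeries.coeff_mul, Finset.Nat.sum_antidiagonal_eq_sum_range_succ_mk, conv]
  refine Finset.sum_congr rfl fun i _ => ?_
  simp [mul_comm]

lemma mk_conv (f g : ℕ → ℝ) :
    PowerSeries.mk (conv f g) = PowerSeries.mk g * PowerSeries.mk f := by
  ext p; rw [PowerSeries.coeff_mk, conv_eq_coeff]

/-- The recursion defining `θ` says precisely that the positive coefficients of the product vanish.
Both inversion formulas for convolutions follow from this identity of power series. -/
lemma mk_docKernel_mul {k : ℕ} (hk3 : 3 ≤ k) (hk5 : k ≤ 5) :
    PowerSeries.mk (docKernel k) * PowerSeries.mk (bdfKernel k) = 1 := by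
  have hb := (bdfKernel_zero_pos hk3 hk5).ne'
  ext p
  rw [← conv_eq_coeff, conv, Finset.sum_range_succ, PowerSeries.coeff_one]
  cases p with
  | zero => simp [docKernel, hb]
  | succ m =>
    rw [if_neg (Nat.succ_ne_zero m), Nat.sub_self, docKernel,
      Fin.sum_univ_eq_sum_range (fun i => docKernel k i * bdfKernel k (m + 1 - i)) (m + 1)]
    simp only [mul_comm (bdfKernel k _)]
    field_simp
    ring

lemma conv_bdf_conv_doc {k : ℕ} (hk3 : 3 ≤ k) (hk5 : k ≤ 5) (x : ℕ → ℝ) (p : ℕ) :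
    conv (bdfKernel k) (conv (docKernel k) x) p = x p := by
  rw [conv_eq_coeff, mk_conv, mul_assoc, mk_docKernel_mul hk3 hk5, mul_one, PowerSeries.coeff_mk]

lemma conv_doc_conv_bdf {k : ℕ} (hk3 : 3 ≤ k) (hk5 : k ≤ 5) (x : ℕ → ℝ) (p : ℕ) :
    conv (docKernel k) (conv (bdfKernel k) x) p = x p := by
  rw [conv_eq_coeff, mk_conv, mul_assoc, mul_comm (PowerSeries.mk (bdfKernel k)),
    mk_docKernel_mul hk3 hk5, mul_one, PowerSeries.coeff_mk]

/-- Extension by zero of a sequence to the indices below `k`. -/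
def shiftSeq (k : ℕ) (x : ℕ → ℝ) (n : ℕ) : ℝ := if n < k then 0 else x (n - k)

/-- Shifting by `k` keeps every index `k + p - i` with `i < k` clear of truncation, so the causal
convolution becomes the fixed `k`-term stencil to which the gradient structure applies. -/
lemma sum_range_shiftSeq {k : ℕ} (hk : 1 ≤ k) {b : ℕ → ℝ} (hb : ∀ j, k ≤ j → b j = 0) (x : ℕ → ℝ) (p : ℕ) :
    ∑ i ∈ Finset.range k, b i * shiftSeq k x (k + p - i) = conv b x p := by
  have h := sum_Icc_kernel (n := k + p) hb (by omega) (shiftSeq k x)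
  simp only [smul_eq_mul] at h
  rw [← h, conv]
  symm
  refine Finset.sum_of_injOn (fun i => k + i) (by intro a _ c _ h; simpa using h) ?_ ?_ ?_
  · intro i hi
    simp only [Finset.coe_range, Set.mem_Iio, Finset.coe_Icc, Set.mem_Icc] at *
    omega
  · intro j hj hj'
    rw [shiftSeq, if_pos, mul_zero]
    by_contra hc
    simp only [Finset.mem_Icc] at hj
    exact hj' ⟨j - k, by simp; omega, by simp; omega⟩
  · intro i _
    rw [shiftSeq, if_neg (by omega)]
    congr 2 <;> omega

/-- The gradient structure telescopes along the sequence extended by zero. The functional vanishes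
initially and is nonnegative at the end, so only the term with `σ_{Lk}/2` remains. -/
lemma sum_mul_conv_bdf_ge {k : ℕ} (hk3 : 3 ≤ k) (hk5 : k ≤ 5) (x : ℕ → ℝ) (M : ℕ) :
    sigmaL k / 2 * ∑ p ∈ Finset.range M, x p ^ 2 ≤
      ∑ p ∈ Finset.range M, x p * conv (bdfKernel k) x p := by
  have key : gradFunctional k (fun x : ℝ => x ^ 2) (shiftSeq k x) (k + M - 1) +
      sigmaL k / 2 * ∑ p ∈ Finset.range M, x p ^ 2 ≤
        ∑ p ∈ Finset.range M, x p * conv (bdfKernel k) x p := by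
    induction M with
    | zero =>
      interval_cases k <;> simp [gradFunctional, shiftSeq]
    | succ M ih =>
      rw [Finset.sum_range_succ, Finset.sum_range_succ]
      have h := gradFunctional_le (n := k + M) hk3 hk5 (shiftSeq k x)
      rw [sum_range_shiftSeq (by omega) fun j hj => bdfKernel_eq_zero hk3 hk5 hj] at h
      have hx : shiftSeq k x (k + M) = x M := by
        rw [shiftSeq, if_neg (by omega)]; congr 1; omega
      rw [hx] at h
      rw [show k + (M + 1) - 1 = k + M by omega]
      linarith
  have h0 : 0 ≤ gradFunctional k (fun x : ℝ => x ^ 2) (shiftSeq k x) (k + M - 1) :=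
    gradFunctional_nonneg _ _ fun a b c d => sq_nonneg _
  linarith

lemma sum_range_delay_le {y : ℕ → ℝ} (hy : ∀ p, 0 ≤ y p) (i M : ℕ) :
    ∑ p ∈ Finset.range M, (if p < i then 0 else y (p - i)) ≤ ∑ p ∈ Finset.range M, y p := by
  have h : ∑ p ∈ Finset.range M, (if p < i then 0 else y (p - i)) =
      ∑ p ∈ Finset.range (M - i), y p := by
    induction M with
    | zero => simp
    | succ M ih =>
      rw [Finset.sum_range_succ, ih]
      split_ifs with hM
      · rw [show M + 1 - i = M - i by omega, add_zero]
      · rw [show M + 1 - i = M - i + 1 by omega, Finset.sum_range_succ]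
  rw [h]
  exact Finset.sum_le_sum_of_subset_of_nonneg (Finset.range_subset_range.2 (Nat.sub_le _ _))
    fun p _ _ => hy p

/-- Cauchy–Schwarz over the `k` taps, each a delayed copy of `x`, gives the factor `k ∑ b_i²`, which
is at most `100` in all three cases. -/
lemma sum_conv_bdf_sq_le {k : ℕ} (hk3 : 3 ≤ k) (hk5 : k ≤ 5) (x : ℕ → ℝ) (M : ℕ) :
    ∑ p ∈ Finset.range M, conv (bdfKernel k) x p ^ 2 ≤ 100 * ∑ p ∈ Finset.range M, x p ^ 2 := by
  have hb : k * ∑ i ∈ Finset.range k, bdfKernel k i ^ 2 ≤ 100 := by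
    interval_cases k
    · norm_num [Finset.sum_range_succ, bdfKernel_three]
    · norm_num [Finset.sum_range_succ, bdfKernel_four]
    · norm_num [Finset.sum_range_succ, bdfKernel_five]
  have hS : 0 ≤ ∑ p ∈ Finset.range M, x p ^ 2 := Finset.sum_nonneg fun p _ => sq_nonneg _
  calc ∑ p ∈ Finset.range M, conv (bdfKernel k) x p ^ 2
      ≤ ∑ p ∈ Finset.range M, (∑ i ∈ Finset.range k, bdfKernel k i ^ 2) *
          ∑ i ∈ Finset.range k, shiftSeq k x (k + p - i) ^ 2 := by
        refine Finset.sum_le_sum fun p _ => ?_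
        rw [← sum_range_shiftSeq (by omega) fun j hj => bdfKernel_eq_zero hk3 hk5 hj]
        exact Finset.sum_mul_sq_le_sq_mul_sq _ _ _
    _ = (∑ i ∈ Finset.range k, bdfKernel k i ^ 2) *
          ∑ i ∈ Finset.range k, ∑ p ∈ Finset.range M, shiftSeq k x (k + p - i) ^ 2 := by
        rw [← Finset.mul_sum, Finset.sum_comm]
    _ ≤ (∑ i ∈ Finset.range k, bdfKernel k i ^ 2) *
          ∑ i ∈ Finset.range k, ∑ p ∈ Finset.range M, x p ^ 2 := by
        refine mul_le_mul_of_nonneg_left ?_ (Finset.sum_nonneg fun _ _ => sq_nonneg _)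
        refine Finset.sum_le_sum fun i hi => ?_
        have hi' := Finset.mem_range.1 hi
        refine le_of_eq_of_le (Finset.sum_congr rfl fun p _ => ?_)
          (sum_range_delay_le (fun p => sq_nonneg (x p)) i M)
        by_cases hp : p < i
        · rw [if_pos hp, shiftSeq, if_pos (by omega)]; norm_num
        · rw [if_neg hp, shiftSeq, if_neg (by omega)]; congr 2; omega
    _ = (k * ∑ i ∈ Finset.range k, bdfKernel k i ^ 2) * ∑ p ∈ Finset.range M, x p ^ 2 := by
        rw [Finset.sum_const, Finset.card_range, nsmul_eq_mul]; ring
    _ ≤ _ := mul_le_mul_of_nonneg_right hb hS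

/-- Put `y = θ * x`, so that `b * y = x`. Coercivity of `b` gives `σ/2 ∑ y² ≤ ∑ x y`, and its
boundedness gives `∑ x² ≤ 100 ∑ y²`. -/
lemma sum_mul_conv_doc_ge {k : ℕ} (hk3 : 3 ≤ k) (hk5 : k ≤ 5) (x : ℕ → ℝ) (M : ℕ) :
    sigmaL k / 200 * ∑ p ∈ Finset.range M, x p ^ 2 ≤
      ∑ p ∈ Finset.range M, x p * conv (docKernel k) x p := by
  have h1 := sum_mul_conv_bdf_ge hk3 hk5 (conv (docKernel k) x) M
  have h2 := sum_conv_bdf_sq_le hk3 hk5 (conv (docKernel k) x) M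
  simp only [conv_bdf_conv_doc hk3 hk5] at h1 h2
  simp only [mul_comm (x _)]
  nlinarith [sigmaL_pos hk3 hk5]

/-- With `y = θ * g`, coercivity and Young's inequality give `σ/2 ∑ y² ≤ ∑ y g ≤ σ/4 ∑ y² + 1/σ ∑
g²`. -/
lemma sum_conv_doc_sq_le {k : ℕ} (hk3 : 3 ≤ k) (hk5 : k ≤ 5) (g : ℕ → ℝ) (M : ℕ) :
    ∑ p ∈ Finset.range M, conv (docKernel k) g p ^ 2 ≤
      4 / sigmaL k ^ 2 * ∑ p ∈ Finset.range M, g p ^ 2 := by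
  have hs := sigmaL_pos hk3 hk5
  have h1 := sum_mul_conv_bdf_ge hk3 hk5 (conv (docKernel k) g) M
  simp only [conv_bdf_conv_doc hk3 hk5] at h1
  have h2 : ∑ p ∈ Finset.range M, conv (docKernel k) g p * g p ≤
      ∑ p ∈ Finset.range M, (sigmaL k / 4 * conv (docKernel k) g p ^ 2 +
        1 / sigmaL k * g p ^ 2) := by
    refine Finset.sum_le_sum fun p _ => ?_
    rw [← sub_nonneg]
    have : sigmaL k / 4 * conv (docKernel k) g p ^ 2 + 1 / sigmaL k * g p ^ 2 -
        conv (docKernel k) g p * g p =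
        1 / sigmaL k * (sigmaL k / 2 * conv (docKernel k) g p - g p) ^ 2 := by
      field_simp; ring
    rw [this]; positivity
  rw [Finset.sum_add_distrib, ← Finset.mul_sum, ← Finset.mul_sum] at h2
  have h3 : sigmaL k / 4 * ∑ p ∈ Finset.range M, conv (docKernel k) g p ^ 2 ≤
      1 / sigmaL k * ∑ p ∈ Finset.range M, g p ^ 2 := by linarith
  have h4 := mul_le_mul_of_nonneg_left h3 (by positivity : 0 ≤ 4 / sigmaL k)
  calc _ = 4 / sigmaL k * (sigmaL k / 4 *
        ∑ p ∈ Finset.range M, conv (docKernel k) g p ^ 2) := by field_simp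
    _ ≤ _ := h4
    _ = _ := by field_simp

/-! ### Geometric decay of the orthogonal kernels and of the starting weights -/

lemma abs_le_of_lyapunov {t q : ℕ → ℝ} {c r : ℝ} (hc : 0 < c) (hr : 0 ≤ r)
    (h1 : ∀ p, c * t p ^ 2 ≤ q p) (h2 : ∀ p, q (p + 1) ≤ r ^ 2 * q p) (p : ℕ) :
    |t p| ≤ √(q 0 / c) * r ^ p := by
  have h : ∀ p, q p ≤ (r ^ p) ^ 2 * q 0 := fun p => by
    induction p with
    | zero => simp
    | succ p ih =>
      calc q (p + 1) ≤ r ^ 2 * q p := h2 p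
        _ ≤ r ^ 2 * ((r ^ p) ^ 2 * q 0) := mul_le_mul_of_nonneg_left ih (sq_nonneg r)
        _ = _ := by ring
  have h0 : 0 ≤ q 0 := le_trans (by positivity) (h1 0)
  rw [← Real.sqrt_sq_eq_abs]
  refine Real.sqrt_le_iff.2 ⟨by positivity, ?_⟩
  rw [mul_pow, Real.sq_sqrt (by positivity), div_mul_eq_mul_div, le_div_iff₀ hc]
  linarith [h1 p, h p]

/-- Geometric decay of the orthogonal convolution kernels. -/
lemma exists_abs_docKernel_le {k : ℕ} (hk3 : 3 ≤ k) (hk5 : k ≤ 5) :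
    ∃ C : ℝ, 0 ≤ C ∧ ∀ p, |docKernel k p| ≤ C * ((k : ℝ) / 7) ^ p := by
  -- Extended by zero, `θ` satisfies the homogeneous recurrence with coefficients `b_i` from its
  -- second term on, so the recurrence starts from the state `(θ_0, 0, …)`.
  have hrec : ∀ p, ∑ i ∈ Finset.range k,
      bdfKernel k i * shiftSeq k (docKernel k) (k + (p + 1) - i) = 0 := fun p => by
    rw [sum_range_shiftSeq (by omega) fun j hj => bdfKernel_eq_zero hk3 hk5 hj, conv_eq_coeff,
      mk_docKernel_mul hk3 hk5, PowerSeries.coeff_one, if_neg (Nat.succ_ne_zero p)]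
  have ht : ∀ p, docKernel k p = shiftSeq k (docKernel k) (p + k) := fun p => by
    rw [shiftSeq, if_neg (by omega), Nat.add_sub_cancel]
  simp only [ht]
  generalize shiftSeq k (docKernel k) = t at hrec
  interval_cases k
  -- In each case `q` is a positive definite form in the last `k - 1` terms that the recurrence
  -- contracts by `(k/7)²`. The constant `c` is the coefficient of the newest square that remains
  -- after completing squares in the older variables.
  · refine ⟨_, Real.sqrt_nonneg _, abs_le_of_lyapunov
      (q := fun p => 11 * t (p + 3) ^ 2 - 7 * t (p + 3) * t (p + 2) + 2 * t (p + 2) ^ 2)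
      (c := 39 / 8) (by norm_num) (by norm_num) (fun p => ?_) fun p => ?_⟩
    · linarith [sq_nonneg (t (p + 2) - 7 / 4 * t (p + 3))]
    · have h := hrec p
      simp only [Finset.sum_range_succ, Finset.sum_range_zero, bdfKernel_three,
        show 3 + (p + 1) - 0 = p + 4 by omega, show 3 + (p + 1) - 1 = p + 3 by omega,
        show 3 + (p + 1) - 2 = p + 2 by omega] at h
      norm_num at h
      rw [show p + 1 + 3 = p + 4 by ring, show p + 1 + 2 = p + 3 by ring]
      have h' : t (p + 4) = 7 / 11 * t (p + 3) - 2 / 11 * t (p + 2) := by linarith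
      rw [h']
      norm_num
      nlinarith [sq_nonneg (t (p + 2) - 7 / 4 * t (p + 3)), sq_nonneg (t (p + 3))]
  · refine ⟨_, Real.sqrt_nonneg _, abs_le_of_lyapunov
      (q := fun p => 212 * t (p + 4) ^ 2 + 134 * t (p + 3) ^ 2 + 10 * t (p + 2) ^ 2
        - 266 * t (p + 4) * t (p + 3) + 46 * t (p + 4) * t (p + 2) - 64 * t (p + 3) * t (p + 2))
      (c := 3748 / 79) (by norm_num) (by norm_num) (fun p => ?_) fun p => ?_⟩
    · linarith [sq_nonneg (t (p + 2) - 16 / 5 * t (p + 3) + 23 / 10 * t (p + 4)),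
        sq_nonneg (t (p + 3) - 297 / 158 * t (p + 4))]
    · have h := hrec p
      simp only [Finset.sum_range_succ, Finset.sum_range_zero, bdfKernel_four,
        show 4 + (p + 1) - 0 = p + 5 by omega, show 4 + (p + 1) - 1 = p + 4 by omega,
        show 4 + (p + 1) - 2 = p + 3 by omega, show 4 + (p + 1) - 3 = p + 2 by omega] at h
      norm_num at h
      rw [show p + 1 + 4 = p + 5 by ring, show p + 1 + 3 = p + 4 by ring,
        show p + 1 + 2 = p + 3 by ring]
      have h' : t (p + 5) = 23 / 25 * t (p + 4) - 13 / 25 * t (p + 3) + 3 / 25 * t (p + 2) := by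
        linarith
      rw [h']
      norm_num
      linarith [sq_nonneg (t (p + 4) - 5019 / 7774 * t (p + 3) + 2003 / 15548 * t (p + 2)),
        sq_nonneg (t (p + 3) + 4727 / 10566 * t (p + 2)), sq_nonneg (t (p + 2))]
  · refine ⟨_, Real.sqrt_nonneg _, abs_le_of_lyapunov
      (q := fun p => 300 * t (p + 5) ^ 2 + 411 * t (p + 4) ^ 2 + 113 * t (p + 3) ^ 2
        + 5 * t (p + 2) ^ 2 - 574 * t (p + 5) * t (p + 4) + 204 * t (p + 5) * t (p + 3)
        - 24 * t (p + 5) * t (p + 2) - 396 * t (p + 4) * t (p + 3) + 68 * t (p + 4) * t (p + 2)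
        - 44 * t (p + 3) * t (p + 2))
      (c := 70863 / 2851) (by norm_num) (by norm_num) (fun p => ?_) fun p => ?_⟩
    · linarith [sq_nonneg (t (p + 2) - 22 / 5 * t (p + 3) + 34 / 5 * t (p + 4)
          - 12 / 5 * t (p + 5)),
        sq_nonneg (t (p + 3) - 242 / 81 * t (p + 4) + 82 / 27 * t (p + 5)),
        sq_nonneg (t (p + 4) - 4731 / 2851 * t (p + 5))]
    · have h := hrec p
      simp only [Finset.sum_range_succ, Finset.sum_range_zero, bdfKernel_five,
        show 5 + (p + 1) - 0 = p + 6 by omega, show 5 + (p + 1) - 1 = p + 5 by omega,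
        show 5 + (p + 1) - 2 = p + 4 by omega, show 5 + (p + 1) - 3 = p + 3 by omega,
        show 5 + (p + 1) - 4 = p + 2 by omega] at h
      norm_num at h
      rw [show p + 1 + 5 = p + 6 by ring, show p + 1 + 4 = p + 5 by ring,
        show p + 1 + 3 = p + 4 by ring, show p + 1 + 2 = p + 3 by ring]
      have h' : t (p + 6) = 163 / 137 * t (p + 5) - t (p + 4) + 63 / 137 * t (p + 3)
          - 12 / 137 * t (p + 2) := by linarith
      rw [h']
      norm_num
      linarith [sq_nonneg (t (p + 5) + 136178 / 296015 * t (p + 4) + 145877 / 296015 * t (p + 3)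
          + 2928 / 296015 * t (p + 2)),
        sq_nonneg (t (p + 4) - 306652 / 4538237 * t (p + 3) + 17467 / 4538237 * t (p + 2)),
        sq_nonneg (t (p + 3) - 42970534 / 37540933 * t (p + 2)), sq_nonneg (t (p + 2))]

lemma sum_geometric_le {r : ℝ} (h0 : 0 ≤ r) (h1 : r < 1) (M : ℕ) :
    ∑ p ∈ Finset.range M, r ^ p ≤ (1 - r)⁻¹ := by
  rw [← tsum_geometric_of_lt_one h0 h1]
  exact (summable_geometric_of_lt_one h0 h1).sum_le_tsum _ fun p _ => pow_nonneg h0 p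

lemma ratio_lt_one {k : ℕ} (hk5 : k ≤ 5) : (k : ℝ) / 7 < 1 := by
  have : (k : ℝ) ≤ 5 := by exact_mod_cast hk5
  linarith

lemma abs_bdfKernel_le {k : ℕ} (hk3 : 3 ≤ k) (hk5 : k ≤ 5) (j : ℕ) : |bdfKernel k j| ≤ 3 := by
  interval_cases k
  · rw [bdfKernel_three]; split_ifs <;> norm_num [abs_le]
  · rw [bdfKernel_four]; split_ifs <;> norm_num [abs_le]
  · rw [bdfKernel_five]; split_ifs <;> norm_num [abs_le]

/-- The weights of the starting values in the starting effect. -/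
def startWeight (k l n : ℕ) : ℝ :=
  ∑ j ∈ Finset.Icc k n, docKernel k (n - j) * bdfKernel k (j - l)

/-- Geometric decay of the weights of the starting values. -/
lemma exists_abs_startWeight_le {k : ℕ} (hk3 : 3 ≤ k) (hk5 : k ≤ 5) :
    ∃ C : ℝ, 0 ≤ C ∧ ∀ l n, l ≤ k - 1 → k ≤ n →
      |startWeight k l n| ≤ C * ((k : ℝ) / 7) ^ (n - k) := by
  obtain ⟨C, hC, hd⟩ := exists_abs_docKernel_le hk3 hk5
  have hk0 : (0 : ℝ) < (k : ℝ) / 7 := by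
    have : 0 < k := by omega
    positivity
  have hk1 := (ratio_lt_one hk5).le
  -- As `l < k`, the kernel `b_{j-l}` vanishes once `j ≥ 2k`. At most `k` terms remain; in each `|b|
  -- ≤ 3`, and passing from `(k/7)^(n-j)` to `(k/7)^(n-k)` costs at most `(k/7)^(-k)`.
  refine ⟨k * (3 * C * (((k : ℝ) / 7) ^ k)⁻¹), by positivity, fun l n hl hn => ?_⟩
  have hterm : ∀ j ∈ Finset.Icc k n, |docKernel k (n - j) * bdfKernel k (j - l)| ≤
      if j < 2 * k then 3 * C * (((k : ℝ) / 7) ^ k)⁻¹ * ((k : ℝ) / 7) ^ (n - k) else 0 := by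
    intro j hj
    rw [Finset.mem_Icc] at hj
    split_ifs with hjk
    · rw [abs_mul]
      have h1 : ((k : ℝ) / 7) ^ (n - j) ≤ (((k : ℝ) / 7) ^ k)⁻¹ * ((k : ℝ) / 7) ^ (n - k) := by
        rw [inv_mul_eq_div, le_div_iff₀ (by positivity), ← pow_add]
        exact pow_le_pow_of_le_one hk0.le hk1 (by omega)
      calc |docKernel k (n - j)| * |bdfKernel k (j - l)|
          ≤ (C * ((((k : ℝ) / 7) ^ k)⁻¹ * ((k : ℝ) / 7) ^ (n - k))) * 3 :=
            mul_le_mul ((hd _).trans (mul_le_mul_of_nonneg_left h1 hC))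
              (abs_bdfKernel_le hk3 hk5 _) (abs_nonneg _) (by positivity)
        _ = _ := by ring
    · rw [bdfKernel_eq_zero hk3 hk5 (by omega), mul_zero, abs_zero]
  calc |startWeight k l n| ≤ ∑ j ∈ Finset.Icc k n, |docKernel k (n - j) * bdfKernel k (j - l)| :=
        Finset.abs_sum_le_sum_abs _ _
    _ ≤ _ := Finset.sum_le_sum hterm
    _ = ((Finset.Icc k n).filter (· < 2 * k)).card *
          (3 * C * (((k : ℝ) / 7) ^ k)⁻¹ * ((k : ℝ) / 7) ^ (n - k)) := by
        rw [← Finset.sum_filter, Finset.sum_const, nsmul_eq_mul]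
    _ ≤ k * (3 * C * (((k : ℝ) / 7) ^ k)⁻¹ * ((k : ℝ) / 7) ^ (n - k)) := by
        refine mul_le_mul_of_nonneg_right ?_ (by positivity)
        have hsub : (Finset.Icc k n).filter (· < 2 * k) ⊆ Finset.Ico k (2 * k) := fun j hj => by
          simp only [Finset.mem_filter, Finset.mem_Icc, Finset.mem_Ico] at *; omega
        have := Finset.card_le_card hsub
        rw [Nat.card_Ico] at this
        exact_mod_cast this.trans (by omega)
    _ = _ := by ring

lemma abs_startingEffect_le {k : ℕ} {C : ℝ} (hC : ∀ l n, l ≤ k - 1 → k ≤ n →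
      |startWeight k l n| ≤ C * ((k : ℝ) / 7) ^ (n - k)) (v : ℕ → ℝ) {n : ℕ} (hn : k ≤ n) :
    |startingEffect k v n| ≤ C * ((k : ℝ) / 7) ^ (n - k) *
      ∑ l ∈ Finset.Icc 1 (k - 1), |backDiff v l| := by
  rw [startingEffect, Finset.mul_sum]
  refine (Finset.abs_sum_le_sum_abs _ _).trans (Finset.sum_le_sum fun l hl => ?_)
  rw [abs_mul, mul_comm]
  exact mul_le_mul_of_nonneg_right (hC l n (Finset.mem_Icc.1 hl).2 hn) (abs_nonneg _)

/-- The squared spectral norm of the BDF matrices is bounded independently of the order. -/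
lemma eigenvalue_bdfMatrix_le {k : ℕ} (hk3 : 3 ≤ k) (hk5 : k ≤ 5) {m : ℕ} {lam : ℝ}
    (h : Module.End.HasEigenvalue
      (Matrix.toLin' ((bdfMatrix k m).transpose * bdfMatrix k m)) lam) : lam ≤ 100 := by
  obtain ⟨v, hv⟩ := h.exists_hasEigenvector
  have hev := hv.apply_eq_smul
  rw [Matrix.toLin'_apply, ← Matrix.mulVec_mulVec] at hev
  -- Pairing the eigenvalue equation with `v` gives `|Bv|² = λ |v|²`; after extension of `v` by
  -- zero, `B v` is a causal convolution.
  have h1 := congrArg (fun w => v ⬝ᵥ w) hev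
  simp only [Matrix.dotProduct_mulVec, Matrix.vecMul_transpose, dotProduct_smul, smul_eq_mul] at h1
  let x : ℕ → ℝ := fun n => if hn : n < m then v ⟨n, hn⟩ else 0
  have hx : ∀ i : Fin m, x i = v i := fun i => by simp [x]
  have hB : ∀ i : Fin m, (bdfMatrix k m).mulVec v i = conv (bdfKernel k) x i := fun i => by
    rw [Matrix.mulVec, dotProduct, conv]
    have e : ∀ j : Fin m, bdfMatrix k m i j * v j =
        (fun n : ℕ => (if n ≤ i then bdfKernel k (i - n) else 0) * x n) j := fun j => by
      simp only [bdfMatrix, Matrix.of_apply, hx, Fin.le_def]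
    rw [Finset.sum_congr rfl fun j _ => e j,
      Fin.sum_univ_eq_sum_range
        (fun n : ℕ => (if n ≤ i then bdfKernel k (i - n) else 0) * x n) m]
    symm
    refine Finset.sum_subset_zero_on_sdiff (Finset.range_subset_range.2 i.2) (fun j hj => ?_)
      fun j hj => ?_
    · simp only [Finset.mem_sdiff, Finset.mem_range] at hj
      rw [if_neg (by omega), zero_mul]
    · rw [if_pos (by simpa [Nat.lt_succ_iff] using hj)]
  have h2 : (bdfMatrix k m).mulVec v ⬝ᵥ (bdfMatrix k m).mulVec v =
      ∑ p ∈ Finset.range m, conv (bdfKernel k) x p ^ 2 := by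
    rw [dotProduct, ← Fin.sum_univ_eq_sum_range]
    exact Finset.sum_congr rfl fun i _ => by rw [hB, pow_two]
  have h3 : v ⬝ᵥ v = ∑ p ∈ Finset.range m, x p ^ 2 := by
    rw [dotProduct, ← Fin.sum_univ_eq_sum_range (fun p => x p ^ 2)]
    exact Finset.sum_congr rfl fun i _ => by rw [hx, pow_two]
  have hpos : 0 < v ⬝ᵥ v := by
    have h0 : 0 ≤ v ⬝ᵥ v := h3 ▸ Finset.sum_nonneg fun p _ => sq_nonneg _
    exact lt_of_le_of_ne h0 fun h => hv.2 (dotProduct_self_eq_zero.1 h.symm)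
  have h4 := sum_conv_bdf_sq_le hk3 hk5 x m
  rw [← h2, ← h3, Matrix.dotProduct_mulVec, h1] at h4
  exact le_of_mul_le_mul_right h4 hpos

/-! ### Real plane waves as a Hilbert basis of the cell -/

section Torus

/-- The measure on `ℝ / ℤ` is normalised as in the theory of Fourier series on the torus. -/
local instance : MeasureSpace UnitAddCircle := ⟨AddCircle.haarAddCircle⟩

local instance : Measure.IsAddHaarMeasure (volume : Measure UnitAddCircle) :=
  inferInstanceAs (Measure.IsAddHaarMeasure AddCircle.haarAddCircle)

local instance : IsProbabilityMeasure (volume : Measure UnitAddCircle) :=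
  inferInstanceAs (IsProbabilityMeasure AddCircle.haarAddCircle)

variable {L : Fin 2 → ℝ}

/-- The area of the period cell. -/
def area (L : Fin 2 → ℝ) : ℝ := ∏ i, L i

lemma area_pos (hL : ∀ i, 0 < L i) : 0 < area L := Finset.prod_pos fun i _ => hL i

/-- The half-open box with side lengths `L`. -/
def halfOpenBox (L : Fin 2 → ℝ) : Set (Fin 2 → ℝ) := Set.univ.pi fun i => Set.Ioc 0 (L i)

lemma measurableSet_halfOpenBox (L : Fin 2 → ℝ) : MeasurableSet (halfOpenBox L) :=
  MeasurableSet.univ_pi fun _ => measurableSet_Ioc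

lemma cell_eq_preimage (L : Fin 2 → ℝ) :
    cell L = (WithLp.ofLp : EuclideanSpace ℝ (Fin 2) → Fin 2 → ℝ) ⁻¹'
      (Set.univ.pi fun i => Set.Ioo 0 (L i)) := by
  ext x; simp [cell]

lemma measurableSet_cell (L : Fin 2 → ℝ) : MeasurableSet (cell L) := by
  rw [cell_eq_preimage]
  exact (MeasurableSet.univ_pi fun _ => measurableSet_Ioo).preimage
    (PiLp.volume_preserving_ofLp (Fin 2)).measurable

lemma measurePreserving_toLp_cell (L : Fin 2 → ℝ) :
    MeasurePreserving (WithLp.toLp 2 : (Fin 2 → ℝ) → EuclideanSpace ℝ (Fin 2))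
      (volume.restrict (Set.univ.pi fun i => Set.Ioo 0 (L i))) (cellMeasure L) := by
  have := (PiLp.volume_preserving_toLp (Fin 2)).restrict_preimage
    (s := cell L) (measurableSet_cell L)
  have hs : (WithLp.toLp 2 : (Fin 2 → ℝ) → EuclideanSpace ℝ (Fin 2)) ⁻¹' cell L =
      Set.univ.pi fun i => Set.Ioo 0 (L i) := by
    ext x; simp [cell]
  rwa [hs] at this

lemma volume_cell (L : Fin 2 → ℝ) : volume (cell L) = ∏ i, ENNReal.ofReal (L i) := by
  rw [cell_eq_preimage, (PiLp.volume_preserving_ofLp (Fin 2)).measure_preimage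
    (MeasurableSet.univ_pi fun _ => measurableSet_Ioo).nullMeasurableSet]
  simp [Real.volume_pi_Ioo]

instance isFiniteMeasure_cell (L : Fin 2 → ℝ) : IsFiniteMeasure (cellMeasure L) := by
  refine ⟨?_⟩
  rw [Measure.restrict_apply_univ, volume_cell]
  exact ENNReal.prod_lt_top fun i _ => ENNReal.ofReal_lt_top

lemma measurePreserving_scale (hL : ∀ i, 0 < L i) :
    MeasurePreserving (fun (v : Fin 2 → ℝ) i => L i * v i) volume
      ((ENNReal.ofReal (area L))⁻¹ • volume) := by
  have hd : (Matrix.diagonal L).det = area L := by simp [area]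
  have h := Real.smul_map_diagonal_volume_pi (D := L) (by rw [hd]; exact (area_pos hL).ne')
  have hf : (⇑(Matrix.toLin' (Matrix.diagonal L)) : (Fin 2 → ℝ) → Fin 2 → ℝ)
      = fun v i => L i * v i := by
    ext v i; simp [Matrix.mulVec_diagonal]
  rw [hd, abs_of_pos (area_pos hL), hf] at h
  refine ⟨by fun_prop, ?_⟩
  conv_rhs => rw [← h]
  rw [smul_smul, ENNReal.inv_mul_cancel (by simpa using area_pos hL) ENNReal.ofReal_ne_top,
    one_smul]

/-- The section of the projection of the plane onto the torus with values in the cell. -/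
def torusLift (L : Fin 2 → ℝ) (t : UnitAddTorus (Fin 2)) : EuclideanSpace ℝ (Fin 2) :=
  WithLp.toLp 2 fun i => L i * (AddCircle.equivIoc 1 0 (t i)).1

/-- The projection of the plane onto the torus. -/
def torusProj (L : Fin 2 → ℝ) (x : EuclideanSpace ℝ (Fin 2)) : UnitAddTorus (Fin 2) :=
  fun i => ((x i / L i : ℝ) : UnitAddCircle)

lemma torusProj_torusLift (hL : ∀ i, 0 < L i) (t : UnitAddTorus (Fin 2)) :
    torusProj L (torusLift L t) = t := by
  ext i
  simp only [torusProj, torusLift]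
  rw [mul_div_cancel_left₀ _ (hL i).ne']
  exact (AddCircle.equivIoc 1 0).symm_apply_apply (t i)

/-- Torus, half-open unit box, scaled box and Euclidean plane are linked by measure preserving maps.
The factor `1/|Ω|` reflects the probability Haar measure on the torus, and the half-open and open
boxes differ by a null set. -/
lemma measurePreserving_torusLift (hL : ∀ i, 0 < L i) :
    MeasurePreserving (torusLift L) volume ((ENNReal.ofReal (area L))⁻¹ • cellMeasure L) := by
  have hA := UnitAddTorus.measurePreserving_equivPiIoc (0 : Fin 2 → ℝ)
  have hS : MeasurableSet {x : Fin 2 → ℝ | ∀ i, x i ∈ Set.Ioc ((0 : Fin 2 → ℝ) i)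
      ((0 : Fin 2 → ℝ) i + 1)} := MeasurableSet.univ_pi' fun _ => measurableSet_Ioc
  have hB := MeasurePreserving.mk
    (measurable_subtype_coe (p := fun x : Fin 2 → ℝ => ∀ i, x i ∈ Set.Ioc ((0 : Fin 2 → ℝ) i)
      ((0 : Fin 2 → ℝ) i + 1))) (map_comap_subtype_coe hS volume)
  have hC := (measurePreserving_scale hL).restrict_preimage (measurableSet_halfOpenBox L)
  have hSeq : (fun (v : Fin 2 → ℝ) i => L i * v i) ⁻¹' halfOpenBox L =
      {x : Fin 2 → ℝ | ∀ i, x i ∈ Set.Ioc ((0 : Fin 2 → ℝ) i) ((0 : Fin 2 → ℝ) i + 1)} := by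
    ext v
    simp only [halfOpenBox, Set.mem_preimage, Set.mem_univ_pi, Set.mem_Ioc, Set.mem_ofPred_eq,
      Pi.zero_apply, zero_add]
    refine forall_congr' fun i => and_congr (by simp [hL i]) ?_
    exact mul_le_iff_le_one_right (hL i)
  rw [hSeq, Measure.restrict_smul] at hC
  have hE : (volume.restrict (halfOpenBox L) : Measure (Fin 2 → ℝ)) =
      volume.restrict (Set.univ.pi fun i => Set.Ioo 0 (L i)) :=
    Measure.restrict_congr_set (Measure.pi_Ioo_ae_eq_pi_Ioc).symm
  rw [hE] at hC
  have hF : MeasurePreserving (WithLp.toLp 2 : (Fin 2 → ℝ) → EuclideanSpace ℝ (Fin 2))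
      ((ENNReal.ofReal (area L))⁻¹ • volume.restrict (Set.univ.pi fun i => Set.Ioo 0 (L i)))
      ((ENNReal.ofReal (area L))⁻¹ • cellMeasure L) :=
    (measurePreserving_toLp_cell L).smul_measure _
  exact hF.comp (hC.comp (hB.comp hA))

/-- The phase `2π ∑ᵢ kᵢ xᵢ / Lᵢ` of a plane wave. -/
def phase (L : Fin 2 → ℝ) (k : Fin 2 → ℤ) (x : EuclideanSpace ℝ (Fin 2)) : ℝ :=
  ∑ i, 2 * Real.pi * k i / L i * x i

lemma phase_add (L : Fin 2 → ℝ) (k l : Fin 2 → ℤ) (x : EuclideanSpace ℝ (Fin 2)) :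
    phase L (k + l) x = phase L k x + phase L l x := by
  simp only [phase, ← Finset.sum_add_distrib]
  refine Finset.sum_congr rfl fun i _ => ?_
  push_cast [Pi.add_apply]
  ring

lemma phase_neg (L : Fin 2 → ℝ) (k : Fin 2 → ℤ) (x : EuclideanSpace ℝ (Fin 2)) :
    phase L (-k) x = -phase L k x := by
  simp only [phase, ← Finset.sum_neg_distrib]
  refine Finset.sum_congr rfl fun i _ => ?_
  push_cast [Pi.neg_apply]
  ring

/-- The normalised real plane waves `|Ω|^{-1/2} (cos + sin)`. -/
def wave (L : Fin 2 → ℝ) (k : Fin 2 → ℤ) (x : EuclideanSpace ℝ (Fin 2)) : ℝ :=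
  (√(area L))⁻¹ * (Real.cos (phase L k x) + Real.sin (phase L k x))

lemma mFourier_torusProj (L : Fin 2 → ℝ) (k : Fin 2 → ℤ)
    (x : EuclideanSpace ℝ (Fin 2)) :
    UnitAddTorus.mFourier k (torusProj L x) = Complex.exp (phase L k x * Complex.I) := by
  simp only [UnitAddTorus.mFourier, ContinuousMap.coe_mk, torusProj, fourier_coe_apply, phase]
  rw [← Complex.exp_sum]
  congr 1
  push_cast
  rw [Finset.sum_mul]
  refine Finset.sum_congr rfl fun i _ => ?_
  ring

lemma continuous_phase (L : Fin 2 → ℝ) (k : Fin 2 → ℤ) : Continuous (phase L k) := by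
  unfold phase; fun_prop

lemma continuous_wave (L : Fin 2 → ℝ) (k : Fin 2 → ℤ) : Continuous (wave L k) := by
  have := continuous_phase L k
  unfold wave; fun_prop

lemma abs_wave_le (L : Fin 2 → ℝ) (k : Fin 2 → ℤ) (x : EuclideanSpace ℝ (Fin 2)) :
    |wave L k x| ≤ 2 * (√(area L))⁻¹ := by
  have h0 : (0 : ℝ) ≤ (√(area L))⁻¹ := by positivity
  rw [wave, abs_mul, abs_of_nonneg h0, mul_comm]
  refine mul_le_mul_of_nonneg_right ?_ h0
  refine (abs_add_le _ _).trans ?_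
  linarith [Real.abs_cos_le_one (phase L k x), Real.abs_sin_le_one (phase L k x)]

lemma integral_cell_eq_torus (hL : ∀ i, 0 < L i) {E : Type*} [NormedAddCommGroup E]
    [NormedSpace ℝ E] {f : EuclideanSpace ℝ (Fin 2) → E}
    (hf : AEStronglyMeasurable f (cellMeasure L)) :
    ∫ x, f x ∂(cellMeasure L) = area L • ∫ t, f (torusLift L t) := by
  have h := measurePreserving_torusLift hL
  have hf' : AEStronglyMeasurable f ((ENNReal.ofReal (area L))⁻¹ • cellMeasure L) :=
    hf.smul_measure _
  rw [← integral_map h.measurable.aemeasurable (by rwa [h.map_eq]), h.map_eq,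
    integral_smul_measure, ENNReal.toReal_inv, ENNReal.toReal_ofReal (area_pos hL).le, smul_smul,
    mul_inv_cancel₀ (area_pos hL).ne', one_smul]

lemma integral_mFourier (k : Fin 2 → ℤ) :
    ∫ t, UnitAddTorus.mFourier k t = if k = 0 then 1 else 0 := by
  have h := (orthonormal_iff_ite.mp (UnitAddTorus.orthonormal_mFourier (d := Fin 2))) 0 k
  rw [ContinuousMap.inner_toLp] at h
  simp only [UnitAddTorus.mFourier_zero, ContinuousMap.one_apply, map_one, mul_one] at h
  rw [h]
  exact if_congr eq_comm rfl rfl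

lemma integral_exp_phase (hL : ∀ i, 0 < L i) (k : Fin 2 → ℤ) :
    ∫ x, Complex.exp (phase L k x * Complex.I) ∂(cellMeasure L)
      = if k = 0 then (area L : ℂ) else 0 := by
  rw [integral_cell_eq_torus hL]
  · have : ∀ t, Complex.exp (phase L k (torusLift L t) * Complex.I) =
        UnitAddTorus.mFourier k t := fun t => by
      rw [← mFourier_torusProj, torusProj_torusLift hL]
    simp only [this]
    rw [integral_mFourier]
    split_ifs <;> simp
  · have := continuous_phase L k
    exact (by fun_prop : Continuous _).aestronglyMeasurable

lemma integrable_of_continuous_bounded {f : EuclideanSpace ℝ (Fin 2) → ℝ} (hf : Continuous f)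
    {C : ℝ} (hC : ∀ x, |f x| ≤ C) : Integrable f (cellMeasure L) :=
  Integrable.of_bound hf.aestronglyMeasurable C (Filter.Eventually.of_forall hC)

lemma integral_cos_phase (hL : ∀ i, 0 < L i) (k : Fin 2 → ℤ) :
    ∫ x, Real.cos (phase L k x) ∂(cellMeasure L) = if k = 0 then area L else 0 := by
  have h := congrArg Complex.re (integral_exp_phase hL k)
  have hi : Integrable (fun x => Complex.exp (phase L k x * Complex.I)) (cellMeasure L) := by
    have := continuous_phase L k
    refine Integrable.of_bound (by fun_prop : Continuous _).aestronglyMeasurable 1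
      (Filter.Eventually.of_forall fun x => ?_)
    rw [Complex.norm_exp_ofReal_mul_I]
  have h2 := integral_re hi
  simp only [RCLike.re_to_complex] at h2
  rw [← h2] at h
  simp only [Complex.exp_ofReal_mul_I_re] at h
  rw [h]
  split_ifs <;> simp

lemma integral_sin_phase (hL : ∀ i, 0 < L i) (k : Fin 2 → ℤ) :
    ∫ x, Real.sin (phase L k x) ∂(cellMeasure L) = 0 := by
  have h := congrArg Complex.im (integral_exp_phase hL k)
  have hi : Integrable (fun x => Complex.exp (phase L k x * Complex.I)) (cellMeasure L) := by
    have := continuous_phase L k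
    refine Integrable.of_bound (by fun_prop : Continuous _).aestronglyMeasurable 1
      (Filter.Eventually.of_forall fun x => ?_)
    rw [Complex.norm_exp_ofReal_mul_I]
  have h2 := integral_im hi
  simp only [RCLike.im_to_complex] at h2
  rw [← h2] at h
  simp only [Complex.exp_ofReal_mul_I_im] at h
  rw [h]
  split_ifs <;> simp

/-- `(cos a + sin a)(cos b + sin b) = cos (a - b) + sin (a + b)`, and the sine has integral zero.
This is why `cos + sin` is used: one real orthonormal family indexed by all of `ℤ²`, with the same
normalisation at `0`. -/
lemma integral_wave_mul_wave (hL : ∀ i, 0 < L i) (k l : Fin 2 → ℤ) :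
    ∫ x, wave L k x * wave L l x ∂(cellMeasure L) = if k = l then 1 else 0 := by
  have h : ∀ x, wave L k x * wave L l x =
      (area L)⁻¹ * (Real.cos (phase L (k + -l) x) + Real.sin (phase L (k + l) x)) := fun x => by
    rw [phase_add, phase_add, phase_neg, Real.cos_add, Real.sin_add, Real.cos_neg, Real.sin_neg,
      wave, wave]
    have : (area L)⁻¹ = (√(area L))⁻¹ * (√(area L))⁻¹ := by
      rw [← mul_inv, Real.mul_self_sqrt (area_pos hL).le]
    rw [this]
    ring
  simp only [h]
  have hc := continuous_phase L (k + -l)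
  have hs := continuous_phase L (k + l)
  rw [integral_const_mul, integral_add
    (integrable_of_continuous_bounded (by fun_prop) fun x => Real.abs_cos_le_one _)
    (integrable_of_continuous_bounded (by fun_prop) fun x => Real.abs_sin_le_one _),
    integral_cos_phase hL, integral_sin_phase hL, add_zero]
  simp only [← sub_eq_add_neg, sub_eq_zero]
  split_ifs
  · exact inv_mul_cancel₀ (area_pos hL).ne'
  · simp

lemma memLp_wave (L : Fin 2 → ℝ) (k : Fin 2 → ℤ) : MemLp (wave L k) 2 (cellMeasure L) :=
  MemLp.of_bound (continuous_wave L k).aestronglyMeasurable _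
    (Filter.Eventually.of_forall (abs_wave_le L k))

/-- The plane waves as elements of `L²(Ω)`. -/
def waveLp (L : Fin 2 → ℝ) (k : Fin 2 → ℤ) : L2 L := (memLp_wave L k).toLp

lemma coeFn_waveLp (L : Fin 2 → ℝ) (k : Fin 2 → ℤ) : waveLp L k =ᵐ[cellMeasure L] wave L k :=
  (memLp_wave L k).coeFn_toLp

lemma inner_eq_integral (u v : L2 L) : ⟪u, v⟫_ℝ = ∫ x, u x * v x ∂(cellMeasure L) := by
  rw [L2.inner_def]
  refine integral_congr_ae (Filter.Eventually.of_forall fun x => ?_)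
  simp [mul_comm]

lemma inner_waveLp (k : Fin 2 → ℤ) (u : L2 L) :
    ⟪waveLp L k, u⟫_ℝ = ∫ x, u x * wave L k x ∂(cellMeasure L) := by
  rw [inner_eq_integral]
  refine integral_congr_ae ?_
  filter_upwards [coeFn_waveLp L k] with x hx
  rw [hx, mul_comm]

lemma orthonormal_waveLp (hL : ∀ i, 0 < L i) : Orthonormal ℝ (waveLp L) := by
  rw [orthonormal_iff_ite]
  intro k l
  rw [inner_waveLp, ← integral_wave_mul_wave hL k l]
  refine integral_congr_ae ?_
  filter_upwards [coeFn_waveLp L l] with x hx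
  rw [hx, mul_comm]

lemma integrable_mul_of_bounded (u : L2 L) {f : EuclideanSpace ℝ (Fin 2) → ℝ} (hf : Continuous f)
    {C : ℝ} (hC : ∀ x, |f x| ≤ C) : Integrable (fun x => u x * f x) (cellMeasure L) := by
  have hu : Integrable u (cellMeasure L) := (Lp.memLp u).integrable (by norm_num)
  exact hu.mul_bdd hf.aestronglyMeasurable (Filter.Eventually.of_forall hC)

/-- The coefficients at `k` and `-k` recover the cosine and sine integrals separately. All complex
Fourier coefficients of the lifted function vanish, and completeness on the torus applies. -/
lemma eq_zero_of_inner_waveLp (hL : ∀ i, 0 < L i) (u : L2 L)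
    (hu : ∀ k, ⟪waveLp L k, u⟫_ℝ = 0) : u = 0 := by
  have hs : (√(area L))⁻¹ ≠ 0 := inv_ne_zero (Real.sqrt_pos.2 (area_pos hL)).ne'
  have hic : ∀ k, Integrable (fun x => u x * Real.cos (phase L k x)) (cellMeasure L) := fun k => by
    have := continuous_phase L k
    exact integrable_mul_of_bounded u (by fun_prop) fun x => Real.abs_cos_le_one _
  have his : ∀ k, Integrable (fun x => u x * Real.sin (phase L k x)) (cellMeasure L) := fun k => by
    have := continuous_phase L k
    exact integrable_mul_of_bounded u (by fun_prop) fun x => Real.abs_sin_le_one _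
  have hsum : ∀ k, (∫ x, u x * Real.cos (phase L k x) ∂(cellMeasure L)) +
      ∫ x, u x * Real.sin (phase L k x) ∂(cellMeasure L) = 0 := fun k => by
    have := hu k
    rw [inner_waveLp] at this
    have h2 : ∀ x, u x * wave L k x = (√(area L))⁻¹ *
        (u x * Real.cos (phase L k x) + u x * Real.sin (phase L k x)) := fun x => by
      rw [wave]; ring
    simp only [h2] at this
    rw [integral_const_mul, integral_add (hic k) (his k)] at this
    exact (mul_eq_zero.1 this).resolve_left hs
  have hcos : ∀ k, ∫ x, u x * Real.cos (phase L k x) ∂(cellMeasure L) = 0 := fun k => by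
    have h1 := hsum k
    have h2 := hsum (-k)
    simp only [phase_neg, Real.cos_neg, Real.sin_neg, mul_neg, integral_neg] at h2
    linarith
  have hsin : ∀ k, ∫ x, u x * Real.sin (phase L k x) ∂(cellMeasure L) = 0 := fun k => by
    linarith [hsum k, hcos k]
  have hexp : ∀ k, ∫ x, Complex.exp (phase L k x * Complex.I) * (u x : ℂ) ∂(cellMeasure L) = 0 :=
    fun k => by
      have h2 : ∀ x, Complex.exp (phase L k x * Complex.I) * (u x : ℂ) =
          ((u x * Real.cos (phase L k x) : ℝ) : ℂ) +
            ((u x * Real.sin (phase L k x) : ℝ) : ℂ) * Complex.I := fun x => by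
        rw [Complex.exp_mul_I]; push_cast; ring
      simp only [h2]
      rw [integral_add (hic k).ofReal ((his k).ofReal.mul_const _), integral_mul_const,
        integral_complex_ofReal, integral_complex_ofReal, hcos, hsin]
      simp
  have hmp := measurePreserving_torusLift hL
  have huL : MemLp (fun x => (u x : ℂ)) 2 ((ENNReal.ofReal (area L))⁻¹ • cellMeasure L) :=
    ((Lp.memLp u).ofReal (K := ℂ)).smul_measure
      (ENNReal.inv_ne_top.2 (by simpa using area_pos hL))
  have hU : MemLp (fun t => (u (torusLift L t) : ℂ)) 2 volume := huL.comp_measurePreserving hmp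
  have hU0 : hU.toLp = 0 := by
    have : UnitAddTorus.mFourierBasis.repr hU.toLp = 0 := by
      ext k
      rw [UnitAddTorus.mFourierBasis_repr]
      have h3 := hexp (-k)
      rw [integral_cell_eq_torus hL] at h3
      · have h4 := (smul_eq_zero.1 h3).resolve_left (area_pos hL).ne'
        simp only [lp.coeFn_zero, Pi.zero_apply]
        rw [← h4, UnitAddTorus.mFourierCoeff]
        refine integral_congr_ae ?_
        filter_upwards [hU.coeFn_toLp] with t ht
        rw [ht, ← mFourier_torusProj, torusProj_torusLift hL, smul_eq_mul]
      · have := continuous_phase L (-k)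
        refine AEStronglyMeasurable.mul (by fun_prop : Continuous _).aestronglyMeasurable ?_
        exact (Complex.continuous_ofReal.comp_aestronglyMeasurable (Lp.aestronglyMeasurable u))
    exact (LinearIsometryEquiv.map_eq_zero_iff _).1 this
  have hU1 : ∀ᵐ t, (u (torusLift L t) : ℂ) = 0 := by
    have := hU.coeFn_toLp
    rw [hU0] at this
    filter_upwards [this, Lp.coeFn_zero ℂ 2 (volume : Measure (UnitAddTorus (Fin 2)))]
      with t ht ht0
    rw [← ht, ht0]; rfl
  have hU2 : ∀ᵐ x ∂((ENNReal.ofReal (area L))⁻¹ • cellMeasure L), (u x : ℂ) = 0 := by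
    rw [← hmp.map_eq, ae_map_iff hmp.measurable.aemeasurable]
    · exact hU1
    · exact (Complex.measurable_ofReal.comp (Lp.stronglyMeasurable u).measurable)
        (measurableSet_singleton 0)
  rw [Measure.ae_ennreal_smul_measure_eq (ENNReal.inv_ne_zero.2 ENNReal.ofReal_ne_top)] at hU2
  refine (Lp.eq_zero_iff_ae_eq_zero).2 ?_
  filter_upwards [hU2] with x hx
  simpa using hx

/-- The plane waves form a Hilbert basis of `L²(Ω)`. -/
def waveBasis (hL : ∀ i, 0 < L i) : HilbertBasis (Fin 2 → ℤ) ℝ (L2 L) :=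
  HilbertBasis.mkOfOrthogonalEqBot (orthonormal_waveLp hL) (by
    rw [Submodule.eq_bot_iff]
    intro u hu
    refine eq_zero_of_inner_waveLp hL u fun k => ?_
    exact (Submodule.mem_orthogonal _ _).1 hu _ (Submodule.subset_span ⟨k, rfl⟩))

@[simp]
lemma coe_waveBasis (hL : ∀ i, 0 < L i) : ⇑(waveBasis hL) = waveLp L :=
  HilbertBasis.coe_mkOfOrthogonalEqBot _ _

end Torus

/-! ### Green's identity and the weak Laplacian as a Fourier multiplier -/

variable {L : Fin 2 → ℝ}

/-- The plane in product coordinates. -/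
def planeEquiv : ℝ × ℝ ≃ᵐ EuclideanSpace ℝ (Fin 2) :=
  (MeasurableEquiv.finTwoArrow (α := ℝ)).symm.trans (MeasurableEquiv.toLp 2 (Fin 2 → ℝ))

lemma planeEquiv_apply (p : ℝ × ℝ) : planeEquiv p = WithLp.toLp 2 ![p.1, p.2] := rfl

lemma measurePreserving_planeEquiv : MeasurePreserving planeEquiv volume volume :=
  (PiLp.volume_preserving_toLp (Fin 2)).comp (volume_preserving_finTwoArrow ℝ).symm

lemma setIntegral_cell (f : EuclideanSpace ℝ (Fin 2) → ℝ) :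
    ∫ x, f x ∂(cellMeasure L) = ∫ p in Set.Icc ((0, 0) : ℝ × ℝ) (L 0, L 1), f (planeEquiv p) := by
  have h := measurePreserving_planeEquiv.setIntegral_preimage_emb planeEquiv.measurableEmbedding
    f (cell L)
  rw [← h]
  refine setIntegral_congr_set ?_
  have : planeEquiv ⁻¹' cell L = Set.Ioo 0 (L 0) ×ˢ Set.Ioo 0 (L 1) := by
    ext p
    simp [planeEquiv_apply, cell, Fin.forall_fin_two, Set.mem_prod]
  rw [this, ← Set.Icc_prod_Icc]
  exact Measure.set_prod_ae_eq Ioo_ae_eq_Icc Ioo_ae_eq_Icc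

/-- The `i`-th partial derivative. -/
def pderiv (i : Fin 2) (f : EuclideanSpace ℝ (Fin 2) → ℝ) (x : EuclideanSpace ℝ (Fin 2)) : ℝ :=
  fderiv ℝ f x (EuclideanSpace.single i 1)

/-- The linear parametrisation of the plane by product coordinates. -/
def planeCLM : ℝ × ℝ →L[ℝ] EuclideanSpace ℝ (Fin 2) :=
  (ContinuousLinearMap.fst ℝ ℝ ℝ).smulRight (EuclideanSpace.single 0 1) +
    (ContinuousLinearMap.snd ℝ ℝ ℝ).smulRight (EuclideanSpace.single 1 1)

lemma planeCLM_apply (p : ℝ × ℝ) : planeCLM p = planeEquiv p := by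
  ext i
  rw [planeEquiv_apply]
  fin_cases i <;> simp [planeCLM]

/-- Divergence theorem on the rectangle for the field `(f, 0)` or `(0, f)`: the two edges with a
flux carry equal integrals by periodicity. -/
lemma integral_pderiv_eq_zero (hL : ∀ i, 0 < L i) {f : EuclideanSpace ℝ (Fin 2) → ℝ}
    (hf : IsPeriodicTest L f) (i : Fin 2) : ∫ x, pderiv i f x ∂(cellMeasure L) = 0 := by
  rw [setIntegral_cell]
  have hd : Differentiable ℝ f := hf.1.differentiable (by simp)
  have hG : ∀ p : ℝ × ℝ, HasFDerivAt (fun p => f (planeCLM p))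
      ((fderiv ℝ f (planeCLM p)).comp planeCLM) p := fun p =>
    (hd (planeCLM p)).hasFDerivAt.comp p planeCLM.hasFDerivAt
  have hGc : Continuous fun p => f (planeCLM p) := hf.1.continuous.comp planeCLM.continuous
  have hfc : Continuous (fderiv ℝ f) := hf.1.continuous_fderiv (by simp)
  have h0 : ∀ p : ℝ × ℝ, HasFDerivAt (fun _ : ℝ × ℝ => (0 : ℝ)) (0 : ℝ × ℝ →L[ℝ] ℝ) p :=
    fun p => hasFDerivAt_const 0 p
  have hle : ((0, 0) : ℝ × ℝ) ≤ (L 0, L 1) := ⟨(hL 0).le, (hL 1).le⟩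
  have e0 : planeCLM (1, 0) = EuclideanSpace.single 0 1 := by simp [planeCLM]
  have e1 : planeCLM (0, 1) = EuclideanSpace.single 1 1 := by simp [planeCLM]
  have hp0 : ∀ y, f (planeCLM (L 0, y)) = f (planeCLM (0, y)) := fun y => by
    rw [← hf.2 (planeCLM (0, y)) 0]
    congr 1
    ext j; fin_cases j <;> simp [planeCLM]
  have hp1 : ∀ x, f (planeCLM (x, L 1)) = f (planeCLM (x, 0)) := fun x => by
    rw [← hf.2 (planeCLM (x, 0)) 1]
    congr 1
    ext j; fin_cases j <;> simp [planeCLM]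
  have hint : ∀ i, Continuous fun p : ℝ × ℝ => fderiv ℝ f (planeCLM p) (EuclideanSpace.single i 1) :=
    fun i => by fun_prop
  fin_cases i
  · have := integral_divergence_prod_Icc_of_hasFDerivAt_of_le _ _ _ _ (0, 0) (L 0, L 1) hle
      hGc.continuousOn continuousOn_const (fun p _ => hG p) (fun p _ => h0 p)
      (by
        refine Continuous.integrableOn_Icc ?_
        simpa [e0] using hint 0)
    simp only [ContinuousLinearMap.comp_apply, e0, zero_apply, add_zero, hp0] at this
    simpa [pderiv, planeCLM_apply] using this
  · have := integral_divergence_prod_Icc_of_hasFDerivAt_of_le _ _ _ _ (0, 0) (L 0, L 1) hle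
      continuousOn_const hGc.continuousOn (fun p _ => h0 p) (fun p _ => hG p)
      (by
        refine Continuous.integrableOn_Icc ?_
        simpa [e1] using hint 1)
    simp only [ContinuousLinearMap.comp_apply, e1, zero_apply, zero_add, hp1] at this
    simpa [pderiv, planeCLM_apply] using this

lemma IsPeriodicTest.pderiv {f : EuclideanSpace ℝ (Fin 2) → ℝ} (hf : IsPeriodicTest L f)
    (i : Fin 2) : IsPeriodicTest L (pderiv i f) := by
  refine ⟨?_, fun x j => ?_⟩
  · have : ContDiff ℝ ∞ (fderiv ℝ f) := hf.1.fderiv_right (by simp)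
    exact this.clm_apply contDiff_const
  · have h : (fun y => f (y + EuclideanSpace.single j (L j))) = f := funext fun y => hf.2 y j
    unfold PFC.pderiv
    rw [← fderiv_comp_add_right, h]

lemma IsPeriodicTest.mul {f g : EuclideanSpace ℝ (Fin 2) → ℝ} (hf : IsPeriodicTest L f)
    (hg : IsPeriodicTest L g) : IsPeriodicTest L fun x => f x * g x :=
  ⟨hf.1.mul hg.1, fun x i => by simp only [hf.2, hg.2]⟩

lemma IsPeriodicTest.sub {f g : EuclideanSpace ℝ (Fin 2) → ℝ} (hf : IsPeriodicTest L f)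
    (hg : IsPeriodicTest L g) : IsPeriodicTest L fun x => f x - g x :=
  ⟨hf.1.sub hg.1, fun x i => by simp only [hf.2, hg.2]⟩

lemma IsPeriodicTest.differentiable {f : EuclideanSpace ℝ (Fin 2) → ℝ}
    (hf : IsPeriodicTest L f) : Differentiable ℝ f := hf.1.differentiable (by simp)

lemma laplacian_eq_sum_pderiv {f : EuclideanSpace ℝ (Fin 2) → ℝ} (hf : IsPeriodicTest L f)
    (x : EuclideanSpace ℝ (Fin 2)) :
    Laplacian.laplacian f x = ∑ i, pderiv i (pderiv i f) x := by
  rw [InnerProductSpace.laplacian_eq_iteratedFDeriv_orthonormalBasis f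
    (EuclideanSpace.basisFun (Fin 2) ℝ)]
  refine Finset.sum_congr rfl fun i _ => ?_
  rw [iteratedFDeriv_two_apply]
  have hd : DifferentiableAt ℝ (fderiv ℝ f) x :=
    (hf.1.fderiv_right (m := ∞) (by simp)).differentiable (by simp) x
  unfold pderiv
  rw [fderiv_clm_apply hd (differentiableAt_const _)]
  simp

lemma IsPeriodicTest.laplacian {f : EuclideanSpace ℝ (Fin 2) → ℝ} (hf : IsPeriodicTest L f) :
    IsPeriodicTest L (Laplacian.laplacian f) := by
  have : Laplacian.laplacian f = fun x => ∑ i, PFC.pderiv i (PFC.pderiv i f) x :=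
    funext (laplacian_eq_sum_pderiv hf)
  rw [this]
  exact ⟨ContDiff.sum fun i _ => ((hf.pderiv i).pderiv i).1,
    fun x j => Finset.sum_congr rfl fun i _ => ((hf.pderiv i).pderiv i).2 x j⟩

/-- A periodic test function is square integrable on the cell. -/
lemma IsPeriodicTest.memLp {f : EuclideanSpace ℝ (Fin 2) → ℝ} (hf : IsPeriodicTest L f) :
    MemLp f 2 (cellMeasure L) := by
  have hb : Bornology.IsBounded (cell L) := by
    have := (Bornology.IsBounded.pi fun i : Fin 2 => Metric.isBounded_Ioo (0 : ℝ) (L i))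
    rw [cell_eq_preimage]
    exact (PiLp.antilipschitzWith_ofLp 2 fun _ : Fin 2 => ℝ).isBounded_preimage this
  obtain ⟨C, hC⟩ := (hb.isCompact_closure.exists_bound_of_continuousOn hf.1.continuous.continuousOn)
  refine MemLp.of_bound hf.1.continuous.aestronglyMeasurable C ?_
  filter_upwards [ae_restrict_mem (measurableSet_cell L)] with x hx
  exact hC x (subset_closure hx)

lemma IsPeriodicTest.integrable {f : EuclideanSpace ℝ (Fin 2) → ℝ} (hf : IsPeriodicTest L f) :
    Integrable f (cellMeasure L) := hf.memLp.integrable (by norm_num)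

/-- Green's second identity for periodic functions. -/
lemma integral_mul_laplacian_comm (hL : ∀ i, 0 < L i) {f g : EuclideanSpace ℝ (Fin 2) → ℝ}
    (hf : IsPeriodicTest L f) (hg : IsPeriodicTest L g) :
    ∫ x, f x * Laplacian.laplacian g x ∂(cellMeasure L) =
      ∫ x, Laplacian.laplacian f x * g x ∂(cellMeasure L) := by
  rw [← sub_eq_zero, ← integral_sub (hf.mul hg.laplacian).integrable (hf.laplacian.mul hg).integrable]
  have hp : ∀ i, IsPeriodicTest L fun x => f x * pderiv i g x - pderiv i f x * g x := fun i =>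
    (hf.mul (hg.pderiv i)).sub ((hf.pderiv i).mul hg)
  have h : ∀ x, f x * Laplacian.laplacian g x - Laplacian.laplacian f x * g x =
      ∑ i, pderiv i (fun x => f x * pderiv i g x - pderiv i f x * g x) x := fun x => by
    rw [laplacian_eq_sum_pderiv hf, laplacian_eq_sum_pderiv hg, Finset.mul_sum, Finset.sum_mul,
      ← Finset.sum_sub_distrib]
    refine Finset.sum_congr rfl fun i _ => ?_
    rw [pderiv.eq_1 i fun x => f x * pderiv i g x - pderiv i f x * g x]
    rw [fderiv_fun_sub ((hf.mul (hg.pderiv i)).differentiable x)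
      (((hf.pderiv i).mul hg).differentiable x),
      fderiv_fun_mul (hf.differentiable x) ((hg.pderiv i).differentiable x),
      fderiv_fun_mul ((hf.pderiv i).differentiable x) (hg.differentiable x)]
    simp only [pderiv, sub_apply, add_apply, smul_apply, smul_eq_mul]
    ring
  simp only [h]
  rw [integral_finsetSum _ fun i _ => ((hp i).pderiv i).integrable]
  exact Finset.sum_eq_zero fun i _ => integral_pderiv_eq_zero hL (hp i) i

/-- The eigenvalues of the negative Laplacian. -/
def freq (L : Fin 2 → ℝ) (k : Fin 2 → ℤ) : ℝ := ∑ i, (2 * Real.pi * k i / L i) ^ 2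

lemma exists_hasFDerivAt_phase (L : Fin 2 → ℝ) (k : Fin 2 → ℤ) (x : EuclideanSpace ℝ (Fin 2)) :
    ∃ D : EuclideanSpace ℝ (Fin 2) →L[ℝ] ℝ, HasFDerivAt (phase L k) D x ∧
      ∀ i, D (EuclideanSpace.single i 1) = 2 * Real.pi * k i / L i := by
  let D : EuclideanSpace ℝ (Fin 2) →L[ℝ] ℝ := ∑ i, (2 * Real.pi * k i / L i) •
      (EuclideanSpace.proj i : EuclideanSpace ℝ (Fin 2) →L[ℝ] ℝ)
  have : phase L k = ⇑D := by
    ext y; simp [phase, D]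
  refine ⟨D, this ▸ D.hasFDerivAt, fun i => ?_⟩
  rw [← this]
  simp [phase, PiLp.single_apply]

lemma isPeriodicTest_wave (hL : ∀ i, 0 < L i) (k : Fin 2 → ℤ) : IsPeriodicTest L (wave L k) := by
  refine ⟨?_, fun x i => ?_⟩
  · have : ContDiff ℝ ∞ (phase L k) := by
      unfold phase
      exact ContDiff.sum fun i _ => contDiff_const.mul (EuclideanSpace.proj i :
        EuclideanSpace ℝ (Fin 2) →L[ℝ] ℝ).contDiff
    exact contDiff_const.mul ((Real.contDiff_cos.comp this).add (Real.contDiff_sin.comp this))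
  · have : phase L k (x + EuclideanSpace.single i (L i)) = phase L k x + k i * (2 * Real.pi) := by
      simp only [phase, PiLp.add_apply, mul_add, Finset.sum_add_distrib]
      congr 1
      simp only [PiLp.single_apply, mul_ite, mul_zero, Finset.sum_ite_eq', Finset.mem_univ, if_true]
      have := (hL i).ne'
      field_simp
    rw [wave, wave, this, Real.cos_add_int_mul_two_pi, Real.sin_add_int_mul_two_pi]

lemma pderiv_wave (L : Fin 2 → ℝ) (k : Fin 2 → ℤ) (i : Fin 2) :
    pderiv i (wave L k) = fun x => (√(area L))⁻¹ * (2 * Real.pi * k i / L i) *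
      (Real.cos (phase L k x) - Real.sin (phase L k x)) := by
  ext x
  obtain ⟨D, h, hD⟩ := exists_hasFDerivAt_phase L k x
  have h2 : HasFDerivAt (wave L k) _ x := (h.cos.add h.sin).const_mul (√(area L))⁻¹
  rw [pderiv, h2.fderiv]
  simp only [smul_apply, add_apply, smul_eq_mul, hD]
  ring

lemma pderiv_pderiv_wave (L : Fin 2 → ℝ) (k : Fin 2 → ℤ) (i : Fin 2)
    (x : EuclideanSpace ℝ (Fin 2)) :
    pderiv i (pderiv i (wave L k)) x = -(2 * Real.pi * k i / L i) ^ 2 * wave L k x := by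
  rw [pderiv_wave]
  obtain ⟨D, h, hD⟩ := exists_hasFDerivAt_phase L k x
  have h2 : HasFDerivAt (fun x => (√(area L))⁻¹ * (2 * Real.pi * k i / L i) *
      (Real.cos (phase L k x) - Real.sin (phase L k x))) _ x :=
    (h.cos.sub h.sin).const_mul ((√(area L))⁻¹ * (2 * Real.pi * k i / L i))
  rw [pderiv, h2.fderiv]
  simp only [smul_apply, sub_apply, smul_eq_mul, hD, wave]
  ring

lemma laplacian_wave (hL : ∀ i, 0 < L i) (k : Fin 2 → ℤ) (x : EuclideanSpace ℝ (Fin 2)) :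
    Laplacian.laplacian (wave L k) x = -freq L k * wave L k x := by
  rw [laplacian_eq_sum_pderiv (isPeriodicTest_wave hL k), freq, ← Finset.sum_neg_distrib,
    Finset.sum_mul]
  exact Finset.sum_congr rfl fun i _ => pderiv_pderiv_wave L k i x

lemma inner_toLp {f : EuclideanSpace ℝ (Fin 2) → ℝ} (hf : MemLp f 2 (cellMeasure L)) (u : L2 L) :
    ⟪u, hf.toLp⟫_ℝ = ∫ x, u x * f x ∂(cellMeasure L) := by
  rw [inner_eq_integral]
  refine integral_congr_ae ?_
  filter_upwards [hf.coeFn_toLp] with x hx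
  rw [hx]

/-- One direction tests with the waves, which are periodic eigenfunctions. For the other, Parseval
expands both pairings with a test function, and Green's identity gives the coefficients of its
Laplacian. -/
lemma hasLaplacian_iff (hL : ∀ i, 0 < L i) {u w : L2 L} :
    HasLaplacian L u w ↔
      ∀ k, ⟪waveLp L k, w⟫_ℝ = -freq L k * ⟪waveLp L k, u⟫_ℝ := by
  constructor
  · intro h k
    have := h _ (isPeriodicTest_wave hL k)
    rw [inner_waveLp, inner_waveLp, ← this, ← integral_const_mul]
    refine integral_congr_ae (Filter.Eventually.of_forall fun x => ?_)
    simp only [laplacian_wave hL]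
    ring
  · intro h ψ hψ
    rw [← inner_toLp hψ.laplacian.memLp u, ← inner_toLp hψ.memLp w,
      ← (waveBasis hL).tsum_inner_mul_inner, ← (waveBasis hL).tsum_inner_mul_inner]
    refine tsum_congr fun k => ?_
    have h1 : ⟪waveLp L k, hψ.laplacian.memLp.toLp⟫_ℝ =
        -freq L k * ⟪waveLp L k, hψ.memLp.toLp⟫_ℝ := by
      have e : ∀ {f : EuclideanSpace ℝ (Fin 2) → ℝ} (hf : MemLp f 2 (cellMeasure L)),
          ⟪waveLp L k, hf.toLp⟫_ℝ = ∫ x, wave L k x * f x ∂(cellMeasure L) := fun hf => by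
        rw [inner_toLp]
        refine integral_congr_ae ?_
        filter_upwards [coeFn_waveLp L k] with x hx
        rw [hx]
      rw [e, e, integral_mul_laplacian_comm hL (isPeriodicTest_wave hL k) hψ,
        ← integral_const_mul]
      refine integral_congr_ae (Filter.Eventually.of_forall fun x => ?_)
      simp only [laplacian_wave hL]
      ring
    rw [coe_waveBasis, h1, real_inner_comm (waveLp L k) u, real_inner_comm (waveLp L k) w, h k]
    ring

/-- The Fourier coefficients with respect to the basis of plane waves. -/
def coef (u : L2 L) (k : Fin 2 → ℤ) : ℝ := ⟪waveLp L k, u⟫_ℝ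

@[simp] lemma coef_add (u v : L2 L) (k : Fin 2 → ℤ) : coef (u + v) k = coef u k + coef v k :=
  inner_add_right _ _ _

@[simp] lemma coef_sub (u v : L2 L) (k : Fin 2 → ℤ) : coef (u - v) k = coef u k - coef v k :=
  inner_sub_right _ _ _

@[simp] lemma coef_neg (u : L2 L) (k : Fin 2 → ℤ) : coef (-u) k = -coef u k :=
  inner_neg_right _ _

@[simp] lemma coef_smul (c : ℝ) (u : L2 L) (k : Fin 2 → ℤ) : coef (c • u) k = c * coef u k :=
  real_inner_smul_right _ _ _

@[simp] lemma coef_sum {ι : Type*} (s : Finset ι) (f : ι → L2 L) (k : Fin 2 → ℤ) :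
    coef (∑ i ∈ s, f i) k = ∑ i ∈ s, coef (f i) k := inner_sum _ _ _

lemma hasSum_coef_mul_coef (hL : ∀ i, 0 < L i) (u v : L2 L) :
    HasSum (fun k => coef u k * coef v k) ⟪u, v⟫_ℝ := by
  have h := (waveBasis hL).hasSum_inner_mul_inner u v
  simp only [coe_waveBasis] at h
  refine h.congr_fun fun k => ?_
  rw [real_inner_comm]
  rfl

lemma hasSum_coef_sq (hL : ∀ i, 0 < L i) (u : L2 L) :
    HasSum (fun k => coef u k ^ 2) (‖u‖ ^ 2) := by
  have h := hasSum_coef_mul_coef hL u u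
  rw [real_inner_self_eq_norm_sq] at h
  exact h.congr_fun fun k => pow_two _

lemma ext_coef (hL : ∀ i, 0 < L i) {u v : L2 L} (h : ∀ k, coef u k = coef v k) : u = v := by
  rw [← sub_eq_zero]
  refine eq_zero_of_inner_waveLp hL _ fun k => ?_
  have := coef_sub u v k
  rw [h, sub_self] at this
  exact this

lemma exists_coef_eq (hL : ∀ i, 0 < L i) {a : (Fin 2 → ℤ) → ℝ} (ha : Summable fun k => a k ^ 2) :
    ∃ u : L2 L, ∀ k, coef u k = a k := by
  have hm : Memℓp a 2 := by
    refine memℓp_gen ?_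
    simpa using ha
  refine ⟨(waveBasis hL).repr.symm ⟨a, hm⟩, fun k => ?_⟩
  have h := (waveBasis hL).repr_apply_apply ((waveBasis hL).repr.symm ⟨a, hm⟩) k
  rw [LinearIsometryEquiv.apply_symm_apply, coe_waveBasis] at h
  exact h.symm

lemma coef_lap (hL : ∀ i, 0 < L i) {u : L2 L} (hu : InH2 L u) (k : Fin 2 → ℤ) :
    coef (lap L u) k = -freq L k * coef u k := by
  rw [lap, dif_pos hu]
  exact (hasLaplacian_iff hL).1 hu.choose_spec k

lemma hasLaplacian_iff_coef (hL : ∀ i, 0 < L i) {u w : L2 L} :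
    HasLaplacian L u w ↔ ∀ k, coef w k = -freq L k * coef u k := hasLaplacian_iff hL

lemma InH2.neg (hL : ∀ i, 0 < L i) {u : L2 L} (hu : InH2 L u) : InH2 L (-u) := by
  obtain ⟨w, hw⟩ := hu
  rw [hasLaplacian_iff_coef hL] at hw
  exact ⟨-w, (hasLaplacian_iff_coef hL).2 fun k => by simp [hw]⟩

lemma freq_nonneg (L : Fin 2 → ℝ) (k : Fin 2 → ℤ) : 0 ≤ freq L k :=
  Finset.sum_nonneg fun _ _ => sq_nonneg _

@[simp] lemma freq_zero (L : Fin 2 → ℝ) : freq L 0 = 0 := by simp [freq]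

lemma exists_mul_le_freq (hL : ∀ i, 0 < L i) :
    ∃ c : ℝ, 0 < c ∧ c ≤ 1 ∧ ∀ k, c * ((k 0 : ℝ) ^ 2 + (k 1 : ℝ) ^ 2) ≤ freq L k := by
  have h : ∀ i, 0 < (2 * Real.pi / L i) ^ 2 := fun i =>
    pow_pos (div_pos Real.two_pi_pos (hL i)) 2
  refine ⟨min 1 (min ((2 * Real.pi / L 0) ^ 2) ((2 * Real.pi / L 1) ^ 2)),
    lt_min one_pos (lt_min (h 0) (h 1)), min_le_left _ _, fun k => ?_⟩
  rw [freq, Fin.sum_univ_two, mul_add]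
  have e : ∀ i, (2 * Real.pi * k i / L i) ^ 2 = (2 * Real.pi / L i) ^ 2 * (k i : ℝ) ^ 2 :=
    fun i => by ring
  rw [e, e]
  exact add_le_add
    (mul_le_mul_of_nonneg_right ((min_le_right _ _).trans (min_le_left _ _)) (sq_nonneg _))
    (mul_le_mul_of_nonneg_right ((min_le_right _ _).trans (min_le_right _ _)) (sq_nonneg _))

lemma exists_le_freq (hL : ∀ i, 0 < L i) : ∃ c : ℝ, 0 < c ∧ ∀ k, k ≠ 0 → c ≤ freq L k := by
  obtain ⟨c, hc, -, h⟩ := exists_mul_le_freq hL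
  refine ⟨c, hc, fun k hk => (le_mul_of_one_le_right hc.le ?_).trans (h k)⟩
  obtain ⟨i, hi⟩ := Function.ne_iff.1 hk
  have h1 : (1 : ℝ) ≤ (k i : ℝ) ^ 2 := by
    have hi' : k i ≠ 0 := hi
    have : 0 < k i ^ 2 := by positivity
    exact_mod_cast Int.add_one_le_of_lt this
  fin_cases i
  · exact h1.trans (le_add_of_nonneg_right (sq_nonneg _))
  · exact h1.trans (le_add_of_nonneg_left (sq_nonneg _))

lemma freq_pos (hL : ∀ i, 0 < L i) {k : Fin 2 → ℤ} (hk : k ≠ 0) : 0 < freq L k := by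
  obtain ⟨c, hc, h⟩ := exists_le_freq hL
  exact hc.trans_le (h k hk)

lemma wave_zero (L : Fin 2 → ℝ) (x : EuclideanSpace ℝ (Fin 2)) :
    wave L 0 x = (√(area L))⁻¹ := by simp [wave, phase]

lemma mean_eq (hL : ∀ i, 0 < L i) (u : L2 L) : mean L u = √(area L) * coef u 0 := by
  have hs := (Real.sqrt_pos.2 (area_pos hL)).ne'
  rw [coef, inner_waveLp, mean]
  simp only [wave_zero]
  rw [integral_mul_const, mul_comm, mul_assoc, inv_mul_cancel₀ hs, mul_one]

lemma mean_eq_zero_iff (hL : ∀ i, 0 < L i) (u : L2 L) : mean L u = 0 ↔ coef u 0 = 0 := by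
  rw [mean_eq hL, mul_eq_zero]
  exact or_iff_right (Real.sqrt_pos.2 (area_pos hL)).ne'

/-- The spectral gap makes the quotients square summable. At `k = 0` the convention `0 / 0 = 0`
agrees with the choice of the mean-zero preimage. -/
lemma coef_invNegLap (hL : ∀ i, 0 < L i) {v : L2 L} (hv : coef v 0 = 0) (k : Fin 2 → ℤ) :
    coef (invNegLap L v) k = coef v k / freq L k := by
  have hex : ∃ g : L2 L, mean L g = 0 ∧ HasLaplacian L g (-v) := by
    obtain ⟨c, hc, hcl⟩ := exists_le_freq hL
    have hs : Summable fun k => (coef v k / freq L k) ^ 2 := by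
      refine Summable.of_nonneg_of_le (fun k => sq_nonneg _) (fun k => ?_)
        ((hasSum_coef_sq hL v).summable.mul_left (c⁻¹ ^ 2))
      by_cases hk : k = 0
      · subst hk; simp [hv]
      · rw [div_eq_inv_mul, mul_pow]
        refine mul_le_mul_of_nonneg_right ?_ (sq_nonneg _)
        exact pow_le_pow_left₀ (inv_nonneg.2 (freq_nonneg L k)) (inv_anti₀ hc (hcl k hk)) 2
    obtain ⟨g, hg⟩ := exists_coef_eq hL hs
    refine ⟨g, (mean_eq_zero_iff hL g).2 (by simp [hg]), (hasLaplacian_iff_coef hL).2 fun k => ?_⟩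
    rw [coef_neg, hg]
    by_cases hk : k = 0
    · subst hk; simp [hv]
    · have := (freq_pos hL hk).ne'
      field_simp
  rw [invNegLap, dif_pos hex]
  obtain ⟨h1, h2⟩ := hex.choose_spec
  by_cases hk : k = 0
  · subst hk
    rw [(mean_eq_zero_iff hL _).1 h1, hv, zero_div]
  · have := (hasLaplacian_iff_coef hL).1 h2 k
    rw [coef_neg] at this
    rw [eq_div_iff (freq_pos hL hk).ne']
    linarith

lemma hasSum_negNormSq (hL : ∀ i, 0 < L i) {v : L2 L} (hv : coef v 0 = 0) :
    HasSum (fun k => (freq L k)⁻¹ * coef v k ^ 2) (negNormSq L v) := by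
  refine (hasSum_coef_mul_coef hL (invNegLap L v) v).congr_fun fun k => ?_
  rw [coef_invNegLap hL hv]
  ring

/-! ### Sobolev embedding -/

lemma summable_inv_one_add_sq : Summable fun n : ℤ => (1 + (n : ℝ) ^ 2)⁻¹ := by
  have h0 : Summable fun n : ℤ => if n = 0 then (1 : ℝ) else 0 := (hasSum_ite_eq 0 1).summable
  refine Summable.of_nonneg_of_le (fun n => by positivity) (fun n => ?_)
    ((Real.summable_one_div_int_pow.2 (one_lt_two)).add h0)
  by_cases hn : n = 0
  · simp [hn]
  · have : (0 : ℝ) < (n : ℝ) ^ 2 := by positivity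
    simp only [hn, if_false, add_zero, one_div]
    exact inv_anti₀ this (by linarith)

/-- Since `c ≤ 1`, `1 + freq ≥ c (1 + k₀² + k₁²)`, whose square dominates `c² (1 + k₀²)(1 + k₁²)`;
the reciprocals factor into two convergent series. -/
lemma summable_inv_one_add_freq_sq (hL : ∀ i, 0 < L i) :
    Summable fun k => ((1 + freq L k)⁻¹) ^ 2 := by
  obtain ⟨c, hc, hc1, h⟩ := exists_mul_le_freq hL
  have hs := summable_inv_one_add_sq.mul_of_nonneg summable_inv_one_add_sq
    (fun n => by positivity) (fun n => by positivity)
  have hs2 := ((finTwoArrowEquiv ℤ).summable_iff.2 hs).mul_left (c⁻¹ ^ 2)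
  refine Summable.of_nonneg_of_le (fun k => sq_nonneg _) (fun k => ?_) hs2
  change ((1 + freq L k)⁻¹) ^ 2 ≤ c⁻¹ ^ 2 * ((1 + (k 0 : ℝ) ^ 2)⁻¹ * (1 + (k 1 : ℝ) ^ 2)⁻¹)
  rw [inv_pow, inv_pow, ← mul_inv, ← mul_inv]
  refine inv_anti₀ (by positivity) ?_
  have h1 : c * (1 + (k 0 : ℝ) ^ 2 + (k 1 : ℝ) ^ 2) ≤ 1 + freq L k := by nlinarith [h k]
  calc c ^ 2 * ((1 + (k 0 : ℝ) ^ 2) * (1 + (k 1 : ℝ) ^ 2))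
      ≤ (c * (1 + (k 0 : ℝ) ^ 2 + (k 1 : ℝ) ^ 2)) ^ 2 := by
        rw [mul_pow]
        refine mul_le_mul_of_nonneg_left ?_ (sq_nonneg c)
        have a := sq_nonneg (k 0 : ℝ)
        have b := sq_nonneg (k 1 : ℝ)
        nlinarith [mul_nonneg a b, mul_nonneg a a, mul_nonneg b b]
    _ ≤ _ := pow_le_pow_left₀ (by positivity) h1 2

lemma abs_setIntegral_wave_le (A : Set (EuclideanSpace ℝ (Fin 2)))
    (k : Fin 2 → ℤ) :
    |∫ x in A, wave L k x ∂(cellMeasure L)| ≤ 2 * (√(area L))⁻¹ * (cellMeasure L).real A := by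
  rw [← Real.norm_eq_abs]
  exact norm_setIntegral_le_of_norm_le_const (measure_lt_top _ _) fun x _ => abs_wave_le L k x

/-- Cauchy–Schwarz against `(1 + freq)⁻¹` makes the coefficients absolutely summable, and the waves
are uniformly bounded. The bound is derived for integrals over measurable sets by Parseval with an
indicator, which avoids pointwise convergence of the Fourier series. -/
lemma ae_le_of_inH2 (hL : ∀ i, 0 < L i) {u : L2 L} (hu : InH2 L u) :
    ∀ᵐ x ∂(cellMeasure L), u x ≤ 2 * (√(area L))⁻¹ *
      (√(∑' k, ((1 + freq L k)⁻¹) ^ 2) * ‖u - lap L u‖) := by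
  set S := ∑' k, ((1 + freq L k)⁻¹) ^ 2 with hS
  set M := 2 * (√(area L))⁻¹ with hM
  have hM0 : 0 ≤ M := by positivity
  have hsum : ∀ s : Finset (Fin 2 → ℤ), ∑ k ∈ s, |coef u k| ≤ √S * ‖u - lap L u‖ := fun s => by
    have hk : ∀ k ∈ s, |coef u k| = (1 + freq L k)⁻¹ * |coef (u - lap L u) k| := fun k _ => by
      have hp : 0 < 1 + freq L k := by linarith [freq_nonneg L k]
      rw [coef_sub, coef_lap hL hu, show coef u k - -freq L k * coef u k =
        (1 + freq L k) * coef u k by ring, abs_mul, abs_of_pos hp, inv_mul_cancel_left₀ hp.ne']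
    rw [Finset.sum_congr rfl hk]
    refine (Real.sum_mul_le_sqrt_mul_sqrt _ _ _).trans ?_
    refine mul_le_mul (Real.sqrt_le_sqrt ?_) ?_ (Real.sqrt_nonneg _) (Real.sqrt_nonneg _)
    · exact (summable_inv_one_add_freq_sq hL).sum_le_tsum _ fun _ _ => sq_nonneg _
    · refine Real.sqrt_le_iff.2 ⟨norm_nonneg _, ?_⟩
      simp only [sq_abs]
      exact sum_le_hasSum _ (fun _ _ => sq_nonneg _) (hasSum_coef_sq hL _)
  have hui : Integrable u (cellMeasure L) := (Lp.memLp u).integrable (by norm_num)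
  refine ae_le_of_forall_setIntegral_le hui (integrable_const _) fun A hA hA' => ?_
  rw [← L2.inner_indicatorConstLp_one (𝕜 := ℝ) hA hA'.ne u]
  have h := hasSum_coef_mul_coef hL (indicatorConstLp 2 hA hA'.ne (1 : ℝ)) u
  refine hasSum_le_of_sum_le h fun s => ?_
  have hcA : ∀ k, |coef (indicatorConstLp 2 hA hA'.ne (1 : ℝ) : L2 L) k| ≤
      M * (cellMeasure L).real A := fun k => by
    rw [coef, real_inner_comm, L2.inner_indicatorConstLp_one]
    refine le_of_eq_of_le ?_ (abs_setIntegral_wave_le A k)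
    congr 1
    exact integral_congr_ae (ae_restrict_of_ae (coeFn_waveLp L k))
  calc _ ≤ ∑ k ∈ s, M * (cellMeasure L).real A * |coef u k| := by
        refine Finset.sum_le_sum fun k _ => ?_
        refine (le_abs_self _).trans ?_
        rw [abs_mul]
        exact mul_le_mul_of_nonneg_right (hcA k) (abs_nonneg _)
    _ ≤ M * (cellMeasure L).real A * (√S * ‖u - lap L u‖) := by
        rw [← Finset.mul_sum]
        exact mul_le_mul_of_nonneg_left (hsum s) (by positivity)
    _ = _ := by
        rw [setIntegral_const, smul_eq_mul]
        ring

lemma lap_neg (hL : ∀ i, 0 < L i) {u : L2 L} (hu : InH2 L u) : lap L (-u) = -lap L u :=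
  ext_coef hL fun k => by
    rw [coef_lap hL (hu.neg hL), coef_neg, coef_neg, coef_lap hL hu]; ring

/-- The embedding of `H²(Ω)` into `L^∞(Ω)`. -/
lemma exists_sobolev (hL : ∀ i, 0 < L i) : ∃ C : ℝ, 0 < C ∧ ∀ u : L2 L, InH2 L u →
    ∀ᵐ x ∂(cellMeasure L), |u x| ≤ C * (‖u‖ + ‖lap L u‖) := by
  refine ⟨2 * (√(area L))⁻¹ * √(∑' k, ((1 + freq L k)⁻¹) ^ 2) + 1, by positivity, fun u hu => ?_⟩
  have hle : ‖u - lap L u‖ ≤ ‖u‖ + ‖lap L u‖ := norm_sub_le _ _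
  have h2 := ae_le_of_inH2 hL (hu.neg hL)
  rw [lap_neg hL hu, ← neg_sub', norm_neg] at h2
  filter_upwards [ae_le_of_inH2 hL hu, h2, Lp.coeFn_neg u] with x hx hx2 hneg
  rw [hneg, Pi.neg_apply] at hx2
  set P := 2 * (√(area L))⁻¹ with hP
  set Q := √(∑' k, ((1 + freq L k)⁻¹) ^ 2) with hQ
  have hPQ : 0 ≤ P * Q := by positivity
  have h3 : P * (Q * ‖u - lap L u‖) ≤ (P * Q + 1) * (‖u‖ + ‖lap L u‖) := by
    rw [← mul_assoc]
    refine mul_le_mul (by linarith) hle (norm_nonneg _) (by linarith)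
  exact abs_le.2 ⟨by linarith, by linarith⟩

/-! ### Convexity and coercivity of the energy -/

lemma integrable_comp_of_bounded {u w : L2 L} {F : ℝ × ℝ → ℝ} (hF : Continuous F) {M : ℝ}
    (hu : ∀ᵐ x ∂(cellMeasure L), |u x| ≤ M) (hw : ∀ᵐ x ∂(cellMeasure L), |w x| ≤ M) :
    Integrable (fun x => F (u x, w x)) (cellMeasure L) := by
  obtain ⟨C, hC⟩ := ((isCompact_Icc (a := -M) (b := M)).prod
    (isCompact_Icc (a := -M) (b := M))).exists_bound_of_continuousOn hF.continuousOn
  refine Integrable.of_bound (hF.comp_aestronglyMeasurable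
    ((Lp.aestronglyMeasurable u).prodMk (Lp.aestronglyMeasurable w))) C ?_
  filter_upwards [hu, hw] with x h1 h2
  exact hC _ ⟨abs_le.1 h1, abs_le.1 h2⟩

lemma exists_ae_bound (hL : ∀ i, 0 < L i) {u : L2 L} (hu : InH2 L u) :
    ∃ M : ℝ, ∀ᵐ x ∂(cellMeasure L), |u x| ≤ M := by
  obtain ⟨C, -, hC⟩ := exists_sobolev hL
  exact ⟨_, hC u hu⟩

lemma exists_ae_bound₂ (hL : ∀ i, 0 < L i) {u w : L2 L} (hu : InH2 L u) (hw : InH2 L w) :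
    ∃ M : ℝ, (∀ᵐ x ∂(cellMeasure L), |u x| ≤ M) ∧ ∀ᵐ x ∂(cellMeasure L), |w x| ≤ M := by
  obtain ⟨M, hM⟩ := exists_ae_bound hL hu
  obtain ⟨M', hM'⟩ := exists_ae_bound hL hw
  exact ⟨max M M', hM.mono fun x hx => hx.trans (le_max_left _ _),
    hM'.mono fun x hx => hx.trans (le_max_right _ _)⟩

lemma inner_linear_part (hL : ∀ i, 0 < L i) {u w : L2 L} (hu : InH2 L u)
    (hu' : InH2 L (u + lap L u)) (hw : InH2 L w) :
    ⟪(u + lap L u) + lap L (u + lap L u), u - w⟫_ℝ =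
      ⟪u + lap L u, (u + lap L u) - (w + lap L w)⟫_ℝ := by
  refine (hasSum_coef_mul_coef hL _ _).unique
    ((hasSum_coef_mul_coef hL (u + lap L u) ((u + lap L u) - (w + lap L w))).congr_fun
      fun k => ?_)
  simp only [coef_add, coef_sub, coef_lap hL hu', coef_lap hL hu, coef_lap hL hw]
  ring

lemma double_well_convexity (ε a b : ℝ) :
    1 / 4 * (a ^ 2 - ε) ^ 2 - 1 / 4 * (b ^ 2 - ε) ^ 2 ≤
      (a ^ 3 - ε * a) * (a - b) + ε / 2 * (a - b) ^ 2 := by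
  have h : (a ^ 3 - ε * a) * (a - b) + ε / 2 * (a - b) ^ 2 -
      (1 / 4 * (a ^ 2 - ε) ^ 2 - 1 / 4 * (b ^ 2 - ε) ^ 2) =
        1 / 4 * ((a ^ 2 - b ^ 2) ^ 2 + 2 * (a * (a - b)) ^ 2) := by ring
  have : 0 ≤ 1 / 4 * ((a ^ 2 - b ^ 2) ^ 2 + 2 * (a * (a - b)) ^ 2) := by positivity
  linarith

/-- The quadratic part of the energy is expanded exactly, leaving half the squared norm of the
increment. The double well is convex up to `-ε/2` times a square, whence the last term. -/
lemma energy_sub_le (hL : ∀ i, 0 < L i) {ε : ℝ} {u w μ : L2 L}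
    (hu : IsChemicalPotential L ε u μ) (hw : InH2 L w) :
    energy L ε u - energy L ε w ≤ ⟪μ, u - w⟫_ℝ
      - 1 / 2 * ‖(u + lap L u) - (w + lap L w)‖ ^ 2 + ε / 2 * ‖u - w‖ ^ 2 := by
  obtain ⟨h1, h2, h3⟩ := hu
  obtain ⟨M, hMu, hMw⟩ := exists_ae_bound₂ hL h1 hw
  set a := (u + lap L u) + lap L (u + lap L u) with ha
  have hμ : ⟪μ, u - w⟫_ℝ = ⟪a, u - w⟫_ℝ +
      ∫ x, (u x ^ 3 - ε * u x) * (u x - w x) ∂(cellMeasure L) := by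
    have : μ = a + (μ - a) := by abel
    conv_lhs => rw [this]
    rw [inner_add_left, inner_eq_integral (μ - a)]
    congr 1
    refine integral_congr_ae ?_
    filter_upwards [h3, Lp.coeFn_sub μ a, Lp.coeFn_sub u w] with x hx hx1 hx2
    rw [hx1, hx2, Pi.sub_apply, Pi.sub_apply, hx]
    ring
  have hn : ‖u - w‖ ^ 2 = ∫ x, (u x - w x) ^ 2 ∂(cellMeasure L) := by
    rw [← real_inner_self_eq_norm_sq, inner_eq_integral]
    refine integral_congr_ae ?_
    filter_upwards [Lp.coeFn_sub u w] with x hx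
    rw [hx, Pi.sub_apply, pow_two]
  have hint : 1 / 4 * ∫ x, (u x ^ 2 - ε) ^ 2 ∂(cellMeasure L) -
      1 / 4 * ∫ x, (w x ^ 2 - ε) ^ 2 ∂(cellMeasure L) ≤
      (∫ x, (u x ^ 3 - ε * u x) * (u x - w x) ∂(cellMeasure L)) +
        ε / 2 * ∫ x, (u x - w x) ^ 2 ∂(cellMeasure L) := by
    have i1 := integrable_comp_of_bounded (F := fun p => 1 / 4 * (p.1 ^ 2 - ε) ^ 2) (by fun_prop)
      hMu hMw
    have i2 := integrable_comp_of_bounded (F := fun p => 1 / 4 * (p.2 ^ 2 - ε) ^ 2) (by fun_prop)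
      hMu hMw
    have i3 := integrable_comp_of_bounded (F := fun p => (p.1 ^ 3 - ε * p.1) * (p.1 - p.2))
      (by fun_prop) hMu hMw
    have i4 := integrable_comp_of_bounded (F := fun p => ε / 2 * (p.1 - p.2) ^ 2)
      (by fun_prop) hMu hMw
    rw [← integral_const_mul, ← integral_const_mul, ← integral_const_mul, ← integral_sub i1 i2,
      ← integral_add i3 i4]
    exact integral_mono (i1.sub i2) (i3.add i4) fun x => double_well_convexity ε _ _
  have hq : 1 / 2 * ‖u + lap L u‖ ^ 2 - 1 / 2 * ‖w + lap L w‖ ^ 2 =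
      ⟪a, u - w⟫_ℝ - 1 / 2 * ‖(u + lap L u) - (w + lap L w)‖ ^ 2 := by
    rw [ha, inner_linear_part hL h1 h2 hw, norm_sub_sq_real, inner_sub_right,
      real_inner_self_eq_norm_sq]
    ring
  rw [hμ, hn, energy, energy]
  linarith

/-- Pointwise `u² ≤ ½(u² - ε)² + ½ + ε`, so the well controls `‖u‖`, and `‖Δu‖ ≤ ‖(1 + Δ)u‖ + ‖u‖`.
The factor `2` in front of the root is later absorbed into `c_Ω`. -/
lemma norm_add_norm_lap_le_of_energy_le (hL : ∀ i, 0 < L i) {ε c : ℝ} (hε : 0 ≤ ε) {u : L2 L}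
    (hu : InH2 L u) (hc : energy L ε u ≤ c) :
    ‖u‖ + ‖lap L u‖ ≤ 2 * √(8 * c + 2 * (2 + ε) ^ 2 * volume.real (cell L)) := by
  obtain ⟨M, hM⟩ := exists_ae_bound hL hu
  have i1 := integrable_comp_of_bounded (F := fun p => (p.1 ^ 2 - ε) ^ 2) (by fun_prop) hM hM
  have hn : ‖u‖ ^ 2 ≤ 1 / 2 * (∫ x, (u x ^ 2 - ε) ^ 2 ∂(cellMeasure L)) +
      (1 / 2 + ε) * volume.real (cell L) := by
    have hv : (1 / 2 + ε) * volume.real (cell L) = ∫ _, (1 / 2 + ε) ∂(cellMeasure L) := by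
      rw [integral_const, measureReal_restrict_apply_univ, smul_eq_mul, mul_comm]
    rw [← real_inner_self_eq_norm_sq, inner_eq_integral, hv, ← integral_const_mul,
      ← integral_add (i1.const_mul _) (integrable_const _)]
    refine integral_mono (integrable_comp_of_bounded (F := fun p => p.1 * p.1) (by fun_prop) hM hM)
      ((i1.const_mul _).add (integrable_const _)) fun x => ?_
    simp only
    nlinarith [sq_nonneg (u x ^ 2 - ε - 1)]
  have hI : 0 ≤ ∫ x, (u x ^ 2 - ε) ^ 2 ∂(cellMeasure L) := integral_nonneg fun x => sq_nonneg _
  have hl : ‖lap L u‖ ≤ ‖u + lap L u‖ + ‖u‖ := by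
    have := norm_sub_le (u + lap L u) u
    rwa [add_sub_cancel_left] at this
  have hV : 0 ≤ volume.real (cell L) := measureReal_nonneg
  have hεV := mul_nonneg hε hV
  rw [energy] at hc
  set A := ‖u + lap L u‖
  have hs : ‖u‖ + ‖lap L u‖ ≤ √(4 * (8 * c + 2 * (2 + ε) ^ 2 * volume.real (cell L))) := by
    refine (add_le_add le_rfl hl).trans (Real.le_sqrt_of_sq_le ?_)
    nlinarith [sq_nonneg (2 * ‖u‖ - A), sq_nonneg A, norm_nonneg u]
  rw [Real.sqrt_mul (by norm_num), show (√4 : ℝ) = 2 by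
    rw [show (4 : ℝ) = 2 ^ 2 by norm_num]; exact Real.sqrt_sq (by norm_num)] at hs
  exact hs

/-! ### Discrete energy dissipation -/

lemma coef_zero_of_hasLaplacian (hL : ∀ i, 0 < L i) {u w : L2 L} (h : HasLaplacian L u w) :
    coef w 0 = 0 := by
  rw [(hasLaplacian_iff_coef hL).1 h, freq_zero]; simp

lemma coef_backDiff (v : ℕ → L2 L) (n : ℕ) (κ : Fin 2 → ℤ) :
    coef (backDiff v n) κ = backDiff (fun j => coef (v j) κ) n := coef_sub _ _ _

lemma coef_bdf {k n : ℕ} (hk3 : 3 ≤ k) (hk5 : k ≤ 5) (hn : k ≤ n) (τ : ℝ) (v : ℕ → L2 L)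
    (κ : Fin 2 → ℤ) : coef (bdf k τ v n) κ =
      1 / τ * ∑ i ∈ Finset.range k, bdfKernel k i * coef (backDiff v (n - i)) κ := by
  rw [bdf, sum_Icc_kernel (fun j hj => bdfKernel_eq_zero hk3 hk5 hj) hn]
  simp

/-- The scheme preserves the volume. -/
lemma coef_backDiff_zero (hL : ∀ i, 0 < L i) {k N : ℕ} (hk3 : 3 ≤ k) (hk5 : k ≤ 5) {ε τ : ℝ}
    (hτ : 0 < τ) {φ : ℕ → L2 L} (h1 : AssumptionA1 k L φ) (h2 : IsBDFSolution k L ε τ N φ)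
    (n : ℕ) (hn : n ≤ N) : coef (backDiff φ n) 0 = 0 := by
  have hmean : ∀ l, l ≤ k - 1 → coef (φ l) 0 = coef (φ 0) 0 := fun l hl => by
    rcases Nat.eq_zero_or_pos l with rfl | hl0
    · rfl
    · have := h1 l hl0 hl
      rw [mean_eq hL, mean_eq hL] at this
      exact mul_left_cancel₀ (Real.sqrt_pos.2 (area_pos hL)).ne' this
  induction n using Nat.strong_induction_on with
  | _ n ih =>
    by_cases hkn : k ≤ n
    · obtain ⟨μ, -, hμ⟩ := h2 n hkn hn
      have h := coef_zero_of_hasLaplacian hL hμ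
      rw [coef_bdf hk3 hk5 hkn, mul_eq_zero, or_iff_right (one_div_ne_zero hτ.ne'),
        -- The zero mode of `D_k φ^n` vanishes because it is a Laplacian. Earlier differences have
        -- no zero mode by induction, so only the term with `b_0 > 0` is left.
        Finset.sum_eq_single_of_mem 0 (by simp; omega), Nat.sub_zero, mul_eq_zero,
        or_iff_right (bdfKernel_zero_pos hk3 hk5).ne'] at h
      · exact h
      · intro i hi hi0
        rw [ih (n - i) (by omega) (by omega), mul_zero]
    · rw [backDiff, coef_sub, hmean n (by omega), hmean (n - 1) (by omega), sub_self]

/-- Reduces the functional in `H⁻¹` to scalar ones weighted by `1/freq`, so that `gradFunctional_le`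
can be used in each mode. The zero mode contributes nothing since the inverse of zero is zero. -/
lemma hasSum_gradFunctional (hL : ∀ i, 0 < L i) (k n : ℕ) {v : ℕ → L2 L}
    (hv : ∀ j ≤ n, coef (v j) 0 = 0) :
    HasSum (fun κ => (freq L κ)⁻¹ *
      gradFunctional k (fun x : ℝ => x ^ 2) (fun j => coef (v j) κ) n)
      (gradFunctional k (negNormSq L) v n) := by
  have h0 := hv n le_rfl
  have h1 := hv (n - 1) (Nat.sub_le _ _)
  have h2 := hv (n - 2) (Nat.sub_le _ _)
  have h3 := hv (n - 3) (Nat.sub_le _ _)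
  have s0 := hasSum_negNormSq hL h0
  have s1 : ∀ a : ℝ, _ := fun a => hasSum_negNormSq hL (v := a • v n - v (n - 1)) (by simp [h0, h1])
  have s2 : ∀ a : ℝ, _ := fun a => hasSum_negNormSq hL (v := a • (v n - v (n - 1)) + v (n - 2))
    (by simp [h0, h1, h2])
  have s3 := hasSum_negNormSq hL
    (v := (2 : ℝ) • (v n - v (n - 1)) + (2 : ℝ) • v (n - 2) - v (n - 3)) (by simp [h0, h1, h2, h3])
  unfold gradFunctional
  split
  · refine ((s0.mul_left _).add ((s1 _).mul_left _)).congr_fun fun κ => ?_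
    simp only [coef_sub, coef_smul, smul_eq_mul]; ring
  · refine (((s0.mul_left _).add ((s1 _).mul_left _)).add ((s2 _).mul_left _)).congr_fun
      fun κ => ?_
    simp only [coef_add, coef_sub, coef_smul, smul_eq_mul]; ring
  · refine ((((s0.mul_left _).add ((s1 _).mul_left _)).add ((s2 _).mul_left _)).add
      (s3.mul_left _)).congr_fun fun κ => ?_
    simp only [coef_add, coef_sub, coef_smul, smul_eq_mul]; ring
  · simp

lemma gradFunctional_negNormSq_nonneg (hL : ∀ i, 0 < L i) (k n : ℕ) {v : ℕ → L2 L}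
    (hv : ∀ j ≤ n, coef (v j) 0 = 0) : 0 ≤ gradFunctional k (negNormSq L) v n :=
  (hasSum_gradFunctional hL k n hv).nonneg fun κ =>
    mul_nonneg (inv_nonneg.2 (freq_nonneg L κ)) (gradFunctional_nonneg _ _ fun _ _ _ _ => sq_nonneg _)

/-- This is where the time-step restriction acts: the defect `ε/2` of convexity must be paid for by
`(1 + Δ)²` and the gradient remainder. As `s/τ ≥ 3ε/2`, it suffices that `2f(1 - f)² + ε(3 - 2f) ≥
0`; for `f ≥ 3/2` this uses `ε < 1`. -/
lemma mode_energy_ineq {ε τ s f : ℝ} (hε0 : 0 < ε) (hε1 : ε < 1) (hτ : 0 < τ)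
    (hs : τ ≤ 2 / (3 * ε) * s) (hf : 0 < f) :
    ε / 2 ≤ 1 / 2 * (1 - f) ^ 2 + 1 / τ * (f⁻¹ * (s / 2)) := by
  have h1 : 3 * ε / 2 ≤ s / τ := by
    rw [le_div_iff₀ hτ]
    calc 3 * ε / 2 * τ ≤ 3 * ε / 2 * (2 / (3 * ε) * s) := by gcongr
      _ = s := by field_simp
  have h2 : 1 / τ * (f⁻¹ * (s / 2)) = f⁻¹ / 2 * (s / τ) := by field_simp
  rw [h2]
  have h3 : f⁻¹ / 2 * (3 * ε / 2) ≤ f⁻¹ / 2 * (s / τ) :=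
    mul_le_mul_of_nonneg_left h1 (by positivity)
  refine le_trans ?_ (add_le_add le_rfl h3)
  have h4 : 1 / 2 * (1 - f) ^ 2 + f⁻¹ / 2 * (3 * ε / 2) - ε / 2 =
      f⁻¹ / 4 * (2 * f * (1 - f) ^ 2 + ε * (3 - 2 * f)) := by
    field_simp; ring
  have h5 : 0 ≤ 2 * f * (1 - f) ^ 2 + ε * (3 - 2 * f) := by
    rcases le_total f (3 / 2) with h | h
    · have : 0 ≤ ε * (3 - 2 * f) := mul_nonneg hε0.le (by linarith)
      positivity
    · nlinarith [mul_nonneg (sub_nonneg.2 hε1.le) (by linarith : 0 ≤ 2 * f - 3),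
        mul_nonneg hf.le (sq_nonneg (3 * f - 4)), sq_nonneg (f - 3 / 2),
        mul_nonneg (sub_nonneg.2 h) (sq_nonneg (f - 3 / 2))]
  have : 0 ≤ f⁻¹ / 4 * (2 * f * (1 - f) ^ 2 + ε * (3 - 2 * f)) := mul_nonneg (by positivity) h5
  linarith

/-- The discrete energy dissipation law. -/
lemma modifiedEnergy_le_pred (hL : ∀ i, 0 < L i) {k N n : ℕ} (hk3 : 3 ≤ k) (hk5 : k ≤ 5)
    {ε τ : ℝ} (hε0 : 0 < ε) (hε1 : ε < 1) (hτ : 0 < τ) (hs : τ ≤ 2 / (3 * ε) * sigmaL k)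
    {φ : ℕ → L2 L} (h1 : AssumptionA1 k L φ) (h2 : IsBDFSolution k L ε τ N φ)
    (hkn : k ≤ n) (hn : n ≤ N) (hH : InH2 L (φ (n - 1))) :
    modifiedEnergy k L ε τ φ n ≤ modifiedEnergy k L ε τ φ (n - 1) := by
  obtain ⟨μ, hμ, hD⟩ := h2 n hkn hn
  have hz : ∀ j ≤ n, coef (backDiff φ j) 0 = 0 := fun j hj =>
    coef_backDiff_zero hL hk3 hk5 hτ h1 h2 j (hj.trans hn)
  have hE := energy_sub_le hL hμ hH
  have hG1 := (hasSum_gradFunctional hL k n hz).mul_left (1 / τ)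
  have hG2 := (hasSum_gradFunctional hL k (n - 1)
    fun j hj => hz j (hj.trans (Nat.sub_le _ _))).mul_left (1 / τ)
  have hv : φ n - φ (n - 1) = backDiff φ n := rfl
  rw [hv] at hE
  have hI := hasSum_coef_mul_coef hL μ (backDiff φ n)
  have hN := (hasSum_coef_sq hL (backDiff φ n)).mul_left (ε / 2)
  have hA := (hasSum_coef_sq hL ((φ n + lap L (φ n)) - (φ (n - 1) + lap L (φ (n - 1))))).mul_left
    (1 / 2)
  -- All contributions form one series over modes, whose terms are then shown to be nonpositive.
  have hle := (((hG1.sub hG2).add hI).add hN).sub hA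
  have hneg := hasSum_le (fun κ => ?_) hle hasSum_zero
  · rw [modifiedEnergy, modifiedEnergy]
    linarith
  · have hc : coef ((φ n + lap L (φ n)) - (φ (n - 1) + lap L (φ (n - 1)))) κ =
        (1 - freq L κ) * coef (backDiff φ n) κ := by
      rw [backDiff, coef_sub, coef_sub, coef_add, coef_add, coef_lap hL hμ.1, coef_lap hL hH]
      ring
    rw [hc]
    by_cases hκ : κ = 0
    · subst hκ
      rw [hz n le_rfl]
      simp
    · have hf := freq_pos hL hκ
      have hg := gradFunctional_le (n := n) hk3 hk5 fun j => coef (backDiff φ j) κ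
      have hb := (hasLaplacian_iff_coef hL).1 hD κ
      rw [coef_bdf hk3 hk5 hkn] at hb
      have hm := mode_energy_ineq hε0 hε1 hτ hs hf
      set c := coef (backDiff φ n) κ
      set G := gradFunctional k (fun x : ℝ => x ^ 2) (fun j => coef (backDiff φ j) κ) n
      set G' := gradFunctional k (fun x : ℝ => x ^ 2) (fun j => coef (backDiff φ j) κ) (n - 1)
      set S := ∑ i ∈ Finset.range k, bdfKernel k i * coef (backDiff φ (n - i)) κ
      set f := freq L κ
      have h3 : 1 / τ * f⁻¹ * (G - G' + sigmaL k / 2 * c ^ 2) ≤ 1 / τ * f⁻¹ * (c * S) :=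
        mul_le_mul_of_nonneg_left hg (by positivity)
      -- The scheme tested with `(-Δ)⁻¹` of the increment: dividing by `f` cancels the Laplacian
      -- acting on `μ`.
      have h4 : 1 / τ * f⁻¹ * (c * S) = -(coef μ κ * c) := by
        calc 1 / τ * f⁻¹ * (c * S) = f⁻¹ * c * (1 / τ * S) := by ring
          _ = _ := by rw [hb]; field_simp
      have h5 := mul_le_mul_of_nonneg_right hm (sq_nonneg c)
      rw [h4] at h3
      linarith

/-- Induction from level `k - 1`, where A2 supplies both regularity and the bound; afterwards the
scheme itself gives `H²`. The nonnegative functional is finally dropped. -/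
lemma energy_le_of_scheme (hL : ∀ i, 0 < L i) {k N : ℕ} (hk3 : 3 ≤ k) (hk5 : k ≤ 5)
    {ε τ c₀ : ℝ} (hε0 : 0 < ε) (hε1 : ε < 1) (hτ : 0 < τ)
    {φ : ℕ → L2 L} (h1 : AssumptionA2 k L ε τ φ c₀) (h2 : IsBDFSolution k L ε τ N φ)
    {n : ℕ} (hkn : k ≤ n) (hn : n ≤ N) : InH2 L (φ n) ∧ energy L ε (φ n) ≤ c₀ := by
  obtain ⟨hA1, hτ2, hH, hc⟩ := h1
  have hs : τ ≤ 2 / (3 * ε) * sigmaL k :=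
    hτ2.trans (mul_le_mul_of_nonneg_left (min_le_right _ _) (by positivity))
  have key : ∀ m, k - 1 + m ≤ N → InH2 L (φ (k - 1 + m)) ∧
      modifiedEnergy k L ε τ φ (k - 1 + m) ≤ c₀ := fun m => by
    induction m with
    | zero => exact fun _ => ⟨hH, hc⟩
    | succ m ih =>
      intro hm
      obtain ⟨i1, i2⟩ := ih (by omega)
      refine ⟨(h2 _ (by omega) hm).choose_spec.1.1, ?_⟩
      exact (modifiedEnergy_le_pred hL hk3 hk5 hε0 hε1 hτ hs hA1 h2 (by omega) hm i1).trans i2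
  obtain ⟨m, rfl⟩ : ∃ m, n = k - 1 + m := ⟨n - (k - 1), by omega⟩
  obtain ⟨i1, i2⟩ := key m hn
  refine ⟨i1, ?_⟩
  rw [modifiedEnergy] at i2
  have := gradFunctional_negNormSq_nonneg hL k (k - 1 + m) (v := backDiff φ) fun j hj =>
    coef_backDiff_zero hL hk3 hk5 hτ hA1 h2 j (hj.trans hn)
  have h3 : 0 ≤ 1 / τ * gradFunctional k (negNormSq L) (backDiff φ) (k - 1 + m) :=
    mul_nonneg (by positivity) this
  linarith

/-! ### Energy dissipation for the exact solution -/

/-- A function with quadratically small increments from above is nonincreasing. -/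
lemma le_of_sub_le_sq {f : ℝ → ℝ} {C T t : ℝ} (ht : 0 ≤ t) (htT : t ≤ T)
    (h : ∀ r s, 0 ≤ r → r ≤ s → s ≤ T → f s - f r ≤ C * (s - r) ^ 2) : f t ≤ f 0 := by
  -- Cutting `[0, t]` into `N` equal pieces gives `N · C (t/N)²`, which tends to `0`.
  have hN : ∀ N : ℕ, 0 < N → f t - f 0 ≤ C * t ^ 2 * (1 / (N : ℝ)) := fun N hN => by
    have hN' : (0 : ℝ) < N := by exact_mod_cast hN
    have h1 : f t - f 0 = ∑ i ∈ Finset.range N, (f ((i + 1 : ℕ) * (t / N)) - f (i * (t / N))) := by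
      rw [Finset.sum_range_sub (fun i : ℕ => f (i * (t / N)))]
      simp [mul_div_cancel₀ _ hN'.ne']
    rw [h1]
    have h2 : ∀ i ∈ Finset.range N, f ((i + 1 : ℕ) * (t / N)) - f (i * (t / N)) ≤
        C * (t / N) ^ 2 := fun i hi => by
      have hi' : ((i + 1 : ℕ) : ℝ) ≤ N := by exact_mod_cast Finset.mem_range.1 hi
      have hd : 0 ≤ t / N := by positivity
      refine (h _ _ (by positivity) ?_ ?_).trans (le_of_eq ?_)
      · push_cast; linarith
      · refine le_trans ?_ htT
        calc ((i + 1 : ℕ) : ℝ) * (t / N) ≤ N * (t / N) := mul_le_mul_of_nonneg_right hi' hd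
          _ = t := by field_simp
      · push_cast; ring
    refine (Finset.sum_le_sum h2).trans (le_of_eq ?_)
    rw [Finset.sum_const, Finset.card_range, nsmul_eq_mul]
    field_simp
  have hlim := (tendsto_one_div_atTop_nhds_zero_nat (𝕜 := ℝ)).const_mul (C * t ^ 2)
  rw [mul_zero] at hlim
  have := ge_of_tendsto hlim (Filter.eventually_atTop.2 ⟨1, fun N h => hN N h⟩)
  linarith

lemma exists_norm_invNegLap_le (hL : ∀ i, 0 < L i) :
    ∃ C : ℝ, 0 ≤ C ∧ ∀ v : L2 L, coef v 0 = 0 → ‖invNegLap L v‖ ≤ C * ‖v‖ := by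
  obtain ⟨c, hc, h⟩ := exists_le_freq hL
  refine ⟨c⁻¹, by positivity, fun v hv => ?_⟩
  have h2 : ‖invNegLap L v‖ ^ 2 ≤ (c⁻¹ * ‖v‖) ^ 2 := by
    rw [mul_pow]
    refine hasSum_le (fun κ => ?_) (hasSum_coef_sq hL _) ((hasSum_coef_sq hL v).mul_left (c⁻¹ ^ 2))
    rw [coef_invNegLap hL hv, div_eq_inv_mul, mul_pow]
    by_cases hκ : κ = 0
    · subst hκ; simp [hv]
    · exact mul_le_mul_of_nonneg_right (pow_le_pow_left₀ (inv_nonneg.2 (freq_nonneg L κ))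
        (inv_anti₀ hc (h κ hκ)) 2) (sq_nonneg _)
  exact (pow_le_pow_iff_left₀ (norm_nonneg _) (by positivity) two_ne_zero).1 h2

lemma negNormSq_nonneg (hL : ∀ i, 0 < L i) {v : L2 L} (hv : coef v 0 = 0) : 0 ≤ negNormSq L v :=
  (hasSum_negNormSq hL hv).nonneg fun κ =>
    mul_nonneg (inv_nonneg.2 (freq_nonneg L κ)) (sq_nonneg _)

lemma inner_eq_neg_inner_invNegLap (hL : ∀ i, 0 < L i) {μ d v : L2 L} (h : HasLaplacian L μ d)
    (hv : coef v 0 = 0) : ⟪μ, v⟫_ℝ = -⟪invNegLap L d, v⟫_ℝ := by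
  rw [← inner_neg_left]
  refine (hasSum_coef_mul_coef hL _ _).unique
    ((hasSum_coef_mul_coef hL (-invNegLap L d) v).congr_fun fun κ => ?_)
  by_cases hκ : κ = 0
  · subst hκ; simp [hv]
  · rw [coef_neg, coef_invNegLap hL (coef_zero_of_hasLaplacian hL h),
      (hasLaplacian_iff_coef hL).1 h]
    have := (freq_pos hL hκ).ne'
    field_simp

/-- Energy dissipation for solutions of the PFC equation, in terms of a first order expansion
in time with a uniform remainder. -/
lemma energy_le_initial (hL : ∀ i, 0 < L i) {ε T M K : ℝ} (hε : 0 ≤ ε) {Φ D : ℝ → L2 L}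
    (hsol : ∀ t ∈ Set.Icc 0 T, ∃ μ : L2 L, IsChemicalPotential L ε (Φ t) μ ∧
      HasLaplacian L μ (D t))
    (hder : ∀ t ∈ Set.Icc 0 T, HasDerivWithinAt Φ (D t) (Set.Icc 0 T) t)
    (hM : ∀ t ∈ Set.Icc 0 T, ‖D t‖ ≤ M)
    (hK : ∀ r s, 0 ≤ r → r ≤ s → s ≤ T → ‖Φ s - Φ r - (s - r) • D s‖ ≤ K * (s - r) ^ 2)
    {t : ℝ} (ht : t ∈ Set.Icc 0 T) : energy L ε (Φ t) ≤ energy L ε (Φ 0) := by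
  obtain ⟨C, hC0, hC⟩ := exists_norm_invNegLap_le hL
  have hT : 0 ≤ T := ht.1.trans ht.2
  have hM0 : 0 ≤ M := (norm_nonneg _).trans (hM t ht)
  refine le_of_sub_le_sq (f := fun t => energy L ε (Φ t)) (C := C * M * K + ε / 2 * M ^ 2) ht.1 ht.2
    fun r s hr hrs hs => ?_
  have hrT : r ∈ Set.Icc 0 T := ⟨hr, hrs.trans hs⟩
  have hsT : s ∈ Set.Icc 0 T := ⟨hr.trans hrs, hs⟩
  obtain ⟨μ, h1, h2⟩ := hsol s hsT
  have hE := energy_sub_le hL h1 (hsol r hrT).choose_spec.1.1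
  have hv : ‖Φ s - Φ r‖ ≤ M * (s - r) := by
    have := (convex_Icc 0 T).norm_image_sub_le_of_norm_hasDerivWithin_le hder hM hrT hsT
    rwa [Real.norm_of_nonneg (sub_nonneg.2 hrs)] at this
  -- Conservation of volume: the time derivative is a Laplacian, so the zero mode has derivative
  -- zero.
  have hz : coef (Φ s - Φ r) 0 = 0 := by
    have hd : ∀ t ∈ Set.Icc 0 T, HasDerivWithinAt (fun t => coef (Φ t) 0) 0 (Set.Icc 0 T) t :=
      fun t ht => by
        have hh : HasDerivWithinAt (fun t => coef (Φ t) 0) (innerSL ℝ (waveLp L 0) (D t))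
            (Set.Icc 0 T) t := ((innerSL ℝ (waveLp L 0)).hasFDerivAt (x := Φ t)).comp_hasDerivWithinAt t
          (hder t ht)
        obtain ⟨μ', -, h⟩ := hsol t ht
        have h0 := coef_zero_of_hasLaplacian hL h
        rwa [show innerSL ℝ (waveLp L 0) (D t) = 0 from h0] at hh
    have := (convex_Icc 0 T).norm_image_sub_le_of_norm_hasDerivWithin_le hd
      (fun t _ => (norm_zero (E := ℝ)).le) hrT hsT
    rw [zero_mul, norm_le_zero_iff] at this
    rw [coef_sub, this]
  have hd0 := coef_zero_of_hasLaplacian hL h2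
  have hμ : ⟪μ, Φ s - Φ r⟫_ℝ ≤ C * M * K * (s - r) ^ 2 := by
    rw [inner_eq_neg_inner_invNegLap hL h2 hz]
    -- The linear part contributes `-(s - r) ‖D s‖²_{-1}`, which has the good sign. The remainder is
    -- of second order; the expansion is at the later time `s`, where the convexity inequality
    -- evaluates `μ`.
    have e : Φ s - Φ r = (s - r) • D s + (Φ s - Φ r - (s - r) • D s) := by abel
    rw [e, inner_add_right, real_inner_smul_right]
    have i1 : 0 ≤ (s - r) * ⟪invNegLap L (D s), D s⟫_ℝ :=
      mul_nonneg (sub_nonneg.2 hrs) (negNormSq_nonneg hL hd0)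
    have i2 := abs_real_inner_le_norm (invNegLap L (D s)) (Φ s - Φ r - (s - r) • D s)
    have i3 : ‖invNegLap L (D s)‖ * ‖Φ s - Φ r - (s - r) • D s‖ ≤
        (C * M) * (K * (s - r) ^ 2) :=
      mul_le_mul ((hC _ hd0).trans (mul_le_mul_of_nonneg_left (hM s hsT) hC0))
        (hK r s hr hrs hs) (norm_nonneg _) (by positivity)
    have i4 := neg_abs_le ⟪invNegLap L (D s), Φ s - Φ r - (s - r) • D s⟫_ℝ
    linarith
  have hsq : ‖Φ s - Φ r‖ ^ 2 ≤ (M * (s - r)) ^ 2 := pow_le_pow_left₀ (norm_nonneg _) hv 2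
  have := mul_le_mul_of_nonneg_left hsq (by positivity : 0 ≤ ε / 2)
  have h0 : 0 ≤ 1 / 2 * ‖(Φ s + lap L (Φ s)) - (Φ r + lap L (Φ r))‖ ^ 2 := by positivity
  linarith

/-! ### Taylor expansion and consistency of the BDF formulas -/

section Taylor

variable {E : Type*} [NormedAddCommGroup E] [NormedSpace ℝ E]

/-- The Taylor polynomial at `t` built from a chain of derivatives. -/
def taylorSum (D : ℕ → ℝ → E) (m : ℕ) (t h : ℝ) : E :=
  ∑ i ∈ Finset.range (m + 1), (h ^ i / (i.factorial : ℝ)) • D i t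

lemma taylorSum_succ (D : ℕ → ℝ → E) (m : ℕ) (t h : ℝ) :
    taylorSum D (m + 1) t h =
      (∑ i ∈ Finset.range (m + 1), (h ^ (i + 1) / ((i + 1).factorial : ℝ)) • D (i + 1) t) +
        D 0 t := by
  rw [taylorSum, Finset.sum_range_succ']
  simp

lemma hasDerivAt_taylorSum_succ (D : ℕ → ℝ → E) (m : ℕ) (t x : ℝ) :
    HasDerivAt (fun x => taylorSum D (m + 1) t (x - t))
      (taylorSum (fun i => D (i + 1)) m t (x - t)) x := by
  simp only [taylorSum_succ]
  refine HasDerivAt.add_const _ ?_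
  rw [taylorSum]
  refine HasDerivAt.fun_sum fun i _ => ?_
  refine HasDerivAt.smul_const ?_ _
  have h := (((hasDerivAt_id x).sub_const t).pow (i + 1)).div_const ((i + 1).factorial : ℝ)
  refine h.congr_deriv ?_
  simp only [id, Nat.add_sub_cancel, mul_one, Nat.factorial_succ]
  push_cast
  have h1 : (i.factorial : ℝ) ≠ 0 := by exact_mod_cast i.factorial_ne_zero
  have h2 : (i : ℝ) + 1 ≠ 0 := by positivity
  field_simp

/-- Taylor's inequality for a chain of derivatives on an interval. -/
lemma norm_sub_taylorSum_le {a b M : ℝ} (hM : 0 ≤ M) (m : ℕ) : ∀ (D : ℕ → ℝ → E),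
    (∀ i ≤ m, ∀ t ∈ Set.Icc a b, HasDerivWithinAt (D i) (D (i + 1) t) (Set.Icc a b) t) →
    (∀ t ∈ Set.Icc a b, ‖D (m + 1) t‖ ≤ M) → ∀ s t, a ≤ s → s ≤ t → t ≤ b →
      ‖D 0 s - taylorSum D m t (s - t)‖ ≤ M * (t - s) ^ (m + 1) := by
  induction m with
  | zero =>
    intro D hD hb s t hs hst ht
    have := (convex_Icc a b).norm_image_sub_le_of_norm_hasDerivWithin_le (hD 0 le_rfl) hb
      ⟨hs.trans hst, ht⟩ ⟨hs, hst.trans ht⟩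
    rw [Real.norm_eq_abs, abs_sub_comm, abs_of_nonneg (sub_nonneg.2 hst)] at this
    simpa [taylorSum] using this
  | succ m ih =>
    intro D hD hb s t hs hst ht
    -- The derivative of the remainder of order `m + 1` is the remainder of order `m` of the shifted
    -- chain. The mean value inequality then adds one power of `t - s`, without the factorial.
    have h1 := ih (fun i => D (i + 1)) (fun i hi => hD (i + 1) (by omega)) hb
    have hsub : Set.Icc s t ⊆ Set.Icc a b := Set.Icc_subset_Icc hs ht
    have hder : ∀ x ∈ Set.Icc s t, HasDerivWithinAt
        (fun x => D 0 x - taylorSum D (m + 1) t (x - t))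
        (D 1 x - taylorSum (fun i => D (i + 1)) m t (x - t)) (Set.Icc s t) x := fun x hx =>
      ((hD 0 (by omega) x (hsub hx)).mono hsub).sub
        (hasDerivAt_taylorSum_succ D m t x).hasDerivWithinAt
    have hbound : ∀ x ∈ Set.Icc s t,
        ‖D 1 x - taylorSum (fun i => D (i + 1)) m t (x - t)‖ ≤ M * (t - s) ^ (m + 1) :=
      fun x hx => (h1 x t (hs.trans hx.1) hx.2 ht).trans <|
        mul_le_mul_of_nonneg_left (pow_le_pow_left₀ (sub_nonneg.2 hx.2) (by linarith [hx.1]) _) hM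
    have := (convex_Icc s t).norm_image_sub_le_of_norm_hasDerivWithin_le hder hbound
      (Set.right_mem_Icc.2 hst) (Set.left_mem_Icc.2 hst)
    have h0 : D 0 t - taylorSum D (m + 1) t (t - t) = 0 := by
      simp [taylorSum_succ]
    simp only [h0, sub_zero] at this
    rw [Real.norm_eq_abs, abs_sub_comm, abs_of_nonneg (sub_nonneg.2 hst)] at this
    rwa [mul_assoc, ← pow_succ] at this

/-- The BDF formulas are exact on polynomials of degree at most `k`. -/
lemma bdf_taylorSum {k : ℕ} (hk3 : 3 ≤ k) (hk5 : k ≤ 5) (D : ℕ → ℝ → E) (t τ : ℝ) :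
    ∑ i ∈ Finset.range k, bdfKernel k i •
      (taylorSum D k t (-(i * τ)) - taylorSum D k t (-((i + 1 : ℕ) * τ))) = τ • D 1 t := by
  interval_cases k
  · simp only [taylorSum, Finset.sum_range_succ, Finset.sum_range_zero, bdfKernel_three,
      Nat.factorial]
    norm_num
    module
  · simp only [taylorSum, Finset.sum_range_succ, Finset.sum_range_zero, bdfKernel_four,
      Nat.factorial]
    norm_num
    module
  · simp only [taylorSum, Finset.sum_range_succ, Finset.sum_range_zero, bdfKernel_five,
      Nat.factorial]
    norm_num
    module

/-- Consistency of the BDF formulas. -/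
lemma norm_bdf_sub_le {k n : ℕ} (hk3 : 3 ≤ k) (hk5 : k ≤ 5) (hkn : k ≤ n) {T M τ : ℝ}
    (hM : 0 ≤ M) (hτ : 0 < τ) (hn : n * τ ≤ T) {D : ℕ → ℝ → E}
    (hD : ∀ i ≤ k, ∀ t ∈ Set.Icc 0 T, HasDerivWithinAt (D i) (D (i + 1) t) (Set.Icc 0 T) t)
    (hb : ∀ t ∈ Set.Icc 0 T, ‖D (k + 1) t‖ ≤ M) :
    ‖bdf k τ (fun j => D 0 (j * τ)) n - D 1 (n * τ)‖ ≤ 30 * 5 ^ 6 * M * τ ^ k := by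
  set t := (n : ℝ) * τ with ht
  let R : ℕ → E := fun j => D 0 (((n - j : ℕ) : ℝ) * τ) - taylorSum D k t (-(j * τ))
  have hR : ∀ j ≤ k, ‖R j‖ ≤ M * (5 ^ 6 * τ ^ (k + 1)) := fun j hj => by
    have hjn : ((n - j : ℕ) : ℝ) = n - j := by
      rw [Nat.cast_sub (hj.trans hkn)]
    have h := norm_sub_taylorSum_le hM k D hD hb (((n - j : ℕ) : ℝ) * τ) t (by positivity)
      (by rw [hjn, ht]; nlinarith [mul_nonneg (Nat.cast_nonneg (α := ℝ) j) hτ.le]) hn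
    have e1 : ((n - j : ℕ) : ℝ) * τ - t = -(j * τ) := by rw [hjn, ht]; ring
    have e2 : t - ((n - j : ℕ) : ℝ) * τ = j * τ := by rw [hjn, ht]; ring
    rw [e1, e2] at h
    refine h.trans (mul_le_mul_of_nonneg_left ?_ hM)
    rw [mul_pow]
    refine mul_le_mul_of_nonneg_right ?_ (by positivity)
    have hj5 : (j : ℝ) ≤ 5 := by exact_mod_cast hj.trans hk5
    calc (j : ℝ) ^ (k + 1) ≤ 5 ^ (k + 1) := pow_le_pow_left₀ (by positivity) hj5 _
      _ ≤ 5 ^ 6 := pow_le_pow_right₀ (by norm_num) (by omega)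
  have hsum : bdf k τ (fun j => D 0 (j * τ)) n - D 1 t =
      (1 / τ) • ∑ i ∈ Finset.range k, bdfKernel k i • (R i - R (i + 1)) := by
    have h1 : D 1 t = (1 / τ) • τ • D 1 t := by
      rw [smul_smul, one_div_mul_cancel hτ.ne', one_smul]
    rw [h1, ← bdf_taylorSum hk3 hk5 D t τ, bdf,
      sum_Icc_kernel (fun j hj => bdfKernel_eq_zero hk3 hk5 hj) hkn, ← smul_sub,
      ← Finset.sum_sub_distrib]
    congr 1
    refine Finset.sum_congr rfl fun i _ => ?_
    rw [← smul_sub, backDiff, Nat.sub_sub]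
    congr 1
    simp only [R]
    abel
  rw [hsum, norm_smul, Real.norm_of_nonneg (by positivity)]
  -- At most five taps, `|b_i| ≤ 3` and two remainders each give `30`; the `5 ^ 6` bounds `j^(k+1)`
  -- for `j ≤ k ≤ 5`.
  have h2 : ‖∑ i ∈ Finset.range k, bdfKernel k i • (R i - R (i + 1))‖ ≤
      ∑ _i ∈ Finset.range k, 3 * (2 * (M * (5 ^ 6 * τ ^ (k + 1)))) := by
    refine norm_sum_le_of_le _ fun i hi => ?_
    have hi' := Finset.mem_range.1 hi
    rw [norm_smul]
    refine mul_le_mul (abs_bdfKernel_le hk3 hk5 i) ?_ (norm_nonneg _) (by norm_num)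
    refine (norm_sub_le _ _).trans ?_
    linarith [hR i hi'.le, hR (i + 1) hi']
  rw [Finset.sum_const, Finset.card_range, nsmul_eq_mul] at h2
  have hk5' : (k : ℝ) ≤ 5 := by exact_mod_cast hk5
  calc 1 / τ * _ ≤ 1 / τ * (5 * (3 * (2 * (M * (5 ^ 6 * τ ^ (k + 1)))))) := by
        refine mul_le_mul_of_nonneg_left (h2.trans ?_) (by positivity)
        exact mul_le_mul_of_nonneg_right hk5' (by positivity)
    _ = _ := by
        field_simp; ring

end Taylor

/-- The chain of derivatives of a function of class `C^m` on a compact interval. -/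
lemma exists_deriv_chain {E : Type*} [NormedAddCommGroup E] [NormedSpace ℝ E] {T : ℝ} (hT : 0 < T)
    {m : ℕ} {Φ : ℝ → E} (hΦ : ContDiffOn ℝ ((m + 1 : ℕ) : WithTop ℕ∞) Φ (Set.Icc 0 T)) :
    ∃ (D : ℕ → ℝ → E) (M : ℝ), D 0 = Φ ∧ D 1 = derivWithin Φ (Set.Icc 0 T) ∧ 0 ≤ M ∧
      (∀ i ≤ m, ∀ t ∈ Set.Icc 0 T, HasDerivWithinAt (D i) (D (i + 1) t) (Set.Icc 0 T) t) ∧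
      ∀ i ≤ m + 1, ∀ t ∈ Set.Icc 0 T, ‖D i t‖ ≤ M := by
  have hu := uniqueDiffOn_Icc hT
  have hb : ∀ i ≤ m + 1, ∃ M : ℝ, ∀ t ∈ Set.Icc 0 T, ‖iteratedDerivWithin i Φ (Set.Icc 0 T) t‖ ≤ M :=
    fun i hi => isCompact_Icc.exists_bound_of_continuousOn
      (hΦ.continuousOn_iteratedDerivWithin (by exact_mod_cast hi) hu)
  choose! B hB using hb
  refine ⟨fun i => iteratedDerivWithin i Φ (Set.Icc 0 T), ∑ i ∈ Finset.range (m + 2), |B i|,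
    iteratedDerivWithin_zero, iteratedDerivWithin_one, Finset.sum_nonneg fun _ _ => abs_nonneg _,
    fun i hi t ht => ?_, fun i hi t ht => ?_⟩
  · change HasDerivWithinAt (iteratedDerivWithin i Φ (Set.Icc 0 T))
      (iteratedDerivWithin (i + 1) Φ (Set.Icc 0 T) t) (Set.Icc 0 T) t
    rw [iteratedDerivWithin_succ]
    exact (hΦ.differentiableOn_iteratedDerivWithin
      (by exact_mod_cast Nat.lt_succ_of_le hi) hu t ht).hasDerivWithinAt
  · refine (hB i hi t ht).trans ((le_abs_self _).trans ?_)
    exact Finset.single_le_sum (f := fun i => |B i|) (fun _ _ => abs_nonneg _)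
      (Finset.mem_range.2 (by omega))

/-! ### Stability in L² -/

lemma conv_congr {f g h : ℕ → ℝ} {p : ℕ} (H : ∀ i ≤ p, g i = h i) : conv f g p = conv f h p :=
  Finset.sum_congr rfl fun i hi => by rw [H i (by simpa [Nat.lt_succ_iff] using hi)]

lemma Icc_succ_eq_image (k p : ℕ) :
    Finset.Icc k (k + p) = (Finset.range (p + 1)).map (addLeftEmbedding k) := by
  ext j
  simp only [Finset.mem_Icc, Finset.mem_map, Finset.mem_range, addLeftEmbedding_apply]
  exact ⟨fun h => ⟨j - k, by omega, by omega⟩, by rintro ⟨i, hi, rfl⟩; omega⟩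

lemma sum_Icc_add {E : Type*} [AddCommMonoid E] (k p : ℕ) (f : ℕ → E) :
    ∑ j ∈ Finset.Icc k (k + p), f j = ∑ i ∈ Finset.range (p + 1), f (k + i) := by
  rw [Icc_succ_eq_image, Finset.sum_map]; rfl

/-- Inversion of the BDF convolution by the orthogonal kernels, including the starting values. -/
lemma backDiff_eq_conv_doc {k : ℕ} (hk3 : 3 ≤ k) (hk5 : k ≤ 5) (a F : ℕ → ℝ) (τ : ℝ) {p : ℕ}
    (h : ∀ i ≤ p, ∑ j ∈ Finset.Icc 1 (k + i), bdfKernel k (k + i - j) * backDiff a j = τ * F i) :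
    backDiff a (k + p) = τ * conv (docKernel k) F p -
      ∑ l ∈ Finset.Icc 1 (k - 1), startWeight k l (k + p) * backDiff a l := by
  -- Only differences from level `k` on are inverted; those below `k` move to the right and, after
  -- convolution with `θ`, become the starting effect.
  have hsplit : ∀ i, conv (bdfKernel k) (fun i => backDiff a (k + i)) i =
      (∑ j ∈ Finset.Icc 1 (k + i), bdfKernel k (k + i - j) * backDiff a j) -
        ∑ l ∈ Finset.Icc 1 (k - 1), bdfKernel k (k + i - l) * backDiff a l := fun i => by
    have hI : Finset.Icc 1 (k + i) = Finset.Icc 1 (k - 1) ∪ Finset.Icc k (k + i) := by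
      ext j; simp only [Finset.mem_union, Finset.mem_Icc]; omega
    have hd : Disjoint (Finset.Icc 1 (k - 1)) (Finset.Icc k (k + i)) := by
      rw [Finset.disjoint_left]; intro j; simp only [Finset.mem_Icc]; omega
    rw [hI, Finset.sum_union hd, add_sub_cancel_left, sum_Icc_add, conv]
    refine Finset.sum_congr rfl fun j _ => ?_
    rw [Nat.add_sub_add_left]
  have h1 := conv_doc_conv_bdf hk3 hk5 (fun i => backDiff a (k + i)) p
  rw [conv_congr (h := fun i => τ * F i -
    ∑ l ∈ Finset.Icc 1 (k - 1), bdfKernel k (k + i - l) * backDiff a l)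
    fun i hi => by rw [hsplit, h i hi]] at h1
  rw [← h1, conv, conv]
  simp only [mul_sub, Finset.sum_sub_distrib]
  congr 1
  · rw [Finset.mul_sum]
    exact Finset.sum_congr rfl fun i _ => by ring
  · simp only [Finset.mul_sum]
    rw [Finset.sum_comm]
    refine Finset.sum_congr rfl fun l _ => ?_
    rw [startWeight, sum_Icc_add, Finset.sum_mul]
    refine Finset.sum_congr rfl fun i _ => ?_
    rw [Nat.add_sub_add_left]
    ring

lemma sq_sub_sq_le_sum (a : ℕ → ℝ) {k : ℕ} (hk : 1 ≤ k) (M : ℕ) :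
    a (k + M - 1) ^ 2 - a (k - 1) ^ 2 ≤
      2 * ∑ p ∈ Finset.range M, a (k + p) * backDiff a (k + p) := by
  induction M with
  | zero => simp
  | succ M ih =>
    rw [Finset.sum_range_succ, show k + (M + 1) - 1 = k + M by omega, backDiff]
    nlinarith [sq_nonneg (a (k + M) - a (k + M - 1))]

/-- The nonlinear term stands under a Laplacian and costs `f²` after Young's inequality. The sixth
order dissipation, which degenerates at `f = 0` and `f = 1`, absorbs this up to a constant. -/
lemma sq_le_symbol {f : ℝ} (hf : 0 ≤ f) : f ^ 2 ≤ f * (1 - f) ^ 2 + 4 := by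
  nlinarith [mul_nonneg hf (sq_nonneg (f - 2)), sq_nonneg (f - 2)]

lemma conv_add (f g h : ℕ → ℝ) (p : ℕ) :
    conv f (fun i => g i + h i) p = conv f g p + conv f h p := by
  simp only [conv, mul_add, Finset.sum_add_distrib]

lemma conv_const_mul (f g : ℕ → ℝ) (c : ℝ) (p : ℕ) :
    conv f (fun i => c * g i) p = c * conv f g p := by
  simp only [conv, Finset.mul_sum]
  exact Finset.sum_congr rfl fun i _ => by ring

/-- The energy estimate for a single Fourier mode with eigenvalue `f`. -/
lemma mode_estimate {k : ℕ} (hk3 : 3 ≤ k) (hk5 : k ≤ 5) {f τ : ℝ} (hf : 0 ≤ f) (hτ : 0 ≤ τ)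
    (a g z : ℕ → ℝ) (M : ℕ)
    (h : ∀ p < M, ∑ j ∈ Finset.Icc 1 (k + p), bdfKernel k (k + p - j) * backDiff a j =
      τ * (-f * ((1 - f) ^ 2 * a (k + p) + g p) + z p)) :
    a (k + M - 1) ^ 2 ≤ a (k - 1) ^ 2 +
      τ * ∑ p ∈ Finset.range M, (sigmaL k / 25 * a (k + p) ^ 2 +
        400 / sigmaL k ^ 3 * g p ^ 2) +
      2 * τ * ∑ p ∈ Finset.range M, ∑ i ∈ Finset.range (p + 1),
        docKernel k (p - i) * (a (k + p) * z i) -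
      2 * ∑ p ∈ Finset.range M, ∑ l ∈ Finset.Icc 1 (k - 1),
        startWeight k l (k + p) * (backDiff a l * a (k + p)) := by
  have hs := sigmaL_pos hk3 hk5
  set x : ℕ → ℝ := fun p => a (k + p) with hx
  have hback : ∀ p ∈ Finset.range M, x p * backDiff a (k + p) =
      τ * (-(f * (1 - f) ^ 2) * (x p * conv (docKernel k) x p) -
        f * x p * conv (docKernel k) g p + x p * conv (docKernel k) z p) -
      x p * ∑ l ∈ Finset.Icc 1 (k - 1), startWeight k l (k + p) * backDiff a l := fun p hp => by
    have hp' := Finset.mem_range.1 hp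
    rw [backDiff_eq_conv_doc hk3 hk5 a (fun i => -(f * (1 - f) ^ 2) * x i + (-f * g i + z i)) τ
      fun i hi => by rw [h i (by omega)]; simp only [hx]; ring,
      conv_add, conv_add, conv_const_mul, conv_const_mul]
    ring
  have h1 := sq_sub_sq_le_sum a (by omega : 1 ≤ k) M
  rw [Finset.sum_congr rfl hback, Finset.sum_sub_distrib, ← Finset.mul_sum,
    Finset.sum_add_distrib, Finset.sum_sub_distrib, ← Finset.mul_sum] at h1
  have hxx := mul_le_mul_of_nonneg_left (sum_mul_conv_doc_ge hk3 hk5 x M)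
    (by positivity : 0 ≤ f * (1 - f) ^ 2)
  have hgg := sum_conv_doc_sq_le hk3 hk5 g M
  -- The Young weights match the coercivity constant `σ/200`. The symbol inequality leaves `4σ/200 =
  -- σ/50`, and boundedness of `θ` turns `50/σ` into `200/σ³`; doubling through the telescoped
  -- squares gives `σ/25` and `400/σ³`.
  have hxg : -∑ p ∈ Finset.range M, f * x p * conv (docKernel k) g p ≤
      sigmaL k / 200 * f ^ 2 * ∑ p ∈ Finset.range M, x p ^ 2 +
        50 / sigmaL k * ∑ p ∈ Finset.range M, conv (docKernel k) g p ^ 2 := by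
    rw [← Finset.sum_neg_distrib, Finset.mul_sum, Finset.mul_sum, ← Finset.sum_add_distrib]
    refine Finset.sum_le_sum fun p _ => ?_
    have : sigmaL k / 200 * f ^ 2 * x p ^ 2 + 50 / sigmaL k * conv (docKernel k) g p ^ 2 +
        f * x p * conv (docKernel k) g p =
        1 / (200 * sigmaL k) * (sigmaL k * f * x p + 100 * conv (docKernel k) g p) ^ 2 := by
      field_simp; ring
    have h0 : 0 ≤ 1 / (200 * sigmaL k) *
      (sigmaL k * f * x p + 100 * conv (docKernel k) g p) ^ 2 := by positivity
    linarith
  have hX : 0 ≤ ∑ p ∈ Finset.range M, x p ^ 2 := Finset.sum_nonneg fun p _ => sq_nonneg _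
  have hsym := mul_le_mul_of_nonneg_right
    (mul_le_mul_of_nonneg_left (sq_le_symbol hf) (by positivity : 0 ≤ sigmaL k / 200)) hX
  have hgg' := mul_le_mul_of_nonneg_left hgg (by positivity : 0 ≤ 50 / sigmaL k)
  have e1 : 50 / sigmaL k * (4 / sigmaL k ^ 2 * ∑ p ∈ Finset.range M, g p ^ 2) =
      200 / sigmaL k ^ 3 * ∑ p ∈ Finset.range M, g p ^ 2 := by field_simp; norm_num; ring
  have hfin : -(f * (1 - f) ^ 2) * ∑ p ∈ Finset.range M, x p * conv (docKernel k) x p -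
      ∑ p ∈ Finset.range M, f * x p * conv (docKernel k) g p ≤
      sigmaL k / 50 * ∑ p ∈ Finset.range M, x p ^ 2 +
        200 / sigmaL k ^ 3 * ∑ p ∈ Finset.range M, g p ^ 2 := by linarith
  have e2 : ∀ p, x p * conv (docKernel k) z p = ∑ i ∈ Finset.range (p + 1),
      docKernel k (p - i) * (a (k + p) * z i) := fun p => by
    rw [conv, Finset.mul_sum]
    exact Finset.sum_congr rfl fun i _ => by simp only [hx]; ring
  have e3 : ∀ p, x p * ∑ l ∈ Finset.Icc 1 (k - 1), startWeight k l (k + p) * backDiff a l =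
      ∑ l ∈ Finset.Icc 1 (k - 1), startWeight k l (k + p) * (backDiff a l * a (k + p)) :=
    fun p => by
      rw [Finset.mul_sum]
      exact Finset.sum_congr rfl fun i _ => by simp only [hx]; ring
  simp only [e2, e3] at h1
  have hfin' := mul_le_mul_of_nonneg_left hfin hτ
  rw [Finset.sum_add_distrib, ← Finset.mul_sum, ← Finset.mul_sum]
  have e4 : 400 / sigmaL k ^ 3 = 2 * (200 / sigmaL k ^ 3) := by ring
  rw [e4]
  linarith

/-- At an index where `E` attains a new maximum, every term on the right contains a factor at most
that maximum, so one division turns the quadratic inequality into a linear one for the running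
maximum. The linear Gronwall argument uses `1 ≤ (1 - c) e^{2c}` for `c ≤ 1/2`. -/
lemma gronwall_running_max {E w : ℕ → ℝ} {S c : ℝ} {M₀ : ℕ} (hE : ∀ p, 0 ≤ E p)
    (hw : ∀ p, 0 ≤ w p) (hS : 0 ≤ S) (hc : 0 ≤ c) (hc2 : c ≤ 1 / 2)
    (h : ∀ M < M₀, E M ^ 2 ≤ S ^ 2 + c * ∑ p ∈ Finset.range (M + 1), E p ^ 2 +
      ∑ p ∈ Finset.range (M + 1), E p * w p) {M : ℕ} (hM : M < M₀) :
    E M ≤ Real.exp (2 * c * (M + 1 : ℕ)) * (S + ∑ p ∈ Finset.range (M + 1), w p) := by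
  -- Running maximum started at `S`, with the index shifted by one: `B n` sees `E p` only for `p <
  -- n`.
  let B : ℕ → ℝ := fun n => Nat.rec S (fun p b => max b (E p)) n
  have hB0 : B 0 = S := rfl
  have hBs : ∀ p, B (p + 1) = max (B p) (E p) := fun p => rfl
  have hBmono : Monotone B := monotone_nat_of_le_succ fun p => by rw [hBs]; exact le_max_left _ _
  have hEB : ∀ p, E p ≤ B (p + 1) := fun p => by rw [hBs]; exact le_max_right _ _
  have hSB : ∀ p, S ≤ B p := fun p => hBmono (Nat.zero_le p)
  have hBnn : ∀ p, 0 ≤ B p := fun p => hS.trans (hSB p)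
  have key : ∀ n ≤ M₀, B n ≤ S + ∑ p ∈ Finset.range n, w p + c * ∑ p ∈ Finset.range n, B (p + 1) := by
    intro n
    induction n with
    | zero => intro _; simp [hB0]
    | succ n ih =>
      intro hn
      rcases le_total (E n) (B n) with hle | hle
      · have i := ih (by omega)
        rw [Finset.sum_range_succ, Finset.sum_range_succ, hBs n, max_eq_left hle]
        have := mul_nonneg hc (hBnn n)
        have := hw n
        linarith
      · have hEn : B (n + 1) = E n := by rw [hBs, max_eq_right hle]
        rw [hEn]
        rcases (hE n).eq_or_lt with h0 | h0
        · rw [← h0]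
          have := Finset.sum_nonneg fun p (_ : p ∈ Finset.range (n + 1)) => hw p
          have := mul_nonneg hc
            (Finset.sum_nonneg fun p (_ : p ∈ Finset.range (n + 1)) => hBnn (p + 1))
          linarith
        · have hp : ∀ p ∈ Finset.range (n + 1), E p ≤ E n := fun p hp => by
            rw [← hEn]
            exact (hEB p).trans (hBmono (Nat.succ_le_of_lt (Finset.mem_range.1 hp)))
          have i := h n (by omega)
          have i1 : ∑ p ∈ Finset.range (n + 1), E p ^ 2 ≤
              E n * ∑ p ∈ Finset.range (n + 1), B (p + 1) := by
            rw [Finset.mul_sum]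
            refine Finset.sum_le_sum fun p hp' => ?_
            rw [pow_two]
            exact mul_le_mul (hp p hp') (hEB p) (hE p) h0.le
          have i2 : ∑ p ∈ Finset.range (n + 1), E p * w p ≤
              E n * ∑ p ∈ Finset.range (n + 1), w p := by
            rw [Finset.mul_sum]
            exact Finset.sum_le_sum fun p hp' => mul_le_mul_of_nonneg_right (hp p hp') (hw p)
          have i3 : S ^ 2 ≤ E n * S := by
            rw [pow_two]
            exact mul_le_mul_of_nonneg_right ((hSB n).trans hle) hS
          have i4 := mul_le_mul_of_nonneg_left i1 hc
          refine le_of_mul_le_mul_left ?_ h0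
          nlinarith
  set Q := S + ∑ p ∈ Finset.range (M + 1), w p with hQ
  have hQ0 : 0 ≤ Q := add_nonneg hS (Finset.sum_nonneg fun p _ => hw p)
  have hexp : 1 ≤ (1 - c) * Real.exp (2 * c) := by
    have := Real.add_one_le_exp (2 * c)
    nlinarith
  have hU : ∀ n ≤ M + 1, Q + c * ∑ p ∈ Finset.range n, B (p + 1) ≤
      Q * Real.exp (2 * c) ^ n := by
    intro n
    induction n with
    | zero => intro _; simp
    | succ n ih =>
      intro hn
      have i1 := ih (by omega)
      have i2 := key (n + 1) (by omega)
      have i3 : ∑ p ∈ Finset.range (n + 1), w p ≤ ∑ p ∈ Finset.range (M + 1), w p :=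
        Finset.sum_le_sum_of_subset_of_nonneg (Finset.range_subset_range.2 (by omega))
          fun p _ _ => hw p
      set U := Q + c * ∑ p ∈ Finset.range (n + 1), B (p + 1) with hUdef
      have i4 : B (n + 1) ≤ U := by linarith
      have i5 : (1 - c) * U ≤ Q + c * ∑ p ∈ Finset.range n, B (p + 1) := by
        have e : U = Q + c * ∑ p ∈ Finset.range n, B (p + 1) + c * B (n + 1) := by
          rw [hUdef, Finset.sum_range_succ]; ring
        have := mul_le_mul_of_nonneg_left i4 hc
        linarith
      have hU0 : 0 ≤ U := (hBnn (n + 1)).trans i4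
      calc U ≤ ((1 - c) * Real.exp (2 * c)) * U := le_mul_of_one_le_left hU0 hexp
        _ = Real.exp (2 * c) * ((1 - c) * U) := by ring
        _ ≤ Real.exp (2 * c) * (Q * Real.exp (2 * c) ^ n) :=
          mul_le_mul_of_nonneg_left (i5.trans i1) (Real.exp_pos _).le
        _ = _ := by ring
  have e : Real.exp (2 * c * (M + 1 : ℕ)) = Real.exp (2 * c) ^ (M + 1) := by
    rw [← Real.exp_nat_mul]; congr 1; ring
  rw [e, mul_comm]
  exact (hEB M).trans ((key (M + 1) (by omega)).trans (hU (M + 1) le_rfl))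

/-- The energy estimate in `L²` for the perturbed linear scheme. -/
lemma norm_sq_estimate (hL : ∀ i, 0 < L i) {k : ℕ} (hk3 : 3 ≤ k) (hk5 : k ≤ 5) {τ : ℝ}
    (hτ : 0 < τ) (e g ξ : ℕ → L2 L) (M : ℕ)
    (h : ∀ p < M, ∀ κ, coef (bdf k τ e (k + p)) κ =
      -freq L κ * ((1 - freq L κ) ^ 2 * coef (e (k + p)) κ + coef (g p) κ) + coef (ξ p) κ) :
    ‖e (k + M - 1)‖ ^ 2 ≤ ‖e (k - 1)‖ ^ 2 +
      τ * ∑ p ∈ Finset.range M, (sigmaL k / 25 * ‖e (k + p)‖ ^ 2 +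
        400 / sigmaL k ^ 3 * ‖g p‖ ^ 2) +
      2 * τ * ∑ p ∈ Finset.range M, ∑ i ∈ Finset.range (p + 1),
        docKernel k (p - i) * ⟪e (k + p), ξ i⟫_ℝ -
      2 * ∑ p ∈ Finset.range M, ∑ l ∈ Finset.Icc 1 (k - 1),
        startWeight k l (k + p) * ⟪backDiff e l, e (k + p)⟫_ℝ := by
  have s1 := hasSum_sum (s := Finset.range M) fun p _ =>
    ((hasSum_coef_sq hL (e (k + p))).mul_left (sigmaL k / 25)).add
      ((hasSum_coef_sq hL (g p)).mul_left (400 / sigmaL k ^ 3))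
  have s2 := hasSum_sum (s := Finset.range M) fun p _ =>
    hasSum_sum (s := Finset.range (p + 1)) fun i _ =>
      (hasSum_coef_mul_coef hL (e (k + p)) (ξ i)).mul_left (docKernel k (p - i))
  have s3 := hasSum_sum (s := Finset.range M) fun p _ =>
    hasSum_sum (s := Finset.Icc 1 (k - 1)) fun l _ =>
      (hasSum_coef_mul_coef hL (backDiff e l) (e (k + p))).mul_left (startWeight k l (k + p))
  refine hasSum_le (fun κ => ?_) (hasSum_coef_sq hL (e (k + M - 1)))
    ((((hasSum_coef_sq hL (e (k - 1))).add (s1.mul_left τ)).add (s2.mul_left (2 * τ))).sub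
      (s3.mul_left 2))
  simp only [coef_backDiff]
  refine mode_estimate hk3 hk5 (freq_nonneg L κ) hτ.le (fun n => coef (e n) κ)
    (fun p => coef (g p) κ) (fun p => coef (ξ p) κ) M fun p hp => ?_
  rw [← h p hp κ, bdf, coef_smul, coef_sum, ← mul_assoc, mul_one_div_cancel hτ.ne', one_mul]
  exact Finset.sum_congr rfl fun j _ => by rw [coef_smul, coef_backDiff]

lemma norm_backDiff_le {E : Type*} [NormedAddCommGroup E] (e : ℕ → E) (k : ℕ) :
    ∑ l ∈ Finset.Icc 1 (k - 1), ‖backDiff e l‖ ≤ 2 * ∑ l ∈ Finset.range k, ‖e l‖ := by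
  have h1 : ∑ l ∈ Finset.Icc 1 (k - 1), ‖e l‖ ≤ ∑ l ∈ Finset.range k, ‖e l‖ :=
    Finset.sum_le_sum_of_subset_of_nonneg (fun l hl => by
      simp only [Finset.mem_Icc, Finset.mem_range] at *; omega) fun _ _ _ => norm_nonneg _
  have h2 : ∑ l ∈ Finset.Icc 1 (k - 1), ‖e (l - 1)‖ ≤ ∑ l ∈ Finset.range k, ‖e l‖ := by
    rw [← Finset.sum_image (f := fun l => ‖e l‖) (g := fun l => l - 1) (s := Finset.Icc 1 (k - 1))
      (by intro a ha b hb hab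
          simp only [Finset.coe_Icc, Set.mem_Icc] at ha hb hab; omega)]
    refine Finset.sum_le_sum_of_subset_of_nonneg (fun l hl => ?_) fun _ _ _ => norm_nonneg _
    simp only [Finset.mem_image, Finset.mem_Icc, Finset.mem_range] at *
    omega
  calc _ ≤ ∑ l ∈ Finset.Icc 1 (k - 1), (‖e l‖ + ‖e (l - 1)‖) :=
        Finset.sum_le_sum fun l _ => norm_sub_le _ _
    _ ≤ _ := by rw [Finset.sum_add_distrib]; linarith

/-- Stability of the BDF schemes in `L²`. -/
lemma norm_error_le (hL : ∀ i, 0 < L i) {k : ℕ} (hk3 : 3 ≤ k) (hk5 : k ≤ 5)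
    {τ a c Ξ Cθ Cs : ℝ} (hτ : 0 < τ) (hΞ : 0 ≤ Ξ) (hCθ : 0 ≤ Cθ) (hCs : 0 ≤ Cs)
    (hθ : ∀ p, |docKernel k p| ≤ Cθ * ((k : ℝ) / 7) ^ p)
    (hW : ∀ l n, l ≤ k - 1 → k ≤ n → |startWeight k l n| ≤ Cs * ((k : ℝ) / 7) ^ (n - k))
    (hc : sigmaL k / 25 + 400 / sigmaL k ^ 3 * a ^ 2 ≤ c) (hcτ : c * τ ≤ 1 / 2)
    (e g ξ : ℕ → L2 L) (M : ℕ)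
    (h : ∀ p ≤ M, ∀ κ, coef (bdf k τ e (k + p)) κ =
      -freq L κ * ((1 - freq L κ) ^ 2 * coef (e (k + p)) κ + coef (g p) κ) + coef (ξ p) κ)
    (hg : ∀ p ≤ M, ‖g p‖ ≤ a * ‖e (k + p)‖) (hξ : ∀ p ≤ M, ‖ξ p‖ ≤ Ξ) :
    ‖e (k + M)‖ ≤ Real.exp (2 * (c * τ) * (M + 1 : ℕ)) *
      ((1 + 4 * Cs * (1 - (k : ℝ) / 7)⁻¹) * ∑ l ∈ Finset.range k, ‖e l‖ +
        2 * Cθ * (1 - (k : ℝ) / 7)⁻¹ * Ξ * (τ * (M + 1 : ℕ))) := by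
  have hr1 := ratio_lt_one hk5
  set r : ℝ := (k : ℝ) / 7 with hr
  have hr0 : 0 ≤ r := by positivity
  have hr2 : 0 ≤ (1 - r)⁻¹ := inv_nonneg.2 (by linarith)
  set S₀ := ∑ l ∈ Finset.range k, ‖e l‖ with hS₀
  have hS₀0 : 0 ≤ S₀ := Finset.sum_nonneg fun _ _ => norm_nonneg _
  have hs := sigmaL_pos hk3 hk5
  have hc0 : 0 ≤ c := le_trans (by positivity) hc
  have hstart : ‖e (k - 1)‖ ≤ S₀ :=
    Finset.single_le_sum (f := fun l => ‖e l‖) (fun _ _ => norm_nonneg _)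
      (Finset.mem_range.2 (by omega))
  -- The first part is the truncation error, with the geometric series of `θ` already summed. The
  -- second is the starting effect, whose own sum over `p` is at most `(1 - r)⁻¹`.
  let w : ℕ → ℝ := fun p => 2 * τ * (Cθ * (1 - r)⁻¹ * Ξ) + 4 * Cs * S₀ * r ^ p
  have hw : ∀ p, 0 ≤ w p := fun p => by positivity
  have hG := gronwall_running_max (E := fun p => ‖e (k + p)‖) (w := w) (S := ‖e (k - 1)‖)
    (c := c * τ) (M₀ := M + 1) (fun p => norm_nonneg _) hw (norm_nonneg _) (by positivity) hcτ
    (fun n hn => ?_) (Nat.lt_succ_self M)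
  · refine hG.trans (mul_le_mul_of_nonneg_left ?_ (Real.exp_pos _).le)
    simp only [w]
    rw [Finset.sum_add_distrib, Finset.sum_const, Finset.card_range, nsmul_eq_mul,
      ← Finset.mul_sum]
    have := mul_le_mul_of_nonneg_left (sum_geometric_le hr0 hr1 (M + 1))
      (by positivity : 0 ≤ 4 * Cs * S₀)
    linarith
  · have hest := norm_sq_estimate hL hk3 hk5 hτ e g ξ (n + 1) fun p hp => h p (by omega)
    rw [show k + (n + 1) - 1 = k + n by omega] at hest
    have i1 : τ * ∑ p ∈ Finset.range (n + 1), (sigmaL k / 25 * ‖e (k + p)‖ ^ 2 +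
        400 / sigmaL k ^ 3 * ‖g p‖ ^ 2) ≤
        c * τ * ∑ p ∈ Finset.range (n + 1), ‖e (k + p)‖ ^ 2 := by
      rw [mul_comm c, mul_assoc]
      refine mul_le_mul_of_nonneg_left ?_ hτ.le
      rw [Finset.mul_sum]
      refine Finset.sum_le_sum fun p hp => ?_
      have hp' := Finset.mem_range.1 hp
      have h1 : ‖g p‖ ^ 2 ≤ a ^ 2 * ‖e (k + p)‖ ^ 2 := by
        rw [← mul_pow]; exact pow_le_pow_left₀ (norm_nonneg _) (hg p (by omega)) 2
      have h2 := mul_le_mul_of_nonneg_left h1 (by positivity : 0 ≤ 400 / sigmaL k ^ 3)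
      have h3 := mul_le_mul_of_nonneg_right hc (sq_nonneg ‖e (k + p)‖)
      linarith
    have i2 : ∀ p ∈ Finset.range (n + 1), ∑ i ∈ Finset.range (p + 1),
        docKernel k (p - i) * ⟪e (k + p), ξ i⟫_ℝ ≤ ‖e (k + p)‖ * (Cθ * (1 - r)⁻¹ * Ξ) := by
      intro p hp
      have hp' := Finset.mem_range.1 hp
      calc _ ≤ ∑ i ∈ Finset.range (p + 1), Cθ * r ^ (p - i) * (‖e (k + p)‖ * Ξ) := by
            refine Finset.sum_le_sum fun i hi => ?_
            have hi' := Finset.mem_range.1 hi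
            refine (le_abs_self _).trans ?_
            rw [abs_mul]
            refine mul_le_mul (hθ _) ((abs_real_inner_le_norm _ _).trans ?_) (abs_nonneg _)
              (by positivity)
            exact mul_le_mul_of_nonneg_left (hξ i (by omega)) (norm_nonneg _)
        _ = (∑ i ∈ Finset.range (p + 1), r ^ i) * (‖e (k + p)‖ * (Cθ * Ξ)) := by
            rw [← Finset.sum_range_reflect, Finset.sum_mul]
            refine Finset.sum_congr rfl fun i hi => ?_
            have hi' := Finset.mem_range.1 hi
            rw [show p - (p + 1 - 1 - i) = i by omega]
            ring
        _ ≤ (1 - r)⁻¹ * (‖e (k + p)‖ * (Cθ * Ξ)) :=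
            mul_le_mul_of_nonneg_right (sum_geometric_le hr0 hr1 _) (by positivity)
        _ = _ := by ring
    have i3 : ∀ p ∈ Finset.range (n + 1), -∑ l ∈ Finset.Icc 1 (k - 1),
        startWeight k l (k + p) * ⟪backDiff e l, e (k + p)⟫_ℝ ≤
          ‖e (k + p)‖ * (2 * Cs * S₀ * r ^ p) := by
      intro p hp
      rw [← Finset.sum_neg_distrib]
      calc _ ≤ ∑ l ∈ Finset.Icc 1 (k - 1), Cs * r ^ p * (‖backDiff e l‖ * ‖e (k + p)‖) := by
            refine Finset.sum_le_sum fun l hl => ?_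
            refine (neg_le_abs _).trans ?_
            rw [abs_mul]
            have h1 := hW l (k + p) (Finset.mem_Icc.1 hl).2 (by omega)
            rw [Nat.add_sub_cancel_left] at h1
            exact mul_le_mul h1 (abs_real_inner_le_norm _ _) (abs_nonneg _) (by positivity)
        _ = Cs * r ^ p * ‖e (k + p)‖ * ∑ l ∈ Finset.Icc 1 (k - 1), ‖backDiff e l‖ := by
            rw [Finset.mul_sum]
            exact Finset.sum_congr rfl fun l _ => by ring
        _ ≤ Cs * r ^ p * ‖e (k + p)‖ * (2 * S₀) :=
            mul_le_mul_of_nonneg_left (norm_backDiff_le e k) (by positivity)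
        _ = _ := by ring
    have j2 := mul_le_mul_of_nonneg_left (Finset.sum_le_sum i2) (by positivity : 0 ≤ 2 * τ)
    have j3 := Finset.sum_le_sum i3
    rw [Finset.sum_neg_distrib] at j3
    have j4 : ∑ p ∈ Finset.range (n + 1), ‖e (k + p)‖ * w p =
        2 * τ * (∑ p ∈ Finset.range (n + 1), ‖e (k + p)‖ * (Cθ * (1 - r)⁻¹ * Ξ)) +
        2 * ∑ p ∈ Finset.range (n + 1), ‖e (k + p)‖ * (2 * Cs * S₀ * r ^ p) := by
      rw [Finset.mul_sum, Finset.mul_sum, ← Finset.sum_add_distrib]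
      exact Finset.sum_congr rfl fun p _ => by simp only [w]; ring
    rw [j4]
    linarith

/-! ### Combining stability, boundedness and consistency -/

/-- Links the Gronwall constant obtained above to the prescribed `c₄`: with `10 ^ 4` for `𝔪_{2k}`,
both the constant term and the coefficient of `a²` are large enough. -/
lemma le_c4 {k : ℕ} (hk3 : 3 ≤ k) (hk5 : k ≤ 5) (a : ℝ) :
    sigmaL k / 25 + 400 / sigmaL k ^ 3 * a ^ 2 ≤ c4 k (10 ^ 4) a := by
  have ha := sq_nonneg a
  interval_cases k <;> norm_num [c4, m1, m3, sigmaL, rho] <;> linarith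

lemma bdf_sub {V : Type*} [AddCommGroup V] [Module ℝ V] (k : ℕ) (τ : ℝ) (u v : ℕ → V) (n : ℕ) :
    bdf k τ (fun j => u j - v j) n = bdf k τ u n - bdf k τ v n := by
  rw [bdf, bdf, bdf, ← smul_sub, ← Finset.sum_sub_distrib]
  congr 1
  refine Finset.sum_congr rfl fun j _ => ?_
  rw [← smul_sub]
  congr 1
  simp only [backDiff]
  abel

lemma coef_linear_part (hL : ∀ i, 0 < L i) {u : L2 L} (h1 : InH2 L u)
    (h2 : InH2 L (u + lap L u)) (κ : Fin 2 → ℤ) :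
    coef ((u + lap L u) + lap L (u + lap L u)) κ = (1 - freq L κ) ^ 2 * coef u κ := by
  simp only [coef_add, coef_lap hL h2, coef_lap hL h1]
  ring

lemma abs_cubic_sub_le {ε x y a b : ℝ} (hε : 0 ≤ ε) (hx : |x| ≤ b) (hy : |y| ≤ a) :
    |(x ^ 3 - ε * x) - (y ^ 3 - ε * y)| ≤ c3 ε a b * |x - y| := by
  have e : (x ^ 3 - ε * x) - (y ^ 3 - ε * y) = (x ^ 2 + x * y + y ^ 2 - ε) * (x - y) := by ring
  rw [e, abs_mul]
  refine mul_le_mul_of_nonneg_right ?_ (abs_nonneg _)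
  have hxy : |x| * |y| ≤ b * a := mul_le_mul hx hy (abs_nonneg _) ((abs_nonneg _).trans hx)
  rw [← abs_mul] at hxy
  have hx2 : x ^ 2 ≤ b ^ 2 := sq_le_sq' (abs_le.1 hx).1 (abs_le.1 hx).2
  have hy2 : y ^ 2 ≤ a ^ 2 := sq_le_sq' (abs_le.1 hy).1 (abs_le.1 hy).2
  have h1 := abs_le.1 hxy
  rw [c3, abs_le]
  constructor
  · nlinarith [sq_nonneg (x + y), sq_nonneg x, sq_nonneg y, sq_nonneg a, sq_nonneg b, h1.1,
      (abs_nonneg _).trans hxy]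
  · nlinarith [h1.2]

/-- The nonlinear terms of two chemical potentials are Lipschitz on bounded sets. -/
lemma norm_nonlinear_sub_le {ε a b : ℝ} (hε : 0 ≤ ε) {u w μ ν : L2 L}
    (hu : IsChemicalPotential L ε u μ) (hw : IsChemicalPotential L ε w ν)
    (hub : ∀ᵐ x ∂(cellMeasure L), |u x| ≤ b) (hwb : ∀ᵐ x ∂(cellMeasure L), |w x| ≤ a) :
    ‖(μ - ((u + lap L u) + lap L (u + lap L u))) - (ν - ((w + lap L w) + lap L (w + lap L w)))‖ ≤
      c3 ε a b * ‖u - w‖ := by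
  refine Lp.norm_le_mul_norm_of_ae_le_mul ?_
  set A := (u + lap L u) + lap L (u + lap L u) with hA
  set B := (w + lap L w) + lap L (w + lap L w) with hB
  filter_upwards [hu.2.2, hw.2.2, hub, hwb, Lp.coeFn_sub (μ - A) (ν - B), Lp.coeFn_sub μ A,
    Lp.coeFn_sub ν B, Lp.coeFn_sub u w] with x h1 h2 h3 h4 h5 h6 h7 h8
  rw [h5, h8, Pi.sub_apply, Pi.sub_apply, h6, h7, Pi.sub_apply, Pi.sub_apply, h1, h2,
    Real.norm_eq_abs, Real.norm_eq_abs]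
  refine le_of_eq_of_le ?_ (abs_cubic_sub_le hε h3 h4)
  congr 1
  ring

lemma ae_abs_le_c1 (hL : ∀ i, 0 < L i) {C ε c : ℝ} (hC : 0 ≤ C) (hε : 0 ≤ ε)
    (hS : ∀ u : L2 L, InH2 L u → ∀ᵐ x ∂(cellMeasure L), |u x| ≤ C * (‖u‖ + ‖lap L u‖))
    {u : L2 L} (hu : InH2 L u) (hc : energy L ε u ≤ c) :
    ∀ᵐ x ∂(cellMeasure L), |u x| ≤ c1 L ε (2 * C) c := by
  have h := mul_le_mul_of_nonneg_left (norm_add_norm_lap_le_of_energy_le hL hε hu hc) hC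
  filter_upwards [hS u hu] with x hx
  rw [c1]
  linarith

lemma eLpNorm_top_le {u : L2 L} {C : ℝ} (h : ∀ᵐ x ∂(cellMeasure L), |u x| ≤ C) :
    eLpNorm u ⊤ (cellMeasure L) ≤ ENNReal.ofReal C := by
  rw [eLpNorm_exponent_top]
  exact eLpNormEssSup_le_of_ae_bound h

/-- The energy of a solution of the PFC equation does not exceed its initial energy. -/
lemma energy_solution_le (hL : ∀ i, 0 < L i) {ε T : ℝ} (hε : 0 ≤ ε) (hT : 0 < T) {m : ℕ}
    (hm : 1 ≤ m) {Φ : ℝ → L2 L}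
    (hΦ : ContDiffOn ℝ ((m + 1 : ℕ) : WithTop ℕ∞) Φ (Set.Icc 0 T))
    (hsol : IsPFCSolution L ε T Φ) {t : ℝ} (ht : t ∈ Set.Icc 0 T) :
    energy L ε (Φ t) ≤ energy L ε (Φ 0) := by
  obtain ⟨D, M, hD0, hD1, hM, hD, hb⟩ := exists_deriv_chain hT hΦ
  have hder : ∀ t ∈ Set.Icc 0 T, HasDerivWithinAt Φ (D 1 t) (Set.Icc 0 T) t := fun t ht => by
    have := hD 0 (Nat.zero_le _) t ht
    rwa [hD0] at this
  refine energy_le_initial hL hε (K := M) (by rw [hD1]; exact hsol) hder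
    (fun t ht => hb 1 (by omega) t ht) (fun r s hr hrs hs => ?_) ht
  have h := norm_sub_taylorSum_le hM 1 D (fun i hi => hD i (hi.trans hm))
    (fun t ht => hb 2 (by omega) t ht) r s hr hrs hs
  refine le_of_eq_of_le ?_ h
  rw [← norm_neg]
  congr 1
  simp only [taylorSum, Finset.sum_range_succ, Finset.sum_range_zero, hD0]
  norm_num
  module

/-- The error estimate in terms of the constants of the stability analysis. -/
lemma norm_solution_sub_le (hL : ∀ i, 0 < L i) {k N n : ℕ} (hk3 : 3 ≤ k) (hk5 : k ≤ 5)
    {ε T τ a b c Cθ Cs M : ℝ} (hε : 0 ≤ ε) (hτ : 0 < τ) (hNT : N * τ = T)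
    (hCθ : 0 ≤ Cθ) (hCs : 0 ≤ Cs) (hM : 0 ≤ M)
    (hθ : ∀ p, |docKernel k p| ≤ Cθ * ((k : ℝ) / 7) ^ p)
    (hW : ∀ l n, l ≤ k - 1 → k ≤ n → |startWeight k l n| ≤ Cs * ((k : ℝ) / 7) ^ (n - k))
    (hc : sigmaL k / 25 + 400 / sigmaL k ^ 3 * c3 ε a b ^ 2 ≤ c) (hcτ : c * τ ≤ 1 / 2)
    {D : ℕ → ℝ → L2 L}
    (hD : ∀ i ≤ k, ∀ t ∈ Set.Icc 0 T, HasDerivWithinAt (D i) (D (i + 1) t) (Set.Icc 0 T) t)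
    (hDM : ∀ t ∈ Set.Icc 0 T, ‖D (k + 1) t‖ ≤ M)
    (hsol : ∀ t ∈ Set.Icc 0 T, ∃ μ : L2 L, IsChemicalPotential L ε (D 0 t) μ ∧
      HasLaplacian L μ (D 1 t))
    (hb : ∀ t ∈ Set.Icc 0 T, ∀ᵐ x ∂(cellMeasure L), |D 0 t x| ≤ b)
    {φ : ℕ → L2 L} (hφ : IsBDFSolution k L ε τ N φ)
    (ha : ∀ j, k ≤ j → j ≤ N → ∀ᵐ x ∂(cellMeasure L), |φ j x| ≤ a)
    (hkn : k ≤ n) (hn : n ≤ N) :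
    ‖D 0 (n * τ) - φ n‖ ≤ Real.exp (2 * (c * τ) * (n - k + 1 : ℕ)) *
      ((1 + 4 * Cs * (1 - (k : ℝ) / 7)⁻¹) * ∑ l ∈ Finset.range k, ‖D 0 (l * τ) - φ l‖ +
        2 * Cθ * (1 - (k : ℝ) / 7)⁻¹ * (30 * 5 ^ 6 * M * τ ^ k) * (τ * (n - k + 1 : ℕ))) := by
  have htime : ∀ p ≤ n - k, ((k + p : ℕ) : ℝ) * τ ∈ Set.Icc 0 T := fun p hp => by
    refine ⟨by positivity, ?_⟩
    rw [← hNT]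
    exact mul_le_mul_of_nonneg_right (by exact_mod_cast (by omega : k + p ≤ N)) hτ.le
  -- Potentials are chosen for every `p`, with no content beyond `n - k`, so that they form
  -- sequences.
  have h1 : ∀ p, ∃ μ : L2 L, p ≤ n - k →
      IsChemicalPotential L ε (D 0 ((k + p : ℕ) * τ)) μ ∧
        HasLaplacian L μ (D 1 ((k + p : ℕ) * τ)) := fun p => by
    by_cases hp : p ≤ n - k
    · obtain ⟨μ, h⟩ := hsol _ (htime p hp)
      exact ⟨μ, fun _ => h⟩
    · exact ⟨0, fun h => absurd h hp⟩
  have h2 : ∀ p, ∃ ν : L2 L, p ≤ n - k → IsChemicalPotential L ε (φ (k + p)) ν ∧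
      HasLaplacian L ν (bdf k τ φ (k + p)) := fun p => by
    by_cases hp : p ≤ n - k
    · obtain ⟨ν, h⟩ := hφ (k + p) (by omega) (by omega)
      exact ⟨ν, fun _ => h⟩
    · exact ⟨0, fun h => absurd h hp⟩
  choose μ hμ using h1
  choose ν hν using h2
  -- Subtracting `(1 + Δ)²` leaves the nonlinear part of each potential, which plays the role of `g`
  -- in the stability estimate; the truncation error plays the role of `ξ`.
  let A : L2 L → L2 L := fun u => (u + lap L u) + lap L (u + lap L u)
  have key := norm_error_le hL hk3 hk5 hτ (a := c3 ε a b) (c := c) (Ξ := 30 * 5 ^ 6 * M * τ ^ k)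
    (by positivity) hCθ hCs hθ hW hc hcτ (fun j => D 0 (j * τ) - φ j)
    (fun p => (μ p - A (D 0 ((k + p : ℕ) * τ))) - (ν p - A (φ (k + p))))
    (fun p => bdf k τ (fun j => D 0 (j * τ)) (k + p) - D 1 ((k + p : ℕ) * τ)) (n - k)
    (fun p hp κ => ?_) (fun p hp => ?_) (fun p hp => ?_)
  · simpa only [Nat.add_sub_cancel' hkn] using key
  · obtain ⟨i1, i2⟩ := hμ p hp
    obtain ⟨j1, j2⟩ := hν p hp
    rw [bdf_sub]
    simp only [coef_sub, A, coef_linear_part hL i1.1 i1.2.1, coef_linear_part hL j1.1 j1.2.1,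
      (hasLaplacian_iff_coef hL).1 i2, (hasLaplacian_iff_coef hL).1 j2]
    ring
  · exact norm_nonlinear_sub_le hε (hμ p hp).1 (hν p hp).1 (hb _ (htime p hp))
      (ha _ (by omega) (by omega))
  · exact norm_bdf_sub_le hk3 hk5 (by omega) hM hτ (htime p hp).2 hD hDM

end PFC

end

theorem mainTheorem3 :
    -- constants depending on `k` only
    ∃ m2 cI : ℕ → ℝ,
      (∀ k : ℕ, 3 ≤ k → k ≤ 5 →
        0 < m2 k ∧
        (∀ (m : ℕ) (lam : ℝ),
          Module.End.HasEigenvalue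
            (Matrix.toLin' ((PFC.bdfMatrix k m).transpose * PFC.bdfMatrix k m)) lam →
          lam ≤ m2 k) ∧
        1 < cI k ∧
        (∀ (v : ℕ → ℝ) (n : ℕ), k ≤ n →
          |PFC.startingEffect k v n| ≤
            cI k * PFC.rho k / 8 * ((k : ℝ) / 7) ^ (n - k) *
              ∑ l ∈ Finset.Icc 1 (k - 1), |PFC.backDiff v l|)) ∧
      ∀ L : Fin 2 → ℝ, (∀ i, 0 < L i) →
        -- the embedding constant depends on the domain only
        ∃ cΩ : ℝ, 0 < cΩ ∧
          (∀ v : PFC.L2 L, PFC.InH2 L v →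
            eLpNorm v ⊤ (PFC.cellMeasure L) ≤ ENNReal.ofReal (cΩ * (‖v‖ + ‖PFC.lap L v‖))) ∧
          ∀ ε : ℝ, 0 < ε → ε < 1 →
            -- the bound of the exact solution depends on the problem and the initial data only
            ∀ Φ₀ : PFC.L2 L, ∃ c₂ : ℝ, 0 < c₂ ∧
              ∀ k : ℕ, 3 ≤ k → k ≤ 5 →
                ∀ T : ℝ, 0 < T → ∀ Φ : ℝ → PFC.L2 L,
                  Φ 0 = Φ₀ →
                  ContDiffOn ℝ ((k + 1 : ℕ) : WithTop ℕ∞) Φ (Set.Icc 0 T) →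
                  PFC.IsPFCSolution L ε T Φ →
                  (∀ t ∈ Set.Icc 0 T,
                    eLpNorm (Φ t) ⊤ (PFC.cellMeasure L) ≤ ENNReal.ofReal c₂) ∧
                  ∃ Cφ : ℝ, 0 < Cφ ∧
                    ∀ (c₀ : ℝ) (N : ℕ) (τ : ℝ) (φ : ℕ → PFC.L2 L),
                      0 < N → τ = T / N →
                      PFC.AssumptionA2 k L ε τ φ c₀ →
                      PFC.IsBDFSolution k L ε τ N φ →
                      τ ≤ 1 / (2 * PFC.c4 k (m2 k) (PFC.c3 ε (PFC.c1 L ε cΩ c₀) c₂)) →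
                      ∀ n : ℕ, k ≤ n → n ≤ N →
                        ‖Φ (n * τ) - φ n‖ ≤
                          7 * PFC.rho k / (7 - (k : ℝ)) *
                            Real.exp (2 * PFC.c4 k (m2 k) (PFC.c3 ε (PFC.c1 L ε cΩ c₀) c₂) *
                              (((n - k + 1 : ℕ) : ℝ) * τ)) *
                            (cI k * ∑ l ∈ Finset.range k, ‖Φ (l * τ) - φ l‖ +
                              Cφ * (((n - k + 1 : ℕ) : ℝ) * τ) * τ ^ k) := by
  have hex : ∀ k : ℕ, ∃ Cs : ℝ, 3 ≤ k → k ≤ 5 → 0 ≤ Cs ∧ ∀ l n, l ≤ k - 1 → k ≤ n →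
      |PFC.startWeight k l n| ≤ Cs * ((k : ℝ) / 7) ^ (n - k) := fun k => by
    by_cases h : 3 ≤ k ∧ k ≤ 5
    · obtain ⟨C, hC⟩ := PFC.exists_abs_startWeight_le h.1 h.2
      exact ⟨C, fun _ _ => hC⟩
    · exact ⟨0, fun h3 h5 => absurd ⟨h3, h5⟩ h⟩
  choose Cs hCs using hex
  have hrho : ∀ k, 3 ≤ k → k ≤ 5 → 10 / 3 ≤ PFC.rho k := fun k hk3 hk5 => by
    interval_cases k <;> norm_num [PFC.rho]
  -- The factor `14` is `4 (1 - k/7)⁻¹ ≤ 4 · 7/2` from the stability estimate, and it also gives `Cs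
  -- ≤ c_I ρ_k / 8` because `ρ_k ≥ 10/3`. The `2` ensures `c_I > 1` and covers the initial error.
  refine ⟨fun _ => 10 ^ 4, fun k => 2 + 14 * Cs k, fun k hk3 hk5 => ⟨by norm_num,
    fun m lam h => (PFC.eigenvalue_bdfMatrix_le hk3 hk5 h).trans (by norm_num), ?_, ?_⟩, ?_⟩
  · linarith [(hCs k hk3 hk5).1]
  · intro v n hn
    obtain ⟨h0, h1⟩ := hCs k hk3 hk5
    refine (PFC.abs_startingEffect_le h1 v hn).trans ?_
    refine mul_le_mul_of_nonneg_right (mul_le_mul_of_nonneg_right ?_ (by positivity))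
      (Finset.sum_nonneg fun _ _ => abs_nonneg _)
    nlinarith [hrho k hk3 hk5]
  intro L hL
  obtain ⟨C, hC, hS⟩ := PFC.exists_sobolev hL
  -- Twice the embedding constant, to absorb the factor `2` in `norm_add_norm_lap_le_of_energy_le`.
  refine ⟨2 * C, by positivity, fun v hv => PFC.eLpNorm_top_le ?_, ?_⟩
  · filter_upwards [hS v hv] with x hx
    nlinarith [norm_nonneg v, norm_nonneg (PFC.lap L v)]
  intro ε hε0 hε1 Φ₀
  have hc1 : 0 ≤ PFC.c1 L ε (2 * C) (PFC.energy L ε Φ₀) :=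
    mul_nonneg (by positivity) (Real.sqrt_nonneg _)
  -- By energy dissipation the sup bound depends only on the initial energy, not on `T`, `k` or the
  -- solution; adding `1` makes it positive.
  refine ⟨PFC.c1 L ε (2 * C) (PFC.energy L ε Φ₀) + 1, by positivity, ?_⟩
  set c₂ := PFC.c1 L ε (2 * C) (PFC.energy L ε Φ₀) + 1
  intro k hk3 hk5 T hT Φ hΦ0 hΦ hsol
  have hbound : ∀ t ∈ Set.Icc 0 T, ∀ᵐ x ∂(PFC.cellMeasure L), |Φ t x| ≤ c₂ := fun t ht => by
    have hE := PFC.energy_solution_le hL hε0.le hT (by omega) hΦ hsol ht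
    rw [hΦ0] at hE
    filter_upwards [PFC.ae_abs_le_c1 hL hC.le hε0.le hS (hsol t ht).choose_spec.1.1 hE] with x hx
    exact hx.trans (le_add_of_nonneg_right zero_le_one)
  refine ⟨fun t ht => PFC.eLpNorm_top_le (hbound t ht), ?_⟩
  obtain ⟨D, M, hD0, hD1, hM, hD, hDM⟩ := PFC.exists_deriv_chain hT hΦ
  obtain ⟨Cθ, hCθ, hθ⟩ := PFC.exists_abs_docKernel_le hk3 hk5
  obtain ⟨hCs0, hW⟩ := hCs k hk3 hk5
  have hk5' : (k : ℝ) ≤ 5 := by exact_mod_cast hk5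
  have hr : 0 < 1 - (k : ℝ) / 7 := by linarith
  have hrinv : (1 - (k : ℝ) / 7)⁻¹ ≤ 7 / 2 := by
    rw [inv_le_comm₀ hr (by norm_num)]
    linarith
  refine ⟨2 * Cθ * (1 - (k : ℝ) / 7)⁻¹ * (30 * 5 ^ 6 * M) + 1, by positivity, ?_⟩
  intro c₀ N τ φ hN hτN hA2 hBDF hτc n hkn hn
  have hN' : (0 : ℝ) < N := by exact_mod_cast hN
  have hτ : 0 < τ := hτN ▸ div_pos hT hN'
  have hNT : N * τ = T := by rw [hτN]; field_simp
  set a₃ := PFC.c3 ε (PFC.c1 L ε (2 * C) c₀) c₂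
  have hc := PFC.le_c4 hk3 hk5 a₃
  set c := PFC.c4 k (10 ^ 4) a₃
  have hc0 : 0 < c := lt_of_lt_of_le (by have := PFC.sigmaL_pos hk3 hk5; positivity) hc
  have hcτ : c * τ ≤ 1 / 2 := by
    rw [le_div_iff₀ (by positivity)] at hτc
    linarith
  have key := PFC.norm_solution_sub_le hL hk3 hk5 hε0.le hτ hNT hCθ hCs0 hM hθ hW hc hcτ hD
    (hDM (k + 1) le_rfl) (by rw [hD0, hD1]; exact hsol) (by rw [hD0]; exact hbound) hBDF
    (fun j hkj hj => by
      obtain ⟨h1, h2⟩ := PFC.energy_le_of_scheme hL hk3 hk5 hε0 hε1 hτ hA2 hBDF hkj hj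
      exact PFC.ae_abs_le_c1 hL hC.le hε0.le hS h1 h2) hkn hn
  rw [hD0] at key
  refine key.trans ?_
  have hS0 : 0 ≤ ∑ l ∈ Finset.range k, ‖Φ (l * τ) - φ l‖ :=
    Finset.sum_nonneg fun _ _ => norm_nonneg _
  set S₀ := ∑ l ∈ Finset.range k, ‖Φ (l * τ) - φ l‖
  set m : ℝ := ((n - k + 1 : ℕ) : ℝ)
  have hm : 0 ≤ m := Nat.cast_nonneg _
  -- The estimate already holds without the prefactor, so it suffices that the prefactor is at least
  -- `1`.
  have hfac : 1 ≤ 7 * PFC.rho k / (7 - (k : ℝ)) := by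
    rw [one_le_div (by linarith)]
    linarith [hrho k hk3 hk5, (Nat.cast_nonneg k : (0 : ℝ) ≤ k)]
  have hexp : Real.exp (2 * (c * τ) * m) = Real.exp (2 * c * (m * τ)) := by
    congr 1; ring
  rw [hexp, mul_assoc (7 * PFC.rho k / (7 - (k : ℝ)))]
  set Ex := Real.exp (2 * c * (m * τ))
  have hEx : 0 < Ex := Real.exp_pos _
  set Q := 2 * Cθ * (1 - (k : ℝ) / 7)⁻¹ * (30 * 5 ^ 6 * M) with hQ
  have hQ0 : 0 ≤ Q := by positivity
  have hin : (1 + 4 * Cs k * (1 - (k : ℝ) / 7)⁻¹) * S₀ +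
      2 * Cθ * (1 - (k : ℝ) / 7)⁻¹ * (30 * 5 ^ 6 * M * τ ^ k) * (τ * m) ≤
      (2 + 14 * Cs k) * S₀ + (Q + 1) * (m * τ) * τ ^ k := by
    refine add_le_add (mul_le_mul_of_nonneg_right ?_ hS0) ?_
    · nlinarith
    · have : 0 ≤ m * τ * τ ^ k := by positivity
      calc _ = Q * (m * τ * τ ^ k) := by rw [hQ]; ring
        _ ≤ (Q + 1) * (m * τ * τ ^ k) := mul_le_mul_of_nonneg_right (by linarith) this
        _ = _ := by ring
  have hR : 0 ≤ Ex * ((2 + 14 * Cs k) * S₀ + (Q + 1) * (m * τ) * τ ^ k) := by positivity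
  exact (mul_le_mul_of_nonneg_left hin hEx.le).trans (le_mul_of_one_le_left hR hfac)
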